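/- Let $G$ be a Lie groupoid over a (Hausdorff, second countable, finite-dimensional, boundaryless) smooth manifold $M$, with source and target maps $s,t$; the manifold of arrows is finite-dimensional and boundaryless but need not be Hausdorff or second countable. For $k\ge 0$ let $G_k$ be the manifold of strings $(g_1,\dots,g_k)$ of composable arrows, $s(g_i)=t(g_{i+1})$, with $t(g_1,\dots,g_k)=t(g_1)$, and $G_0=M$. Let $C^k(G)=C^\infty(G_k)$, with the differential $$\delta f(g_1,\dots,g_{k+1})=(-1)^k\Big\{f(g_2,\dots,g_{k+1})+\sum_{i=1}^k(-1)^i f(g_1,\dots,g_ig_{i+1},\dots,g_{k+1})+(-1)^{k+1}f(g_1,\dots,g_k)\Big\}$$ (for $k=0$: $\delta f(g)=f(s(g))-f(t(g))$). For a bounded graded real vector bundle $E=\bigoplus_{l\in\mathbb Z}E^l$ over $M$, of finite rank in each degree, let $C^k(G;E^l)=\Gamma(G_k,t^*E^l)$, $C(G;E)=\bigoplus_{k,l}C^k(G;E^l)$ and $C(G;E)^n=\bigoplus_{k+l=n}C^k(G;E^l)$, with the right action of $C^\bullet(G)$ given, for $\eta\in C^k(G;E^l)$ and $f\in C^{m}(G)$,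 by $$(\eta\star f)(g_1,\dots,g_{k+m})=(-1)^{km}\,\eta(g_1,\dots,g_k)\,f(g_{k+1},\dots,g_{k+m}).$$ A representation up to homotopy of $G$ is such an $E$ together with a linear operator $D:C(G;E)^\bullet\to C(G;E)^{\bullet+1}$ such that $D^2=0$ and $D(\eta\star f)=D(\eta)\star f+(-1)^{n}\eta\star\delta(f)$ for $\eta\in C(G;E)^n$, $f\in C^\bullet(G)$. A morphism $\Phi:E\to F$ is a $C^\bullet(G)$-linear map $C(G;E)^\bullet\to C(G;F)^\bullet$ of degree zero which commutes with the structure operators. The component of $D$ of bidegree $(0,1)$ on $C^0(G;E)=\Gamma(E)$ is a vector bundle map $\partial:E^\bullet\to E^{\bullet+1}$ with $\partial^2=0$, and the component of $\Phi$ of bidegree $(0,0)$ on $C^0(G;E)$ is a map $\Phi_0:(E,\partial)\to(F,\partial)$ of complexes of vector bundles. $\Phi$ is a quasi-isomorphism if for every $x\in M$ the map $\Phi_{0,x}:(E_x,\partial_x)\to(F_x,\partial_x)$ induces isomorphisms in cohomology in all degrees. Two morphisms $\Phi,\Psi:E\to F$ are homotopic if there is a $C^\bullet(G)$-linear map $H:C(G;E)\to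 C(G;F)$ lowering the total degree by one such that $\Phi-\Psi=D_FH+HD_E$. A morphism $\Phi:E\to F$ is a homotopy equivalence if there is a morphism $\Psi:F\to E$ such that $\Psi\Phi$ is homotopic to $\mathrm{id}_E$ and $\Phi\Psi$ is homotopic to $\mathrm{id}_F$. Then every quasi-isomorphism $\Phi:E\to F$ between two representations up to homotopy of $G$ is a homotopy equivalence. -/

import Mathlib

open Bundle Manifold
open scoped ContDiff Manifold Topology

noncomputable section

universe uM uG u₁ u₂ u₃ u₄ v₁ v₂ v₃ v₄ v₅ v₆

/-! ### Maps into finite products of manifolds -/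

section PiManifold

variable {EM : Type u₁} [NormedAddCommGroup EM] [NormedSpace ℝ EM]
  {HN : Type u₃} [TopologicalSpace HN] {EN : Type u₄} [NormedAddCommGroup EN] [NormedSpace ℝ EN]
  {J : ModelWithCorners ℝ EN HN}
  {N : Type v₁} [TopologicalSpace N] [ChartedSpace HN N]
  {G : Type uG} [TopologicalSpace G] [ChartedSpace EM G]

/-- The model of the product manifold `G ^ k`. -/
abbrev powModel (EM : Type u₁) [NormedAddCommGroup EM] [NormedSpace ℝ EM] (k : ℕ) :
    ModelWithCorners ℝ (Fin k → EM) (ModelPi fun _ : Fin k => EM) :=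
  ModelWithCorners.pi fun _ : Fin k => 𝓘(ℝ, EM)

theorem contMDiffWithinAt_powModel {k : ℕ} {f : N → Fin k → G} {S : Set N} {x : N}
    (hf : ∀ i, ContMDiffWithinAt J 𝓘(ℝ, EM) ∞ (fun y => f y i) S x) :
    ContMDiffWithinAt J (powModel EM k) ∞ f S x := by
  rw [contMDiffWithinAt_iff]
  refine ⟨continuousWithinAt_pi.2 fun i => (hf i).continuousWithinAt, ?_⟩
  rw [contDiffWithinAt_pi]
  intro i
  exact (contMDiffWithinAt_iff.1 (hf i)).2

theorem contMDiff_powModel_apply {k : ℕ} (i : Fin k) :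
    ContMDiff (powModel EM k) 𝓘(ℝ, EM) ∞ (fun g : Fin k → G => g i) := by
  intro g
  rw [← contMDiffWithinAt_univ, contMDiffWithinAt_iff]
  refine ⟨(continuous_apply i).continuousWithinAt, ?_⟩
  have h : ContDiffWithinAt ℝ ∞ (fun v : Fin k → EM => v i)
      ((extChartAt (powModel EM k) g).symm ⁻¹' Set.univ ∩ Set.range (powModel EM k))
      (extChartAt (powModel EM k) g g) := (contDiff_apply ℝ EM i).contDiffWithinAt
  refine h.congr_of_eventuallyEq_of_mem ?_ (by simp)
  have hmem : (extChartAt (powModel EM k) g).target ∈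
      𝓝[(extChartAt (powModel EM k) g).symm ⁻¹' Set.univ ∩ Set.range (powModel EM k)]
        (extChartAt (powModel EM k) g g) := by
    simpa using extChartAt_target_mem_nhdsWithin (I := powModel EM k) g
  filter_upwards [hmem] with v hv
  have := congrFun ((extChartAt (powModel EM k) g).right_inv hv) i
  exact this

end PiManifold

/-! ### Lie groupoids -/

/-- A Lie groupoid with manifold of objects `M` and manifold of arrows `G`.  An arrow `g` goes from
`src g` to `tgt g`, and the product `mul g h` is meaningful when `src g = tgt h`; the values of
`mul` on other pairs are irrelevant and never used. -/
structure LieGroupoid (EM : Type u₁) [NormedAddCommGroup EM] [NormedSpace ℝ EM]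
    (M : Type uM) [TopologicalSpace M] [ChartedSpace EM M]
    (EG : Type u₂) [NormedAddCommGroup EG] [NormedSpace ℝ EG]
    (G : Type uG) [TopologicalSpace G] [ChartedSpace EG G] where
  src : G → M
  tgt : G → M
  unit : M → G
  inv : G → G
  mul : G → G → G
  src_submersion : IsSubmersion 𝓘(ℝ, EG) 𝓘(ℝ, EM) ∞ src
  src_surjective : Function.Surjective src
  tgt_submersion : IsSubmersion 𝓘(ℝ, EG) 𝓘(ℝ, EM) ∞ tgt
  tgt_surjective : Function.Surjective tgt
  unit_smooth : ContMDiff 𝓘(ℝ, EM) 𝓘(ℝ, EG) ∞ unit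
  inv_smooth : ContMDiff 𝓘(ℝ, EG) 𝓘(ℝ, EG) ∞ inv
  mul_smooth : ContMDiffOn (𝓘(ℝ, EG).prod 𝓘(ℝ, EG)) 𝓘(ℝ, EG) ∞
    (fun p : G × G => mul p.1 p.2) {p | src p.1 = tgt p.2}
  src_unit : ∀ x, src (unit x) = x
  tgt_unit : ∀ x, tgt (unit x) = x
  src_inv : ∀ g, src (inv g) = tgt g
  tgt_inv : ∀ g, tgt (inv g) = src g
  src_mul : ∀ g h, src g = tgt h → src (mul g h) = src h
  tgt_mul : ∀ g h, src g = tgt h → tgt (mul g h) = tgt g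
  mul_assoc : ∀ g h k, src g = tgt h → src h = tgt k → mul (mul g h) k = mul g (mul h k)
  unit_mul : ∀ g, mul (unit (tgt g)) g = g
  mul_unit : ∀ g, mul g (unit (src g)) = g
  inv_mul : ∀ g, mul (inv g) g = unit (src g)
  mul_inv : ∀ g, mul g (inv g) = unit (tgt g)

/-- A bounded graded smooth real vector bundle of finite rank in each degree.  `Fib l x` is the
fibre at `x` of the degree `l` component, whose typical fibre is `Modelel l`. -/
structure GradedVectorBundle (EM : Type u₁) [NormedAddCommGroup EM] [NormedSpace ℝ EM]
    (M : Type uM) [TopologicalSpace M] [ChartedSpace EM M] where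
  Model : ℤ → Type v₁
  Fib : ℤ → M → Type v₂
  [modNormed : ∀ l, NormedAddCommGroup (Model l)]
  [modSpace : ∀ l, NormedSpace ℝ (Model l)]
  [modFinite : ∀ l, FiniteDimensional ℝ (Model l)]
  [fibAdd : ∀ l x, AddCommGroup (Fib l x)]
  [fibModule : ∀ l x, Module ℝ (Fib l x)]
  [fibTop : ∀ l x, TopologicalSpace (Fib l x)]
  [totTop : ∀ l, TopologicalSpace (TotalSpace (Model l) (Fib l))]
  [fiberBundle : ∀ l, FiberBundle (Model l) (Fib l)]
  [vectorBundle : ∀ l, VectorBundle ℝ (Model l) (Fib l)]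
  [smoothBundle : ∀ l, ContMDiffVectorBundle ∞ (Model l) (Fib l) 𝓘(ℝ, EM)]
  bounded : ∃ a b : ℤ, ∀ l, l < a ∨ b < l → ∀ x, Subsingleton (Fib l x)

attribute [instance] GradedVectorBundle.modNormed GradedVectorBundle.modSpace
  GradedVectorBundle.modFinite GradedVectorBundle.fibAdd GradedVectorBundle.fibModule
  GradedVectorBundle.fibTop GradedVectorBundle.totTop GradedVectorBundle.fiberBundle
  GradedVectorBundle.vectorBundle GradedVectorBundle.smoothBundle

section Groupoid

variable {EM : Type u₁} [NormedAddCommGroup EM] [NormedSpace ℝ EM]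
  {M : Type uM} [TopologicalSpace M] [ChartedSpace EM M]
  {EG : Type u₂} [NormedAddCommGroup EG] [NormedSpace ℝ EG]
  {G : Type uG} [TopologicalSpace G] [ChartedSpace EG G]

namespace LieGroupoid

/-! ### Strings of composable arrows -/

/-- The vertices of `(x, (g₁, …, g_k))`: `vertex 0 = x` and `vertex i = src g_i` for `1 ≤ i`. -/
def vertex (𝒢 : LieGroupoid EM M EG G) {k : ℕ} (p : M × (Fin k → G)) : Fin (k + 1) → M :=
  Fin.cons p.1 fun i => 𝒢.src (p.2 i)

/-- The manifold `G_k` of strings of `k` composable arrows, embedded in `M × G ^ k` as the set of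
all `(x, (g₁, …, g_k))` with `tgt g₁ = x` and `tgt g_{i+1} = src g_i`.  The target map `G_k → M` is
the first projection.  In particular `G_0 = M`. -/
def strings (𝒢 : LieGroupoid EM M EG G) (k : ℕ) : Set (M × (Fin k → G)) :=
  {p | ∀ i : Fin k, 𝒢.tgt (p.2 i) = 𝒢.vertex p i.castSucc}

/-- The string without arrows at `x`. -/
def objString (𝒢 : LieGroupoid EM M EG G) (x : M) : 𝒢.strings 0 :=
  ⟨(x, Fin.elim0), fun i => i.elim0⟩

/-- `(g₁, …, g_{k+m}) ↦ (g₁, …, g_k)`, on the ambient product. -/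
abbrev preFront {k : ℕ} (m : ℕ) (p : M × (Fin (k + m) → G)) : M × (Fin k → G) :=
  (p.1, fun i => p.2 (Fin.castAdd m i))

/-- `(g₁, …, g_{k+m}) ↦ (g_{k+1}, …, g_{k+m})`, on the ambient product. -/
def preBack (𝒢 : LieGroupoid EM M EG G) (k : ℕ) {m : ℕ} (p : M × (Fin (k + m) → G)) :
    M × (Fin m → G) :=
  (𝒢.vertex p ⟨k, by omega⟩, fun i => p.2 (Fin.natAdd k i))

/-- `(g₁, …, g_{k+1}) ↦ (g₂, …, g_{k+1})`, on the ambient product. -/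
def preFaceZero (𝒢 : LieGroupoid EM M EG G) {k : ℕ} (p : M × (Fin (k + 1) → G)) :
    M × (Fin k → G) :=
  (𝒢.src (p.2 0), Fin.tail p.2)

/-- For `j = 0, …, k`, the map `(g₁, …, g_{k+1}) ↦ (g₁, …, g_{j+1} g_{j+2}, …, g_{k+1})`, which for
`j = k` is `(g₁, …, g_{k+1}) ↦ (g₁, …, g_k)`, on the ambient product. -/
def preFaceSucc (𝒢 : LieGroupoid EM M EG G) {k : ℕ} (j : Fin (k + 1))
    (p : M × (Fin (k + 1) → G)) : M × (Fin k → G) :=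
  (p.1, Fin.contractNth j 𝒢.mul p.2)

theorem vertex_succ (𝒢 : LieGroupoid EM M EG G) {k : ℕ} (p : M × (Fin k → G)) (i : Fin k) :
    𝒢.vertex p i.succ = 𝒢.src (p.2 i) := rfl

theorem tgt_of_val_succ (𝒢 : LieGroupoid EM M EG G) {k : ℕ} {p : M × (Fin k → G)}
    (hp : p ∈ 𝒢.strings k) (i j : Fin k) (h : (j : ℕ) = i + 1) :
    𝒢.tgt (p.2 j) = 𝒢.src (p.2 i) := by
  rw [hp j, ← 𝒢.vertex_succ p i]
  congr 1
  ext
  simpa using h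

theorem tgt_of_val_zero (𝒢 : LieGroupoid EM M EG G) {k : ℕ} {p : M × (Fin k → G)}
    (hp : p ∈ 𝒢.strings k) (i : Fin k) (h : (i : ℕ) = 0) : 𝒢.tgt (p.2 i) = p.1 := by
  rw [hp i]
  have : i.castSucc = 0 := by ext; simpa using h
  rw [this]
  rfl

theorem mem_strings_iff (𝒢 : LieGroupoid EM M EG G) {k : ℕ} (p : M × (Fin k → G)) :
    p ∈ 𝒢.strings k ↔ (∀ i : Fin k, (i : ℕ) = 0 → 𝒢.tgt (p.2 i) = p.1) ∧
      ∀ i j : Fin k, (j : ℕ) = i + 1 → 𝒢.tgt (p.2 j) = 𝒢.src (p.2 i) := by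
  refine ⟨fun hp => ⟨𝒢.tgt_of_val_zero hp, 𝒢.tgt_of_val_succ hp⟩, fun hp j => ?_⟩
  rcases k with _ | k
  · exact j.elim0
  refine Fin.cases ?_ (fun i => ?_) j
  · exact hp.1 0 rfl
  · exact hp.2 i.castSucc i.succ (by simp)

theorem preFront_mem (𝒢 : LieGroupoid EM M EG G) {k m : ℕ} {p : M × (Fin (k + m) → G)}
    (hp : p ∈ 𝒢.strings (k + m)) : preFront m p ∈ 𝒢.strings k := by
  rw [mem_strings_iff]
  exact ⟨fun i hi => 𝒢.tgt_of_val_zero hp _ (by simpa using hi),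
    fun i j hij => 𝒢.tgt_of_val_succ hp _ _ (by simpa using hij)⟩

theorem preBack_mem (𝒢 : LieGroupoid EM M EG G) {k m : ℕ} {p : M × (Fin (k + m) → G)}
    (hp : p ∈ 𝒢.strings (k + m)) : 𝒢.preBack k p ∈ 𝒢.strings m := by
  rw [mem_strings_iff]
  refine ⟨fun i hi => ?_, fun i j hij => 𝒢.tgt_of_val_succ hp _ _ (by simp; omega)⟩
  change 𝒢.tgt (p.2 (Fin.natAdd k i)) = 𝒢.vertex p ⟨k, by omega⟩
  rw [hp]
  congr 1
  ext
  simp [hi]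

theorem preFaceZero_mem (𝒢 : LieGroupoid EM M EG G) {k : ℕ} {p : M × (Fin (k + 1) → G)}
    (hp : p ∈ 𝒢.strings (k + 1)) : 𝒢.preFaceZero p ∈ 𝒢.strings k := by
  rw [mem_strings_iff]
  exact ⟨fun i hi => 𝒢.tgt_of_val_succ hp _ _ (by simp [hi]),
    fun i j hij => 𝒢.tgt_of_val_succ hp _ _ (by simp [hij])⟩

theorem preFaceSucc_mem (𝒢 : LieGroupoid EM M EG G) {k : ℕ} (j : Fin (k + 1))
    {p : M × (Fin (k + 1) → G)} (hp : p ∈ 𝒢.strings (k + 1)) :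
    𝒢.preFaceSucc j p ∈ 𝒢.strings k := by
  have hc : ∀ i : Fin k, 𝒢.src (p.2 i.castSucc) = 𝒢.tgt (p.2 i.succ) := fun i =>
    (𝒢.tgt_of_val_succ hp _ _ (by simp)).symm
  have htgt : ∀ i : Fin k, 𝒢.tgt (Fin.contractNth j 𝒢.mul p.2 i) =
      if (i : ℕ) ≤ j then 𝒢.tgt (p.2 i.castSucc) else 𝒢.tgt (p.2 i.succ) := by
    intro i
    unfold Fin.contractNth
    split_ifs with h1 h2 h3 h3 h4 <;> first | rfl | omega | exact 𝒢.tgt_mul _ _ (hc i)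
  have hsrc : ∀ i : Fin k, 𝒢.src (Fin.contractNth j 𝒢.mul p.2 i) =
      if (i : ℕ) < j then 𝒢.src (p.2 i.castSucc) else 𝒢.src (p.2 i.succ) := by
    intro i
    unfold Fin.contractNth
    split_ifs <;> first | rfl | omega | exact 𝒢.src_mul _ _ (hc i)
  rw [mem_strings_iff]
  refine ⟨fun i hi => ?_, fun i i' hii' => ?_⟩
  · change 𝒢.tgt (Fin.contractNth j 𝒢.mul p.2 i) = p.1
    rw [htgt, if_pos (by omega)]
    exact 𝒢.tgt_of_val_zero hp _ (by simpa using hi)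
  · change 𝒢.tgt (Fin.contractNth j 𝒢.mul p.2 i') = 𝒢.src (Fin.contractNth j 𝒢.mul p.2 i)
    rw [htgt, hsrc]
    by_cases h : (i' : ℕ) ≤ j
    · rw [if_pos h, if_pos (by omega)]
      exact 𝒢.tgt_of_val_succ hp _ _ (by simp [hii'])
    · rw [if_neg h, if_neg (by omega)]
      exact 𝒢.tgt_of_val_succ hp _ _ (by simp [hii'])

abbrev front (𝒢 : LieGroupoid EM M EG G) {k : ℕ} (m : ℕ) (p : 𝒢.strings (k + m)) : 𝒢.strings k :=
  ⟨preFront m p.1, 𝒢.preFront_mem p.2⟩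

def back (𝒢 : LieGroupoid EM M EG G) (k : ℕ) {m : ℕ} (p : 𝒢.strings (k + m)) : 𝒢.strings m :=
  ⟨𝒢.preBack k p.1, 𝒢.preBack_mem p.2⟩

def faceZero (𝒢 : LieGroupoid EM M EG G) {k : ℕ} (p : 𝒢.strings (k + 1)) : 𝒢.strings k :=
  ⟨𝒢.preFaceZero p.1, 𝒢.preFaceZero_mem p.2⟩

def faceSucc (𝒢 : LieGroupoid EM M EG G) {k : ℕ} (j : Fin (k + 1)) (p : 𝒢.strings (k + 1)) :
    𝒢.strings k :=
  ⟨𝒢.preFaceSucc j p.1, 𝒢.preFaceSucc_mem j p.2⟩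

/-! ### The structure maps between the manifolds of strings are smooth -/

variable (EM EG) in
/-- The model of the ambient manifold `M × G ^ k`. -/
abbrev ambient (k : ℕ) :
    ModelWithCorners ℝ (EM × (Fin k → EG)) (ModelProd EM (ModelPi fun _ : Fin k => EG)) :=
  𝓘(ℝ, EM).prod (powModel EG k)

theorem contMDiff_arrow {k : ℕ} (i : Fin k) :
    ContMDiff (ambient EM EG k) 𝓘(ℝ, EG) ∞ (fun p : M × (Fin k → G) => p.2 i) :=
  (contMDiff_powModel_apply i).comp contMDiff_snd

theorem contMDiff_src (𝒢 : LieGroupoid EM M EG G) :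
    ContMDiff 𝓘(ℝ, EG) 𝓘(ℝ, EM) ∞ 𝒢.src := 𝒢.src_submersion.contMDiff

theorem contMDiff_vertex (𝒢 : LieGroupoid EM M EG G) {k : ℕ} (i : Fin (k + 1)) :
    ContMDiff (ambient EM EG k) 𝓘(ℝ, EM) ∞ (fun p : M × (Fin k → G) => 𝒢.vertex p i) := by
  refine Fin.cases ?_ (fun i => ?_) i
  · exact contMDiff_fst
  · exact 𝒢.contMDiff_src.comp (contMDiff_arrow i)

theorem contMDiffOn_preFront (𝒢 : LieGroupoid EM M EG G) (k m : ℕ) :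
    ContMDiffOn (ambient EM EG (k + m)) (ambient EM EG k) ∞
      (preFront m : M × (Fin (k + m) → G) → M × (Fin k → G)) (𝒢.strings (k + m)) := by
  intro p _
  exact contMDiffWithinAt_fst.prodMk
    (contMDiffWithinAt_powModel fun i => (contMDiff_arrow _ _).contMDiffWithinAt)

theorem contMDiffOn_preBack (𝒢 : LieGroupoid EM M EG G) (k m : ℕ) :
    ContMDiffOn (ambient EM EG (k + m)) (ambient EM EG m) ∞
      (𝒢.preBack k : M × (Fin (k + m) → G) → M × (Fin m → G)) (𝒢.strings (k + m)) := by
  intro p _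
  exact (𝒢.contMDiff_vertex _ _).contMDiffWithinAt.prodMk
    (contMDiffWithinAt_powModel fun i => (contMDiff_arrow _ _).contMDiffWithinAt)

theorem contMDiffOn_preFaceZero (𝒢 : LieGroupoid EM M EG G) (k : ℕ) :
    ContMDiffOn (ambient EM EG (k + 1)) (ambient EM EG k) ∞
      (𝒢.preFaceZero : M × (Fin (k + 1) → G) → M × (Fin k → G)) (𝒢.strings (k + 1)) := by
  intro p _
  exact ((𝒢.contMDiff_src.comp (contMDiff_arrow 0)) p).contMDiffWithinAt.prodMk
    (contMDiffWithinAt_powModel fun i => (contMDiff_arrow _ _).contMDiffWithinAt)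

theorem contMDiffOn_preFaceSucc (𝒢 : LieGroupoid EM M EG G) (k : ℕ) (j : Fin (k + 1)) :
    ContMDiffOn (ambient EM EG (k + 1)) (ambient EM EG k) ∞
      (𝒢.preFaceSucc j : M × (Fin (k + 1) → G) → M × (Fin k → G)) (𝒢.strings (k + 1)) := by
  intro p hp
  refine contMDiffWithinAt_fst.prodMk (contMDiffWithinAt_powModel fun i => ?_)
  unfold Fin.contractNth
  split_ifs
  · exact (contMDiff_arrow _ _).contMDiffWithinAt
  · have hc : ∀ q ∈ 𝒢.strings (k + 1), 𝒢.src (q.2 i.castSucc) = 𝒢.tgt (q.2 i.succ) :=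
      fun q hq => (𝒢.tgt_of_val_succ hq _ _ (by simp)).symm
    have h2 : ContMDiffWithinAt (ambient EM EG (k + 1)) (𝓘(ℝ, EG).prod 𝓘(ℝ, EG)) ∞
        (fun q : M × (Fin (k + 1) → G) => (q.2 i.castSucc, q.2 i.succ)) (𝒢.strings (k + 1)) p :=
      (contMDiff_arrow i.castSucc p).contMDiffWithinAt.prodMk
        (contMDiff_arrow i.succ p).contMDiffWithinAt
    exact (𝒢.mul_smooth (p.2 i.castSucc, p.2 i.succ) (hc p hp)).comp p h2 fun q hq => hc q hq
  · exact (contMDiff_arrow _ _).contMDiffWithinAt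

end LieGroupoid


/-! ### Cochains -/

open Classical in
/-- A function on `G_k` is smooth if it is smooth along the embedded submanifold `G_k` of the
ambient manifold `M × G ^ k`. -/
def IsSmoothFunction (𝒢 : LieGroupoid EM M EG G) {k : ℕ} (f : 𝒢.strings k → ℝ) : Prop :=
  ContMDiffOn (LieGroupoid.ambient EM EG k) 𝓘(ℝ, ℝ) ∞
    (fun p => if h : p ∈ 𝒢.strings k then f ⟨p, h⟩ else 0) (𝒢.strings k)

open Classical in
/-- A section of the pull-back of `E^l` to `G_k` along the target map `G_k → M` is smooth if it is
smooth, as a map to the total space of `E^l`, along the embedded submanifold `G_k` of the ambient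
manifold `M × G ^ k`. -/
def IsSmoothSection (𝒢 : LieGroupoid EM M EG G) (E : GradedVectorBundle.{uM, u₁, v₁, v₂} EM M)
    {k : ℕ} {l : ℤ} (η : ∀ p : 𝒢.strings k, E.Fib l p.1.1) : Prop :=
  ContMDiffOn (LieGroupoid.ambient EM EG k) (𝓘(ℝ, EM).prod 𝓘(ℝ, E.Model l)) ∞
    (fun p => TotalSpace.mk' (E.Model l) p.1
      (if h : p ∈ 𝒢.strings k then η ⟨p, h⟩ else 0 : E.Fib l p.1)) (𝒢.strings k)

section Smoothness

variable {𝒢 : LieGroupoid EM M EG G} {E : GradedVectorBundle.{uM, u₁, v₁, v₂} EM M}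

open Classical in
theorem IsSmoothFunction.comp {k m : ℕ} {f : 𝒢.strings m → ℝ} (hf : IsSmoothFunction 𝒢 f)
    {φ : M × (Fin k → G) → M × (Fin m → G)}
    (hφ : ContMDiffOn (LieGroupoid.ambient EM EG k) (LieGroupoid.ambient EM EG m) ∞ φ
      (𝒢.strings k)) (hm : ∀ {p}, p ∈ 𝒢.strings k → φ p ∈ 𝒢.strings m) :
    IsSmoothFunction 𝒢 fun p : 𝒢.strings k => f ⟨φ p.1, hm p.2⟩ := by
  unfold IsSmoothFunction at hf ⊢
  refine (hf.comp hφ fun p hp => hm hp).congr fun p hp => ?_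
  simp [hp, hm hp]

open Classical in
theorem isSmoothFunction_zero {k : ℕ} : IsSmoothFunction 𝒢 (fun _ : 𝒢.strings k => (0 : ℝ)) := by
  have h : ContMDiffOn (LieGroupoid.ambient EM EG k) 𝓘(ℝ, ℝ) ∞
      (fun _ : M × (Fin k → G) => (0 : ℝ)) (𝒢.strings k) := contMDiffOn_const
  exact h.congr fun p hp => by simp

open Classical in
theorem IsSmoothFunction.add {k : ℕ} {f g : 𝒢.strings k → ℝ} (hf : IsSmoothFunction 𝒢 f)
    (hg : IsSmoothFunction 𝒢 g) : IsSmoothFunction 𝒢 fun p => f p + g p := by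
  refine (ContMDiffOn.add hf hg).congr fun p hp => ?_
  simp [hp]

open Classical in
theorem IsSmoothFunction.const_mul {k : ℕ} {f : 𝒢.strings k → ℝ} (hf : IsSmoothFunction 𝒢 f)
    (c : ℝ) : IsSmoothFunction 𝒢 fun p => c * f p := by
  have h : ContMDiffOn (LieGroupoid.ambient EM EG k) 𝓘(ℝ, ℝ) ∞
      (fun _ : M × (Fin k → G) => c) (𝒢.strings k) := contMDiffOn_const
  refine (h.smul hf).congr fun p hp => ?_
  simp [hp]

open Classical in
theorem IsSmoothFunction.sum {k : ℕ} {ι : Type*} (s : Finset ι) {f : ι → 𝒢.strings k → ℝ}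
    (hf : ∀ i ∈ s, IsSmoothFunction 𝒢 (f i)) : IsSmoothFunction 𝒢 fun p => ∑ i ∈ s, f i p := by
  induction s using Finset.induction_on with
  | empty => simpa using isSmoothFunction_zero
  | insert a s ha ih =>
    simp only [Finset.sum_insert ha]
    exact (hf a (by simp)).add (ih fun i hi => hf i (by simp [hi]))

open Classical in
theorem isSmoothSection_iff {k : ℕ} {l : ℤ} {η : ∀ p : 𝒢.strings k, E.Fib l p.1.1} :
    IsSmoothSection 𝒢 E η ↔ ∀ p ∈ 𝒢.strings k,
      ContMDiffWithinAt (LieGroupoid.ambient EM EG k) 𝓘(ℝ, E.Model l) ∞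
        (fun q => (trivializationAt (E.Model l) (E.Fib l) p.1
          ⟨q.1, if h : q ∈ 𝒢.strings k then η ⟨q, h⟩ else 0⟩).2) (𝒢.strings k) p := by
  refine forall₂_congr fun p _ => ?_
  rw [contMDiffWithinAt_totalSpace]
  exact and_iff_right contMDiffWithinAt_fst

open Classical in
theorem isSmoothSection_zero {k : ℕ} {l : ℤ} :
    IsSmoothSection 𝒢 E (fun _ => 0 : ∀ p : 𝒢.strings k, E.Fib l p.1.1) := by
  rw [isSmoothSection_iff]
  intro p hp
  set e := trivializationAt (E.Model l) (E.Fib l) p.1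
  refine (contMDiffWithinAt_const (c := (0 : E.Model l))).congr_of_eventuallyEq_of_mem ?_ hp
  filter_upwards [continuous_fst.continuousWithinAt
    (e.open_baseSet.mem_nhds (FiberBundle.mem_baseSet_trivializationAt' p.1))] with q hq
  have := (e.linear ℝ hq).map_zero
  split_ifs <;> exact this

open Classical in
theorem IsSmoothSection.add {k : ℕ} {l : ℤ} {η θ : ∀ p : 𝒢.strings k, E.Fib l p.1.1}
    (hη : IsSmoothSection 𝒢 E η) (hθ : IsSmoothSection 𝒢 E θ) :
    IsSmoothSection 𝒢 E fun p => η p + θ p := by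
  rw [isSmoothSection_iff] at *
  intro p hp
  set e := trivializationAt (E.Model l) (E.Fib l) p.1
  refine ((hη p hp).add (hθ p hp)).congr_of_eventuallyEq_of_mem ?_ hp
  filter_upwards [continuous_fst.continuousWithinAt
    (e.open_baseSet.mem_nhds (FiberBundle.mem_baseSet_trivializationAt' p.1)),
    self_mem_nhdsWithin] with q hq hq'
  have := (e.linear ℝ hq).map_add (η ⟨q, hq'⟩) (θ ⟨q, hq'⟩)
  simpa [hq'] using this

open Classical in
theorem IsSmoothSection.smul {k : ℕ} {l : ℤ} {f : 𝒢.strings k → ℝ}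
    {η : ∀ p : 𝒢.strings k, E.Fib l p.1.1}
    (hf : IsSmoothFunction 𝒢 f) (hη : IsSmoothSection 𝒢 E η) :
    IsSmoothSection 𝒢 E fun p => f p • η p := by
  rw [isSmoothSection_iff] at *
  intro p hp
  set e := trivializationAt (E.Model l) (E.Fib l) p.1
  refine ((hf p hp).smul (hη p hp)).congr_of_eventuallyEq_of_mem ?_ hp
  filter_upwards [continuous_fst.continuousWithinAt
    (e.open_baseSet.mem_nhds (FiberBundle.mem_baseSet_trivializationAt' p.1)),
    self_mem_nhdsWithin] with q hq hq'
  have := (e.linear ℝ hq).map_smul (f ⟨q, hq'⟩) (η ⟨q, hq'⟩)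
  simpa [hq'] using this

open Classical in
theorem IsSmoothSection.front {k : ℕ} (m : ℕ) {l : ℤ} {η : ∀ p : 𝒢.strings k, E.Fib l p.1.1}
    (hη : IsSmoothSection 𝒢 E η) :
    IsSmoothSection 𝒢 E fun p : 𝒢.strings (k + m) => (η (𝒢.front m p) : E.Fib l p.1.1) := by
  unfold IsSmoothSection at hη ⊢
  refine (hη.comp (𝒢.contMDiffOn_preFront k m)
    fun p hp => 𝒢.preFront_mem hp).congr fun p hp => ?_
  have h1 := 𝒢.preFront_mem hp
  simp only [Function.comp, dif_pos h1]
  rw [dif_pos hp]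

end Smoothness

namespace LieGroupoid

/-- `C^k(G)`: the smooth functions on `G_k`. -/
def Functions (𝒢 : LieGroupoid EM M EG G) (k : ℕ) : Submodule ℝ (𝒢.strings k → ℝ) where
  carrier := {f | IsSmoothFunction 𝒢 f}
  add_mem' hf hg := hf.add hg
  zero_mem' := isSmoothFunction_zero
  smul_mem' c _ hf := hf.const_mul c

/-- The differential `δ : C^k(G) → C^{k+1}(G)`,
`δ f (g₁, …, g_{k+1}) = (-1)^k (f (g₂, …, g_{k+1}) + ∑_{i=1}^k (-1)^i f (…, g_i g_{i+1}, …)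
  + (-1)^{k+1} f (g₁, …, g_k))`. -/
def δ (𝒢 : LieGroupoid EM M EG G) {k : ℕ} (f : 𝒢.Functions k) : 𝒢.Functions (k + 1) :=
  ⟨fun p => (-1) ^ k * (f.1 (𝒢.faceZero p) +
      ∑ j : Fin (k + 1), (-1) ^ ((j : ℕ) + 1) * f.1 (𝒢.faceSucc j p)),
    IsSmoothFunction.const_mul (IsSmoothFunction.add
      (f.2.comp (𝒢.contMDiffOn_preFaceZero k) 𝒢.preFaceZero_mem)
      (IsSmoothFunction.sum Finset.univ fun j _ =>
        IsSmoothFunction.const_mul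
          (f.2.comp (𝒢.contMDiffOn_preFaceSucc k j) (𝒢.preFaceSucc_mem j))
          ((-1) ^ ((j : ℕ) + 1)))) ((-1) ^ k)⟩

/-- `C^k(G; E^l)`: the smooth sections over `G_k` of the pull-back of `E^l` along the target map. -/
def Cochains (𝒢 : LieGroupoid EM M EG G) (E : GradedVectorBundle.{uM, u₁, v₁, v₂} EM M)
    (k : ℕ) (l : ℤ) : Submodule ℝ (∀ p : 𝒢.strings k, E.Fib l p.1.1) where
  carrier := {η | IsSmoothSection 𝒢 E η}
  add_mem' hη hθ := hη.add hθ
  zero_mem' := isSmoothSection_zero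
  smul_mem' c η hη := by
    have h : IsSmoothFunction 𝒢 (fun _ : 𝒢.strings k => c) := by
      refine (contMDiffOn_const (c := c)).congr fun p hp => ?_
      simp [hp]
    exact IsSmoothSection.smul h hη

/-- The right action of `f ∈ C^m(G)` on `C^k(G; E^l)`,
`(η ⋆ f) (g₁, …, g_{k+m}) = (-1)^{k m} f (g_{k+1}, …, g_{k+m}) η (g₁, …, g_k)`. -/
def starRight (𝒢 : LieGroupoid EM M EG G) (E : GradedVectorBundle.{uM, u₁, v₁, v₂} EM M)
    {m : ℕ} (f : 𝒢.Functions m) (k : ℕ) (l : ℤ) :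
    𝒢.Cochains E k l →ₗ[ℝ] 𝒢.Cochains E (k + m) l where
  toFun η := ⟨fun p => ((-1) ^ (k * m) * f.1 (𝒢.back k p)) • (η.1 (𝒢.front m p) : E.Fib l p.1.1),
    IsSmoothSection.smul
      ((f.2.comp (𝒢.contMDiffOn_preBack k m) 𝒢.preBack_mem).const_mul _) (η.2.front m)⟩
  map_add' η θ := by
    ext p
    exact smul_add _ _ _
  map_smul' c η := by
    ext p
    change _ • (c • η.1 (𝒢.front m p) : E.Fib l p.1.1) =
      c • (_ • η.1 (𝒢.front m p) : E.Fib l p.1.1)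
    rw [smul_smul, smul_smul, mul_comm]

/-- `C(G; E)`: the direct sum of all `C^k(G; E^l)`. -/
abbrev TotalCochains (𝒢 : LieGroupoid EM M EG G)
    (E : GradedVectorBundle.{uM, u₁, v₁, v₂} EM M) : Type _ :=
  DirectSum (ℕ × ℤ) fun a => 𝒢.Cochains E a.1 a.2

/-- `C(G; E)^n`: the direct sum of the `C^k(G; E^l)` with `k + l = n`, as a subspace of
`C(G; E)`. -/
def totalDegree (𝒢 : LieGroupoid EM M EG G) (E : GradedVectorBundle.{uM, u₁, v₁, v₂} EM M)
    (n : ℤ) : Submodule ℝ (𝒢.TotalCochains E) where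
  carrier := {η | ∀ a : ℕ × ℤ, (a.1 : ℤ) + a.2 ≠ n → η a = 0}
  add_mem' hη hθ a ha := by simp [hη a ha, hθ a ha]
  zero_mem' a _ := rfl
  smul_mem' c η hη a ha := by simp [DirectSum.smul_apply, hη a ha]

/-- The right action of `f ∈ C^m(G)` on `C(G; E)`. -/
def star (𝒢 : LieGroupoid EM M EG G) {E : GradedVectorBundle.{uM, u₁, v₁, v₂} EM M}
    {m : ℕ} (η : 𝒢.TotalCochains E) (f : 𝒢.Functions m) : 𝒢.TotalCochains E :=
  DirectSum.toModule ℝ (ℕ × ℤ) (𝒢.TotalCochains E)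
    (fun a => (DirectSum.lof ℝ (ℕ × ℤ) (fun b : ℕ × ℤ => 𝒢.Cochains E b.1 b.2)
      (a.1 + m, a.2)).comp (𝒢.starRight E f a.1 a.2)) η

theorem star_lof (𝒢 : LieGroupoid EM M EG G) {E : GradedVectorBundle.{uM, u₁, v₁, v₂} EM M}
    {m : ℕ} (k : ℕ) (l : ℤ) (η : 𝒢.Cochains E k l) (f : 𝒢.Functions m) :
    𝒢.star (DirectSum.lof ℝ (ℕ × ℤ) (fun b : ℕ × ℤ => 𝒢.Cochains E b.1 b.2) (k, l) η) f =
      DirectSum.lof ℝ (ℕ × ℤ) (fun b : ℕ × ℤ => 𝒢.Cochains E b.1 b.2) (k + m, l)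
        (𝒢.starRight E f k l η) := by
  rw [star, DirectSum.toModule_lof]
  rfl

end LieGroupoid

/-! ### Representations up to homotopy -/

/-- A representation up to homotopy of a Lie groupoid on a bounded graded vector bundle `E`: a
linear operator `D` of degree one on `C(G; E)` with `D² = 0` and
`D (η ⋆ f) = D η ⋆ f + (-1)^n η ⋆ δ f` for `η ∈ C(G; E)^n`. -/
structure RepUpToHomotopy (𝒢 : LieGroupoid EM M EG G) where
  bundle : GradedVectorBundle.{uM, u₁, v₁, v₂} EM M
  D : 𝒢.TotalCochains bundle →ₗ[ℝ] 𝒢.TotalCochains bundle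
  degree_one : ∀ (n : ℤ), ∀ η ∈ 𝒢.totalDegree bundle n, D η ∈ 𝒢.totalDegree bundle (n + 1)
  sq_zero : ∀ η, D (D η) = 0
  leibniz : ∀ (n : ℤ), ∀ η ∈ 𝒢.totalDegree bundle n, ∀ (m : ℕ) (f : 𝒢.Functions m),
    D (𝒢.star η f) = 𝒢.star (D η) f + (-1 : ℝ) ^ n • 𝒢.star η (𝒢.δ f)

namespace RepUpToHomotopy

variable {𝒢 : LieGroupoid EM M EG G}

/-- A morphism of representations up to homotopy: a `C(G)`-linear map of degree zero which commutes
with the structure operators. -/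
structure Hom (E : RepUpToHomotopy.{uM, uG, u₁, u₂, v₁, v₂} 𝒢)
    (F : RepUpToHomotopy.{uM, uG, u₁, u₂, v₃, v₄} 𝒢) where
  toLinearMap : 𝒢.TotalCochains E.bundle →ₗ[ℝ] 𝒢.TotalCochains F.bundle
  degree_zero : ∀ (n : ℤ), ∀ η ∈ 𝒢.totalDegree E.bundle n,
    toLinearMap η ∈ 𝒢.totalDegree F.bundle n
  map_star : ∀ η (m : ℕ) (f : 𝒢.Functions m),
    toLinearMap (𝒢.star η f) = 𝒢.star (toLinearMap η) f
  comm : ∀ η, toLinearMap (E.D η) = F.D (toLinearMap η)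

namespace Hom

variable {E : RepUpToHomotopy.{uM, uG, u₁, u₂, v₁, v₂} 𝒢}
  {F : RepUpToHomotopy.{uM, uG, u₁, u₂, v₃, v₄} 𝒢}

/-- The identity morphism. -/
def id (E : RepUpToHomotopy.{uM, uG, u₁, u₂, v₁, v₂} 𝒢) : Hom E E where
  toLinearMap := LinearMap.id
  degree_zero _ _ hη := hη
  map_star _ _ _ := rfl
  comm _ := rfl

/-- The composition `Ψ ∘ Φ`. -/
def comp {K : RepUpToHomotopy.{uM, uG, u₁, u₂, v₅, v₆} 𝒢} (Ψ : Hom F K) (Φ : Hom E F) :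
    Hom E K where
  toLinearMap := Ψ.toLinearMap.comp Φ.toLinearMap
  degree_zero n η hη := Ψ.degree_zero n _ (Φ.degree_zero n η hη)
  map_star η m f := by simp [Φ.map_star, Ψ.map_star]
  comm η := by simp [Φ.comm, Ψ.comm]

/-- `Φ` and `Ψ` are homotopic if `Φ - Ψ = D H + H D` for some `C(G)`-linear map `H` which lowers the
total degree by one. -/
def Homotopic (Φ Ψ : Hom E F) : Prop :=
  ∃ H : 𝒢.TotalCochains E.bundle →ₗ[ℝ] 𝒢.TotalCochains F.bundle,
    (∀ (n : ℤ), ∀ η ∈ 𝒢.totalDegree E.bundle n, H η ∈ 𝒢.totalDegree F.bundle (n - 1)) ∧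
    (∀ η (m : ℕ) (f : 𝒢.Functions m), H (𝒢.star η f) = 𝒢.star (H η) f) ∧
    ∀ η, Φ.toLinearMap η - Ψ.toLinearMap η = F.D (H η) + H (E.D η)

/-- `Φ` is a homotopy equivalence, that is, invertible up to homotopy. -/
def IsHomotopyEquiv (Φ : Hom E F) : Prop :=
  ∃ Ψ : Hom F E, Homotopic (Ψ.comp Φ) (Hom.id E) ∧ Homotopic (Φ.comp Ψ) (Hom.id F)

end Hom

end RepUpToHomotopy

/-! ### The underlying maps of vector bundles -/

section Fiberwise

variable [FiniteDimensional ℝ EM] [IsManifold 𝓘(ℝ, EM) ∞ M] [T2Space M]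

theorem exists_bump (x : M) {U : Set M} (hU : U ∈ 𝓝 x) :
    ∃ φ : SmoothBumpFunction 𝓘(ℝ, EM) x, tsupport φ ⊆ U := by
  obtain ⟨φ, -, hφ⟩ := (SmoothBumpFunction.nhds_basis_tsupport (I := 𝓘(ℝ, EM)) x).mem_iff.1 hU
  exact ⟨φ, hφ⟩

namespace GradedVectorBundle

variable (E : GradedVectorBundle.{uM, u₁, v₁, v₂} EM M)

/-- A bump function at `x` with support in the domain of a trivialization of `E^l` at `x`. -/
def bump (l : ℤ) (x : M) : SmoothBumpFunction 𝓘(ℝ, EM) x :=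
  (exists_bump x ((trivializationAt (E.Model l) (E.Fib l) x).open_baseSet.mem_nhds
    (FiberBundle.mem_baseSet_trivializationAt' x))).choose

theorem tsupport_bump (l : ℤ) (x : M) :
    tsupport (E.bump l x) ⊆ (trivializationAt (E.Model l) (E.Fib l) x).baseSet :=
  (exists_bump x ((trivializationAt (E.Model l) (E.Fib l) x).open_baseSet.mem_nhds
    (FiberBundle.mem_baseSet_trivializationAt' x))).choose_spec

/-- A global section of `E^l` with value `v` at `x`, depending linearly on `v`: constant in a
trivialization, multiplied by a bump function. -/
def extendFun (l : ℤ) (x : M) (v : E.Fib l x) (y : M) : E.Fib l y :=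
  E.bump l x y • (trivializationAt (E.Model l) (E.Fib l) x).symmₗ ℝ y
    ((trivializationAt (E.Model l) (E.Fib l) x).linearMapAt ℝ x v)

theorem extendFun_self (l : ℤ) (x : M) (v : E.Fib l x) : E.extendFun l x v x = v := by
  rw [extendFun, Trivialization.symmₗ_linearMapAt _ (FiberBundle.mem_baseSet_trivializationAt' x),
    SmoothBumpFunction.eq_one, one_smul]

theorem contMDiff_extendFun (l : ℤ) (x : M) (v : E.Fib l x) :
    ContMDiff 𝓘(ℝ, EM) (𝓘(ℝ, EM).prod 𝓘(ℝ, E.Model l)) ∞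
      fun y => TotalSpace.mk' (E.Model l) y (E.extendFun l x v y) := by
  set e := trivializationAt (E.Model l) (E.Fib l) x with he
  refine ContMDiffOn.smul_section_of_tsupport (u := e.baseSet) (ψ := E.bump l x)
    (s := fun y => e.symmₗ ℝ y (e.linearMapAt ℝ x v))
    (E.bump l x).contMDiff.contMDiffOn e.open_baseSet (E.tsupport_bump l x) ?_
  intro y hy
  rw [e.contMDiffWithinAt_section _ hy]
  refine (contMDiffWithinAt_const (c := e.linearMapAt ℝ x v)).congr (fun z hz => ?_) ?_
  · rw [Trivialization.symmₗ_apply _ hz]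
    simp [hz]
  · rw [Trivialization.symmₗ_apply _ hy]
    simp [hy]

end GradedVectorBundle

namespace LieGroupoid

open Classical in
/-- The extension of vectors `v ∈ E^l_x` to global sections of `E^l`, that is, to elements of
`C^0(G; E^l)`. -/
def extend (𝒢 : LieGroupoid EM M EG G) (E : GradedVectorBundle.{uM, u₁, v₁, v₂} EM M)
    (l : ℤ) (x : M) : E.Fib l x →ₗ[ℝ] 𝒢.Cochains E 0 l where
  toFun v := ⟨fun p => E.extendFun l x v p.1.1, by
    have h : ContMDiffOn (ambient EM EG 0) (𝓘(ℝ, EM).prod 𝓘(ℝ, E.Model l)) ∞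
        (fun p : M × (Fin 0 → G) => TotalSpace.mk' (E.Model l) p.1 (E.extendFun l x v p.1))
        (𝒢.strings 0) := ((E.contMDiff_extendFun l x v).comp contMDiff_fst).contMDiffOn
    refine h.congr fun p hp => ?_
    rw [dif_pos hp]⟩
  map_add' v w := by
    ext p
    simp [GradedVectorBundle.extendFun]
  map_smul' c v := by
    ext p
    simp [GradedVectorBundle.extendFun, smul_comm c]

theorem extend_self (𝒢 : LieGroupoid EM M EG G) (E : GradedVectorBundle.{uM, u₁, v₁, v₂} EM M)
    (l : ℤ) (x : M) (v : E.Fib l x) : (𝒢.extend E l x v).1 (𝒢.objString x) = v :=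
  E.extendFun_self l x v

/-- For a linear map `T : C(G; E) → C(G; F)`, the map `E^l_x → F^m_x` which sends `v` to the value
at `x` of the component in `C^0(G; F^m) = Γ(F^m)` of `T s`, for a section `s ∈ Γ(E^l) = C^0(G; E^l)`
with `s(x) = v`.  If `T` is the structure operator of a representation up to homotopy or a morphism
of representations up to homotopy, this component is tensorial in `s`, so that the choice of `s`
does not matter. -/
def fiberMap (𝒢 : LieGroupoid EM M EG G) {E : GradedVectorBundle.{uM, u₁, v₁, v₂} EM M}
    {F : GradedVectorBundle.{uM, u₁, v₃, v₄} EM M}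
    (T : 𝒢.TotalCochains E →ₗ[ℝ] 𝒢.TotalCochains F) (l m : ℤ) (x : M) :
    E.Fib l x →ₗ[ℝ] F.Fib m x :=
  (LinearMap.proj (𝒢.objString x)).comp <| (𝒢.Cochains F 0 m).subtype.comp <|
    (DirectSum.component ℝ (ℕ × ℤ) (fun a : ℕ × ℤ => 𝒢.Cochains F a.1 a.2) (0, m)).comp <|
      T.comp <| (DirectSum.lof ℝ (ℕ × ℤ) (fun a : ℕ × ℤ => 𝒢.Cochains E a.1 a.2) (0, l)).comp <|
        𝒢.extend E l x

theorem fiberMap_apply (𝒢 : LieGroupoid EM M EG G) {E : GradedVectorBundle.{uM, u₁, v₁, v₂} EM M}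
    {F : GradedVectorBundle.{uM, u₁, v₃, v₄} EM M}
    (T : 𝒢.TotalCochains E →ₗ[ℝ] 𝒢.TotalCochains F) (l m : ℤ) (x : M) (v : E.Fib l x) :
    𝒢.fiberMap T l m x v = (T (DirectSum.lof ℝ (ℕ × ℤ)
      (fun a : ℕ × ℤ => 𝒢.Cochains E a.1 a.2) (0, l) (𝒢.extend E l x v)) (0, m)).1
        (𝒢.objString x) := rfl

end LieGroupoid

namespace RepUpToHomotopy

variable {𝒢 : LieGroupoid EM M EG G}

/-- The differential `∂ : E^l_x → E^{l+1}_x` of the underlying complex of vector bundles of `E`. -/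
def differential (E : RepUpToHomotopy.{uM, uG, u₁, u₂, v₁, v₂} 𝒢) (l m : ℤ) (x : M) :
    E.bundle.Fib l x →ₗ[ℝ] E.bundle.Fib m x :=
  𝒢.fiberMap E.D l m x

variable {E : RepUpToHomotopy.{uM, uG, u₁, u₂, v₁, v₂} 𝒢}
  {F : RepUpToHomotopy.{uM, uG, u₁, u₂, v₃, v₄} 𝒢}

namespace Hom

/-- The map of complexes of vector bundles `Φ₀ : E^l_x → F^l_x` underlying a morphism `Φ`. -/
def fiber (Φ : Hom E F) (l : ℤ) (x : M) : E.bundle.Fib l x →ₗ[ℝ] F.bundle.Fib l x :=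
  𝒢.fiberMap Φ.toLinearMap l l x

/-- `Φ` is a quasi-isomorphism if `Φ₀` induces an isomorphism in cohomology at every point: for
every `x ∈ M` and every `l`, the map induced by `Φ₀` from `H^l(E_x) = ker ∂ / im ∂` to
`H^l(F_x) = ker ∂ / im ∂` is injective and surjective. -/
def IsQuasiIso (Φ : Hom E F) : Prop :=
  ∀ (x : M) (l : ℤ),
    (∀ v : E.bundle.Fib l x, E.differential l (l + 1) x v = 0 →
      Φ.fiber l x v ∈ LinearMap.range (F.differential (l - 1) l x) →
        v ∈ LinearMap.range (E.differential (l - 1) l x)) ∧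
    (∀ w : F.bundle.Fib l x, F.differential l (l + 1) x w = 0 →
      ∃ v : E.bundle.Fib l x, E.differential l (l + 1) x v = 0 ∧
        w - Φ.fiber l x v ∈ LinearMap.range (F.differential (l - 1) l x))

end Hom

end RepUpToHomotopy

end Fiberwise

end Groupoid

end

/-! Form the mapping cone of `Φ`, with underlying graded bundle `E[1] ⊕ F` and the operator
`totalD`, `(η, θ) ↦ (-Dη, Φη + Dθ)`. A homotopy equivalence is the same information as a contraction
of this cone: if `K` is `C(G)`-linear of degree `-1` with `DK + KD = 1`, its component `F → E` is a
homotopy inverse of `Φ`, and its diagonal components are, up to sign, the two homotopies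
(`isHomotopyEquiv_of_contraction`).

To find `K`, look first at leading terms, the parts in `C^0`. They are fibrewise (`HasLeadingTerm`),
and the leading term of the cone operator is the usual mapping cone of the complexes `E_x → F_x`.
For a quasi-isomorphism that complex is exact at every `x` (`coneD_exact`). Exactness at points must
be turned into a contraction `h` depending smoothly on `x`. Hodge theory does this: with a transpose
`dᵀ`, the Laplacian `ddᵀ + dᵀd` is invertible and commutes with `d`, so `Δ⁻¹dᵀ` contracts
(`Matrix.laplacian_contraction`). Smoothness is checked in matrices. Bundles need not be trivial, so
each is presented as the image of a smooth orthogonal projection in a trivial bundle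
(`nonempty_smoothFrame`); this requires finitely many global sections spanning every fibre
(`exists_spansOn_univ`).

Let `h` act at the target of the string: this is a `C(G)`-linear operator `H`, and `N = 1 - (DH +
HD)` has degree zero. The Leibniz corrections of `DH` and `HD` cancel, so `N` is `C(G)`-linear; its
leading term vanishes. Since `C(G; E)` is generated over `C(G)` by sections of `E`, such an operator
lowers the bundle degree (`map_mem_coneLE`) and is nilpotent because the bundles are bounded. The
finite geometric series then corrects `H` to `K = (∑ N^i) H` (`contraction_of_isNilpotent`). -/

/-! ### Finite families of sections spanning all fibres of a vector bundle -/

section SpanningSections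

open Set Module

variable {EM : Type*} [NormedAddCommGroup EM] [NormedSpace ℝ EM]
  {M : Type*} [TopologicalSpace M] [ChartedSpace EM M]
  {F : Type*} [NormedAddCommGroup F] [NormedSpace ℝ F]
  {V : M → Type*} [∀ x, AddCommGroup (V x)] [∀ x, Module ℝ (V x)] [∀ x, TopologicalSpace (V x)]
  [TopologicalSpace (TotalSpace F V)] [FiberBundle F V]

/-- The sections `e i` span the fibres over `K`: no nonzero functional vanishes on all of them. -/
def SpansOn {ι : Type*} (K : Set M) (e : ι → Cₛ^∞⟮𝓘(ℝ, EM); F, V⟯) : Prop :=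
  ∀ x ∈ K, ∀ μ : V x →ₗ[ℝ] ℝ, (∀ i, μ (e i x) = 0) → μ = 0

variable [FiniteDimensional ℝ EM] [FiniteDimensional ℝ F]
  [VectorBundle ℝ F V] [ContMDiffVectorBundle ∞ F V 𝓘(ℝ, EM)]
  [IsManifold 𝓘(ℝ, EM) ∞ M]

/-- A basis of the model fibre, carried over by a trivialization and cut off by a bump function,
still gives a basis wherever the bump function equals one. -/
theorem exists_spansOn_nhds [T2Space M] (x₀ : M) :
    ∃ U ∈ 𝓝 x₀, ∃ e : Fin (finrank ℝ F) → Cₛ^∞⟮𝓘(ℝ, EM); F, V⟯, SpansOn U e := by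
  set t := trivializationAt F V x₀ with ht
  have hx₀ : x₀ ∈ t.baseSet := FiberBundle.mem_baseSet_trivializationAt' x₀
  obtain ⟨ψ, hψ⟩ := exists_bump (EM := EM) x₀ (t.open_baseSet.mem_nhds hx₀)
  let s : F → Cₛ^∞⟮𝓘(ℝ, EM); F, V⟯ := fun v => ⟨fun y => ψ y • t.symmₗ ℝ y v, by
    refine ContMDiffOn.smul_section_of_tsupport (u := t.baseSet) (ψ := ψ)
      (s := fun y => t.symmₗ ℝ y v) ψ.contMDiff.contMDiffOn t.open_baseSet hψ ?_
    intro y hy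
    rw [t.contMDiffWithinAt_section _ hy]
    refine (contMDiffWithinAt_const (c := v)).congr (fun z hz => ?_) ?_
    · rw [Trivialization.symmₗ_apply _ hz]
      simp [hz]
    · rw [Trivialization.symmₗ_apply _ hy]
      simp [hy]⟩
  let b := finBasis ℝ F
  refine ⟨{y | ψ y = 1} ∩ t.baseSet,
    Filter.inter_mem ψ.eventuallyEq_one (t.open_baseSet.mem_nhds hx₀), fun i => s (b i), ?_⟩
  rintro y ⟨hy1, hy⟩ μ hμ
  have h0 : μ ∘ₗ t.symmₗ ℝ y = 0 := b.ext fun i => by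
    have h := hμ i
    change μ (ψ y • t.symmₗ ℝ y (b i)) = 0 at h
    rw [show ψ y = 1 from hy1, one_smul] at h
    simpa using h
  ext v
  have h := LinearMap.congr_fun h0 (t.linearMapAt ℝ y v)
  rw [LinearMap.comp_apply, t.symmₗ_linearMapAt hy] at h
  simpa using h

theorem exists_spansOn_isCompact [T2Space M] {K : Set M} (hK : IsCompact K) :
    ∃ (n : ℕ) (e : Fin n → Cₛ^∞⟮𝓘(ℝ, EM); F, V⟯), SpansOn K e := by
  choose U hU e he using exists_spansOn_nhds (EM := EM) (F := F) (V := V)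
  obtain ⟨t, -, ht⟩ := hK.elim_nhds_subcover U fun x _ => hU x
  let q := Fintype.equivFin (t × Fin (finrank ℝ F))
  refine ⟨_, fun i => e (q.symm i).1 (q.symm i).2, fun x hx μ hμ => ?_⟩
  obtain ⟨y, hy, hxy⟩ := mem_iUnion₂.1 (ht hx)
  refine he y x hxy μ fun i => ?_
  simpa using hμ (q (⟨y, hy⟩, i))

/-- The set is the image of the total space of the dual bundle under `μ ↦ (μ (e i))`. That space has
dimension `dim M + rank V`, is covered by countably many charts, and differentiable maps do not
raise Hausdorff dimension. -/
theorem dimH_dual_image_lt [SigmaCompactSpace M] {n : ℕ} (e : Fin n → Cₛ^∞⟮𝓘(ℝ, EM); F, V⟯)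
    (hn : finrank ℝ EM + finrank ℝ F < n) :
    dimH {w : Fin n → ℝ | ∃ x, ∃ μ : V x →ₗ[ℝ] ℝ, ∀ i, μ (e i x) = w i} <
      finrank ℝ (Fin n → ℝ) := by
  let c : M → M → EM := fun x₀ => chartAt EM x₀
  have hball : ∀ x₀ : M, ∃ ε > 0, Metric.ball (c x₀ x₀) ε ⊆
      (chartAt EM x₀).target ∩ (chartAt EM x₀).symm ⁻¹' (trivializationAt F V x₀).baseSet := by
    intro x₀
    refine Metric.mem_nhds_iff.1 (Filter.inter_mem ((chartAt EM x₀).open_target.mem_nhds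
      (mem_chart_target EM x₀)) ?_)
    refine ((chartAt EM x₀).continuousAt_symm (mem_chart_target EM x₀)).preimage_mem_nhds ?_
    rw [(chartAt EM x₀).left_inv (mem_chart_source EM x₀)]
    exact (trivializationAt F V x₀).open_baseSet.mem_nhds
      (FiberBundle.mem_baseSet_trivializationAt' x₀)
  choose ε hε hsub using hball
  let f : M → EM × (F →L[ℝ] ℝ) → Fin n → ℝ := fun x₀ p i =>
    p.2 (trivializationAt F V x₀ ⟨(chartAt EM x₀).symm p.1, e i ((chartAt EM x₀).symm p.1)⟩).2
  have hf : ∀ x₀, ContDiffOn ℝ 1 (f x₀) (Metric.ball (c x₀ x₀) (ε x₀) ×ˢ univ) := by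
    intro x₀
    rw [contDiffOn_pi]
    intro i
    have h1 : ContMDiffOn 𝓘(ℝ, EM) 𝓘(ℝ, F) ∞
        (fun y => (trivializationAt F V x₀ ⟨y, e i y⟩).2) (trivializationAt F V x₀).baseSet := by
      intro y hy
      have := ((e i).contMDiff y).contMDiffWithinAt (s := (trivializationAt F V x₀).baseSet)
      rwa [(trivializationAt F V x₀).contMDiffWithinAt_section _ hy] at this
    have h2 : ContDiffOn ℝ 1 (fun z : EM => (trivializationAt F V x₀
        ⟨(chartAt EM x₀).symm z, e i ((chartAt EM x₀).symm z)⟩).2)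
          (Metric.ball (c x₀ x₀) (ε x₀)) := by
      have h3 := h1.comp ((contMDiffOn_chart_symm (I := 𝓘(ℝ, EM)) (n := ∞) (x := x₀)).mono
        fun z hz => (hsub x₀ hz).1) fun z hz => (hsub x₀ hz).2
      exact (contMDiffOn_iff_contDiffOn.1 h3).of_le (by exact_mod_cast le_top)
    have h4 := h2.comp (contDiffOn_fst (s := Metric.ball (c x₀ x₀) (ε x₀) ×ˢ
      (univ : Set (F →L[ℝ] ℝ)))) fun p hp => hp.1
    exact contDiffOn_snd.clm_apply h4
  have hdim : ∀ x₀, dimH (f x₀ '' (Metric.ball (c x₀ x₀) (ε x₀) ×ˢ univ)) ≤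
      (finrank ℝ EM + finrank ℝ F : ℕ) := by
    intro x₀
    refine ((hf x₀).dimH_image_le ((convex_ball _ _).prod convex_univ) Subset.rfl).trans ?_
    refine (dimH_mono (subset_univ _)).trans ?_
    rw [Real.dimH_univ_eq_finrank, finrank_prod]
    have : finrank ℝ (F →L[ℝ] ℝ) = finrank ℝ F := by
      rw [← (LinearMap.toContinuousLinearMap : (F →ₗ[ℝ] ℝ) ≃ₗ[ℝ] F →L[ℝ] ℝ).finrank_eq]
      exact Subspace.dual_finrank_eq
    rw [this]
  obtain ⟨t, htc, htU⟩ := countable_cover_nhds_of_sigmaCompact (X := M)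
    (f := fun x₀ => (chartAt EM x₀).source ∩ c x₀ ⁻¹' Metric.ball (c x₀ x₀) (ε x₀)) fun x₀ =>
      Filter.inter_mem (chart_source_mem_nhds EM x₀)
        (((chartAt EM x₀).continuousAt (mem_chart_source EM x₀)).preimage_mem_nhds
          (Metric.ball_mem_nhds _ (hε x₀)))
  have hsubset : {w : Fin n → ℝ | ∃ x, ∃ μ : V x →ₗ[ℝ] ℝ, ∀ i, μ (e i x) = w i} ⊆
      ⋃ x₀ ∈ t, f x₀ '' (Metric.ball (c x₀ x₀) (ε x₀) ×ˢ univ) := by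
    rintro w ⟨x, μ, hμ⟩
    obtain ⟨x₀, hx₀, hx⟩ := mem_iUnion₂.1 (htU.symm ▸ mem_univ x)
    refine mem_iUnion₂.2 ⟨x₀, hx₀, (c x₀ x, LinearMap.toContinuousLinearMap
      (μ ∘ₗ (trivializationAt F V x₀).symmₗ ℝ x)), ⟨hx.2, mem_univ _⟩, ?_⟩
    have hb : x ∈ (trivializationAt F V x₀).baseSet := by
      have := (hsub x₀ hx.2).2
      rwa [mem_preimage, (chartAt EM x₀).left_inv hx.1] at this
    funext i
    have hcx : (chartAt EM x₀).symm (c x₀ x) = x := (chartAt EM x₀).left_inv hx.1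
    change μ ((trivializationAt F V x₀).symmₗ ℝ x (trivializationAt F V x₀
      ⟨(chartAt EM x₀).symm (c x₀ x), e i ((chartAt EM x₀).symm (c x₀ x))⟩).2) = w i
    have hl := (trivializationAt F V x₀).symmₗ_linearMapAt (R := ℝ) hb (e i x)
    rw [(trivializationAt F V x₀).coe_linearMapAt_of_mem hb] at hl
    rw [hcx, hl, hμ]
  refine (dimH_mono hsubset).trans_lt ?_
  rw [dimH_bUnion htc, finrank_fin_fun]
  refine lt_of_le_of_lt (iSup₂_le fun x₀ _ => hdim x₀) ?_
  exact_mod_cast hn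

/-- Generic projection, as in the easy Whitney theorem: subtracting multiples of the last section
along a direction `w` keeps the spanning property unless `w` is the list of values of a functional
on the sections, and almost no `w` is. -/
theorem SpansOn.exists_drop [SigmaCompactSpace M] {n : ℕ} {K : Set M}
    {e : Fin (n + 1) → Cₛ^∞⟮𝓘(ℝ, EM); F, V⟯} (he : SpansOn K e)
    (hn : finrank ℝ EM + finrank ℝ F ≤ n) :
    ∃ e' : Fin n → Cₛ^∞⟮𝓘(ℝ, EM); F, V⟯, SpansOn K e' := by
  have hd := dense_compl_of_dimH_lt_finrank
    (dimH_dual_image_lt e (Nat.lt_succ_of_le hn))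
  have ho : IsOpen {w : Fin (n + 1) → ℝ | w (Fin.last n) ≠ 0} :=
    isOpen_ne_fun (continuous_apply _) continuous_const
  obtain ⟨w, hw0, hw⟩ := hd.inter_open_nonempty _ ho ⟨fun _ => 1, one_ne_zero⟩
  have hw0 : w (Fin.last n) ≠ 0 := hw0
  refine ⟨fun i => e i.castSucc - (w i.castSucc / w (Fin.last n)) • e (Fin.last n),
    fun x hx μ hμ => ?_⟩
  have hμ' : ∀ i : Fin n, μ (e i.castSucc x) =
      w i.castSucc / w (Fin.last n) * μ (e (Fin.last n) x) := by
    intro i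
    have := hμ i
    rw [ContMDiffSection.coe_sub, Pi.sub_apply, ContMDiffSection.coe_smul, Pi.smul_apply, map_sub,
      map_smul, smul_eq_mul] at this
    linarith
  by_cases h0 : μ (e (Fin.last n) x) = 0
  · refine he x hx μ fun i => ?_
    refine Fin.lastCases h0 (fun i => ?_) i
    rw [hμ', h0, mul_zero]
  -- Here the values of `μ` are a nonzero multiple of `w`, so rescaling `μ` realizes `w` itself,
  -- against the choice of `w`.
  · refine absurd ⟨x, (w (Fin.last n) / μ (e (Fin.last n) x)) • μ, fun i => ?_⟩ hw
    rw [LinearMap.smul_apply, smul_eq_mul]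
    refine Fin.lastCases ?_ (fun i => ?_) i
    · field_simp
    · rw [hμ']
      field_simp

/-- The number of sections does not depend on `K`; this uniformity lets families on infinitely many
compact pieces be added up. -/
theorem exists_spansOn_isCompact_bounded [T2Space M] [SigmaCompactSpace M] {K : Set M}
    (hK : IsCompact K) :
    ∃ e : Fin (finrank ℝ EM + finrank ℝ F) → Cₛ^∞⟮𝓘(ℝ, EM); F, V⟯, SpansOn K e := by
  obtain ⟨n, e, he⟩ := exists_spansOn_isCompact (EM := EM) (F := F) (V := V) hK
  have key : ∀ m : ℕ, (∃ e : Fin (finrank ℝ EM + finrank ℝ F + m) → Cₛ^∞⟮𝓘(ℝ, EM); F, V⟯,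
      SpansOn K e) → ∃ e : Fin (finrank ℝ EM + finrank ℝ F) → Cₛ^∞⟮𝓘(ℝ, EM); F, V⟯,
        SpansOn K e := by
    intro m
    induction m with
    | zero => exact id
    | succ m ih =>
      rintro ⟨e, he⟩
      exact ih (SpansOn.exists_drop (n := finrank ℝ EM + finrank ℝ F + m) he (by omega))
  -- Padding with zero sections gives a family larger than the bound by exactly `n`, from which `n`
  -- sections are dropped one at a time.
  refine key n ⟨Fin.addCases (fun _ => 0) e, fun x hx μ hμ => he x hx μ fun i => ?_⟩
  simpa using hμ (Fin.natAdd _ i)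

/-- Cover `M` by compact annuli `A n` with open neighbourhoods `U n`, two of which are disjoint when
the indices differ by at least three. Sections living on annuli of the same residue modulo 3 can
therefore be summed without interference, and three colours suffice. -/
theorem exists_spansOn_univ [T2Space M] [SigmaCompactSpace M] :
    ∃ (n : ℕ) (e : Fin n → Cₛ^∞⟮𝓘(ℝ, EM); F, V⟯), SpansOn univ e := by
  have : LocallyCompactSpace M := Manifold.locallyCompact_of_finiteDimensional 𝓘(ℝ, EM)
  -- Two shifts put empty sets at indices 0 and 1, so that every point first appears at some index
  -- `n + 2` and hence lies in `A n`.
  let K : CompactExhaustion M := (CompactExhaustion.choice M).shiftr.shiftr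
  have hfind : ∀ x, ∃ n, K.find x = n + 2 := fun x =>
    ⟨(CompactExhaustion.choice M).find x, by simp [K]⟩
  let A : ℕ → Set M := fun n => K (n + 2) \ interior (K (n + 1))
  let U : ℕ → Set M := fun n => interior (K (n + 3)) \ K n
  have hA : ∀ n, IsCompact (A n) := fun n => (K.isCompact (n + 2)).diff isOpen_interior
  have hAU : ∀ n, A n ⊆ U n := fun n x hx =>
    ⟨K.subset_interior_succ (n + 2) hx.1, fun h => hx.2 (K.subset_interior_succ n h)⟩
  have hUopen : ∀ n, IsOpen (U n) := fun n => isOpen_interior.sdiff (K.isCompact n).isClosed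
  choose e he using fun n => exists_spansOn_isCompact_bounded (EM := EM) (F := F) (V := V) (hA n)
  choose χ hχ0 hχ1 _ using fun n => exists_contMDiffMap_zero_one_of_isClosed 𝓘(ℝ, EM) (n := ⊤)
    (hUopen n).isClosed_compl (hA n).isClosed (disjoint_compl_left_iff_subset.2 (hAU n))
  let s : Fin 3 → Fin (finrank ℝ EM + finrank ℝ F) → ℕ → ∀ x, V x := fun c i n x =>
    (if n % 3 = c then χ n x else 0) • e n i x
  have hsU : ∀ c i n x, s c i n x ≠ 0 → x ∈ U n := by
    intro c i n x h
    by_contra hx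
    refine h ?_
    have : χ n x = 0 := hχ0 n hx
    simp [s, this]
  have hfin : ∀ c i, LocallyFinite fun n => {x | s c i n x ≠ 0} := by
    intro c i x
    obtain ⟨m, hm⟩ := K.exists_mem_nhds x
    refine ⟨K m, hm, (finite_lt_nat m).subset ?_⟩
    rintro n ⟨y, hy, hym⟩
    by_contra hnm
    exact (hsU c i n y hy).2 (K.subset (not_lt.1 hnm) hym)
  have hs : ∀ c i n, ContMDiff 𝓘(ℝ, EM) (𝓘(ℝ, EM).prod 𝓘(ℝ, F)) ∞
      fun x => TotalSpace.mk' F x (s c i n x) := by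
    intro c i n
    refine ContMDiff.smul_section (f := fun x => if n % 3 = c then χ n x else 0) ?_
      (e n i).contMDiff
    by_cases h : n % 3 = c
    · simpa [h] using (χ n).contMDiff
    · simpa [h] using contMDiff_const
  let S : Fin 3 × Fin (finrank ℝ EM + finrank ℝ F) → Cₛ^∞⟮𝓘(ℝ, EM); F, V⟯ := fun p =>
    ⟨fun x => ∑ᶠ n, s p.1 p.2 n x,
      ContMDiff.finsum_section_of_locallyFinite (hfin p.1 p.2) (hs p.1 p.2)⟩
  let q := Fintype.equivFin (Fin 3 × Fin (finrank ℝ EM + finrank ℝ F))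
  refine ⟨_, fun i => S (q.symm i), fun x _ μ hμ => ?_⟩
  obtain ⟨n, hn⟩ := hfind x
  have hxA : x ∈ A n := ⟨hn ▸ K.mem_find x, fun h => by
    have := K.mem_iff_find_le.1 (interior_subset h)
    omega⟩
  refine he n x hxA μ fun i => ?_
  have h := hμ (q (⟨n % 3, Nat.mod_lt _ (by norm_num)⟩, i))
  simp only [Equiv.symm_apply_apply] at h
  change μ (∑ᶠ m, s ⟨n % 3, _⟩ i m x) = 0 at h
  rw [finsum_eq_single _ n] at h
  · have h1 : χ n x = 1 := hχ1 n hxA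
    simpa [s, h1] using h
  · intro m hmn
    by_contra h0
    have hm := hsU _ i m x h0
    have h3 : m % 3 = n % 3 := by
      by_contra h3
      exact h0 (by simp [s, h3])
    -- Distinct indices congruent modulo 3 are at least three apart, and then `x` would lie in two
    -- disjoint neighbourhoods `U m` and `U n`.
    have hxU := hAU n hxA
    rcases lt_or_gt_of_ne hmn with hlt | hlt
    · exact hxU.2 (K.subset (by omega) (interior_subset hm.1))
    · exact hm.2 (K.subset (by omega) (interior_subset hxU.1))

end SpanningSections

noncomputable section

/-! ### Matrices with entries in an algebra of functions -/

section FunctionMatrices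

open Matrix

variable {B : Type*} (𝒮 : Subalgebra ℝ (B → ℝ)) {m n k : Type*}

/-- The matrix valued function `A` has entries in `𝒮`. -/
def EntriesMem (A : B → Matrix m n ℝ) : Prop := ∀ i j, (fun x => A x i j) ∈ 𝒮

namespace EntriesMem

variable {𝒮}

theorem add {A A' : B → Matrix m n ℝ} (hA : EntriesMem 𝒮 A) (hA' : EntriesMem 𝒮 A') :
    EntriesMem 𝒮 fun x => A x + A' x := fun i j => 𝒮.add_mem (hA i j) (hA' i j)

theorem sub {A A' : B → Matrix m n ℝ} (hA : EntriesMem 𝒮 A) (hA' : EntriesMem 𝒮 A') :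
    EntriesMem 𝒮 fun x => A x - A' x := fun i j => 𝒮.sub_mem (hA i j) (hA' i j)

theorem transpose {A : B → Matrix m n ℝ} (hA : EntriesMem 𝒮 A) :
    EntriesMem 𝒮 fun x => (A x)ᵀ := fun i j => hA j i

theorem const (C : Matrix m n ℝ) : EntriesMem 𝒮 fun _ : B => C :=
  fun i j => 𝒮.algebraMap_mem (C i j)

theorem fromBlocks {m' n' : Type*} {A : B → Matrix m n ℝ} {A' : B → Matrix m n' ℝ}
    {C : B → Matrix m' n ℝ} {C' : B → Matrix m' n' ℝ} (hA : EntriesMem 𝒮 A)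
    (hA' : EntriesMem 𝒮 A') (hC : EntriesMem 𝒮 C) (hC' : EntriesMem 𝒮 C') :
    EntriesMem 𝒮 fun x => Matrix.fromBlocks (A x) (A' x) (C x) (C' x) := by
  rintro (i | i) (j | j)
  · exact hA i j
  · exact hA' i j
  · exact hC i j
  · exact hC' i j

theorem mul [Fintype n] {A : B → Matrix m n ℝ} {A' : B → Matrix n k ℝ} (hA : EntriesMem 𝒮 A)
    (hA' : EntriesMem 𝒮 A') : EntriesMem 𝒮 fun x => A x * A' x := by
  intro i j
  have h : (fun x => (A x * A' x) i j) = ∑ l, (fun x => A x i l) * fun x => A' x l j := by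
    ext x
    simp [Matrix.mul_apply]
  rw [h]
  exact 𝒮.sum_mem fun l _ => 𝒮.mul_mem (hA i l) (hA' l j)

theorem mulVec [Fintype n] {A : B → Matrix m n ℝ} {v : B → n → ℝ} (hA : EntriesMem 𝒮 A)
    (hv : ∀ j, (fun x => v x j) ∈ 𝒮) (i : m) : (fun x => (A x *ᵥ v x) i) ∈ 𝒮 := by
  have h : (fun x => (A x *ᵥ v x) i) = ∑ l, (fun x => A x i l) * fun x => v x l := by
    ext x
    simp [Matrix.mulVec, dotProduct]
  rw [h]
  exact 𝒮.sum_mem fun l _ => 𝒮.mul_mem (hA i l) (hv l)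

variable [Fintype n] [DecidableEq n]

theorem det {A : B → Matrix n n ℝ} (hA : EntriesMem 𝒮 A) : (fun x => (A x).det) ∈ 𝒮 := by
  have h : (fun x => (A x).det) = ∑ σ : Equiv.Perm n,
      algebraMap ℝ (B → ℝ) ((Equiv.Perm.sign σ : ℤ) : ℝ) * ∏ i, fun x => A x (σ i) i := by
    ext x
    simp [Matrix.det_apply']
  rw [h]
  exact 𝒮.sum_mem fun σ _ => 𝒮.mul_mem (𝒮.algebraMap_mem _) (𝒮.prod_mem fun i _ => hA _ _)

/-- By Cramer's rule the inverse is polynomial in the entries and the inverse determinant. -/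
theorem inv {A : B → Matrix n n ℝ} (hA : EntriesMem 𝒮 A)
    (hdet : (fun x => ((A x).det)⁻¹) ∈ 𝒮) : EntriesMem 𝒮 fun x => (A x)⁻¹ := by
  intro i j
  have h : (fun x => (A x)⁻¹ i j) = (fun x => ((A x).det)⁻¹) * fun x => (A x).adjugate i j := by
    ext x
    simp [Matrix.inv_def]
  rw [h]
  refine 𝒮.mul_mem hdet ?_
  simp only [Matrix.adjugate_apply]
  refine det fun a b => ?_
  -- An entry of the adjugate is the determinant of `A` with row `j` replaced by a constant basis
  -- vector.
  by_cases hab : a = j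
  · subst hab
    simp only [Matrix.updateRow_self]
    exact 𝒮.algebraMap_mem (Pi.single (M := fun _ => ℝ) i 1 b)
  · simpa [Matrix.updateRow_ne hab] using hA a b

end EntriesMem

end FunctionMatrices

/-! ### Contractions of exact complexes by means of the Laplacian -/

section Laplacian

open Matrix

variable {a b c e : Type*} [Fintype a] [Fintype b] [Fintype c] [Fintype e]
  [DecidableEq b]

/-- The Laplacian of `d' ∘ d = 0`, completed by the identity on the kernel of the projection `P`. -/
def Matrix.laplacian (d : Matrix b a ℝ) (d' : Matrix c b ℝ) (P : Matrix b b ℝ) : Matrix b b ℝ :=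
  d * dᵀ + d'ᵀ * d' + (1 - P)

/-- The quadratic form of the Laplacian is `|dᵀv|² + |d'v|² + |(1-P)v|²`. A null vector is thus a
cycle in the image of `P`, so `v = dw` by exactness, and `|v|² = ⟨dᵀv, w⟩ = 0`. -/
theorem Matrix.laplacian_det_ne_zero {d : Matrix b a ℝ} {d' : Matrix c b ℝ} {P : Matrix b b ℝ}
    (hPs : Pᵀ = P) (hPP : P * P = P)
    (hex : ∀ v, P *ᵥ v = v → d' *ᵥ v = 0 → ∃ w, d *ᵥ w = v) : (laplacian d d' P).det ≠ 0 := by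
  intro hdet
  obtain ⟨v, hv0, hv⟩ := exists_mulVec_eq_zero_iff.2 hdet
  have hQ : (1 - P) = (1 - P)ᵀ * (1 - P) := by
    rw [transpose_sub, transpose_one, hPs, Matrix.mul_sub, Matrix.sub_mul, Matrix.sub_mul, hPP]
    simp
  have h1 : v ⬝ᵥ (laplacian d d' P *ᵥ v) =
      (dᵀ *ᵥ v) ⬝ᵥ (dᵀ *ᵥ v) + (d' *ᵥ v) ⬝ᵥ (d' *ᵥ v) + ((1 - P) *ᵥ v) ⬝ᵥ ((1 - P) *ᵥ v) := by
    have h3 : v ⬝ᵥ ((1 - P) *ᵥ v) = ((1 - P) *ᵥ v) ⬝ᵥ ((1 - P) *ᵥ v) := by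
      conv_lhs => rw [hQ, ← mulVec_mulVec, dotProduct_mulVec, vecMul_transpose]
    rw [laplacian, add_mulVec, add_mulVec, dotProduct_add, dotProduct_add, h3, ← mulVec_mulVec,
      ← mulVec_mulVec, dotProduct_mulVec, dotProduct_mulVec v d'ᵀ, vecMul_transpose,
      ← mulVec_transpose]
  rw [hv, dotProduct_zero] at h1
  have p1 : 0 ≤ (dᵀ *ᵥ v) ⬝ᵥ (dᵀ *ᵥ v) := Finset.sum_nonneg fun i _ => mul_self_nonneg _
  have p2 : 0 ≤ (d' *ᵥ v) ⬝ᵥ (d' *ᵥ v) := Finset.sum_nonneg fun i _ => mul_self_nonneg _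
  have p3 : 0 ≤ ((1 - P) *ᵥ v) ⬝ᵥ ((1 - P) *ᵥ v) := Finset.sum_nonneg fun i _ => mul_self_nonneg _
  have z1 : dᵀ *ᵥ v = 0 := dotProduct_self_eq_zero.1 (by linarith)
  have z2 : d' *ᵥ v = 0 := dotProduct_self_eq_zero.1 (by linarith)
  have z3 : (1 - P) *ᵥ v = 0 := dotProduct_self_eq_zero.1 (by linarith)
  rw [sub_mulVec, one_mulVec, sub_eq_zero] at z3
  obtain ⟨w, rfl⟩ := hex v z3.symm z2
  refine hv0 (dotProduct_self_eq_zero.1 ?_)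
  rw [dotProduct_mulVec, ← mulVec_transpose, z1, zero_dotProduct]

/-- Consecutive Laplacians are intertwined by `d₁`, hence so are their inverses. The left side
becomes `Δ⁻¹(Δ - (1-Q))`, and `Δ` is the identity on the image of `1-Q`. -/
theorem Matrix.laplacian_contraction [DecidableEq c] {d₀ : Matrix b a ℝ} {d₁ : Matrix c b ℝ}
    {d₂ : Matrix e c ℝ}
    {P : Matrix b b ℝ} {Q : Matrix c c ℝ} (h₁ : d₁ * d₀ = 0) (h₂ : d₂ * d₁ = 0)
    (hP : d₁ * P = d₁) (hQ : Q * d₁ = d₁) (hQ₂ : d₂ * Q = d₂) (hQQ : Q * Q = Q) (hQs : Qᵀ = Q)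
    (hdP : (laplacian d₀ d₁ P).det ≠ 0) (hdQ : (laplacian d₁ d₂ Q).det ≠ 0) :
    d₁ * ((laplacian d₀ d₁ P)⁻¹ * d₁ᵀ) + (laplacian d₁ d₂ Q)⁻¹ * d₂ᵀ * d₂ = Q := by
  have uP := (isUnit_iff_ne_zero.2 hdP)
  have uQ := (isUnit_iff_ne_zero.2 hdQ)
  have c1 : d₁ * laplacian d₀ d₁ P = laplacian d₁ d₂ Q * d₁ := by
    simp only [laplacian, Matrix.mul_add, Matrix.add_mul, Matrix.mul_sub, Matrix.sub_mul,
      ← Matrix.mul_assoc, h₁, hP, hQ]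
    simp [Matrix.mul_assoc, h₂]
  have c2 : d₁ * (laplacian d₀ d₁ P)⁻¹ = (laplacian d₁ d₂ Q)⁻¹ * d₁ := by
    calc d₁ * (laplacian d₀ d₁ P)⁻¹
        = (laplacian d₁ d₂ Q)⁻¹ * (laplacian d₁ d₂ Q * d₁) * (laplacian d₀ d₁ P)⁻¹ := by
          rw [← Matrix.mul_assoc, nonsing_inv_mul _ uQ, Matrix.one_mul]
      _ = (laplacian d₁ d₂ Q)⁻¹ * d₁ := by
          rw [← c1, Matrix.mul_assoc, Matrix.mul_assoc, mul_nonsing_inv _ uP, Matrix.mul_one]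
  have hT : d₁ᵀ * Q = d₁ᵀ := by
    rw [← hQs, ← transpose_mul, hQ]
  have c3 : laplacian d₁ d₂ Q * (1 - Q) = 1 - Q := by
    simp only [laplacian, Matrix.mul_sub, Matrix.add_mul, Matrix.sub_mul, Matrix.mul_assoc, hT,
      hQ₂, hQQ, Matrix.mul_one, Matrix.one_mul]
    abel
  have c4 : (laplacian d₁ d₂ Q)⁻¹ * (1 - Q) = 1 - Q := by
    conv_lhs => rw [← c3]
    rw [← Matrix.mul_assoc, nonsing_inv_mul _ uQ, Matrix.one_mul]
  calc d₁ * ((laplacian d₀ d₁ P)⁻¹ * d₁ᵀ) + (laplacian d₁ d₂ Q)⁻¹ * d₂ᵀ * d₂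
      = (laplacian d₁ d₂ Q)⁻¹ * (laplacian d₁ d₂ Q - (1 - Q)) := by
        have h3 : laplacian d₁ d₂ Q - (1 - Q) = d₁ * d₁ᵀ + d₂ᵀ * d₂ := add_sub_cancel_right _ _
        rw [← Matrix.mul_assoc, c2, h3, Matrix.mul_add, Matrix.mul_assoc, Matrix.mul_assoc]
    _ = Q := by
        rw [Matrix.mul_sub, nonsing_inv_mul _ uQ, c4]
        abel

end Laplacian

/-! ### Framed families of vector spaces -/

/-- A frame of a family of vector spaces: vectors `toFun x (Pi.single i 1)` spanning `V x`, with
dual coordinates chosen so that `coord x ∘ toFun x` is an orthogonal projection with entries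
in `𝒮`. -/
structure Frame {B : Type*} (𝒮 : Subalgebra ℝ (B → ℝ)) (V : B → Type*)
    [∀ x, AddCommGroup (V x)] [∀ x, Module ℝ (V x)] where
  ι : Type
  [fintype : Fintype ι]
  [decEq : DecidableEq ι]
  comb : ∀ x, (ι → ℝ) →ₗ[ℝ] V x
  coord : ∀ x, V x →ₗ[ℝ] ι → ℝ
  comb_coord : ∀ x v, comb x (coord x v) = v
  symm : ∀ x, (LinearMap.toMatrix' (coord x ∘ₗ comb x)).transpose =
    LinearMap.toMatrix' (coord x ∘ₗ comb x)
  proj_mem : EntriesMem 𝒮 fun x => LinearMap.toMatrix' (coord x ∘ₗ comb x)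

attribute [instance] Frame.fintype Frame.decEq

namespace Frame

open Matrix

variable {B : Type*} {𝒮 : Subalgebra ℝ (B → ℝ)} {U V W Q : B → Type*}
  [∀ x, AddCommGroup (U x)] [∀ x, Module ℝ (U x)]
  [∀ x, AddCommGroup (V x)] [∀ x, Module ℝ (V x)]
  [∀ x, AddCommGroup (W x)] [∀ x, Module ℝ (W x)]
  [∀ x, AddCommGroup (Q x)] [∀ x, Module ℝ (Q x)]

/-- The matrix of a family of linear maps. -/
def mat (f : Frame 𝒮 V) (g : Frame 𝒮 W) (T : ∀ x, V x →ₗ[ℝ] W x) (x : B) : Matrix g.ι f.ι ℝ :=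
  LinearMap.toMatrix' (g.coord x ∘ₗ T x ∘ₗ f.comb x)

/-- The orthogonal projection of a frame. -/
def proj (f : Frame 𝒮 V) (x : B) : Matrix f.ι f.ι ℝ :=
  LinearMap.toMatrix' (f.coord x ∘ₗ f.comb x)

theorem mat_mulVec (f : Frame 𝒮 V) (g : Frame 𝒮 W) (T : ∀ x, V x →ₗ[ℝ] W x) (x : B)
    (v : f.ι → ℝ) : f.mat g T x *ᵥ v = g.coord x (T x (f.comb x v)) :=
  LinearMap.toMatrix'_mulVec _ _

theorem mat_apply (f : Frame 𝒮 V) (g : Frame 𝒮 W) (T : ∀ x, V x →ₗ[ℝ] W x) (x : B)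
    (i : g.ι) (j : f.ι) : f.mat g T x i j = g.coord x (T x (f.comb x (Pi.single j 1))) i := by
  rw [mat, LinearMap.toMatrix'_apply]
  rfl

theorem mat_id (f : Frame 𝒮 V) (x : B) : f.mat f (fun _ => LinearMap.id) x = f.proj x := rfl

/-- The frame may be redundant, but `comb ∘ coord = id` between the two factors makes matrices
multiply; the identity goes to the projection `proj`, not to `1`. -/
theorem mat_mul (f : Frame 𝒮 V) (g : Frame 𝒮 W) (h : Frame 𝒮 Q) (T : ∀ x, V x →ₗ[ℝ] W x)
    (S : ∀ x, W x →ₗ[ℝ] Q x) (x : B) :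
    g.mat h S x * f.mat g T x = f.mat h (fun y => S y ∘ₗ T y) x := by
  rw [mat, mat, ← LinearMap.toMatrix'_comp, mat]
  congr 1
  ext v
  simp [g.comb_coord]

theorem proj_mul_proj (f : Frame 𝒮 V) (x : B) : f.proj x * f.proj x = f.proj x := by
  simpa [mat_id] using f.mat_mul f f (fun _ => LinearMap.id) (fun _ => LinearMap.id) x

theorem mat_mul_proj (f : Frame 𝒮 V) (g : Frame 𝒮 W) (T : ∀ x, V x →ₗ[ℝ] W x) (x : B) :
    f.mat g T x * f.proj x = f.mat g T x := by
  simpa [mat_id] using f.mat_mul f g (fun _ => LinearMap.id) T x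

theorem proj_mul_mat (f : Frame 𝒮 V) (g : Frame 𝒮 W) (T : ∀ x, V x →ₗ[ℝ] W x) (x : B) :
    g.proj x * f.mat g T x = f.mat g T x := by
  simpa [mat_id] using f.mat_mul g g T (fun _ => LinearMap.id) x

theorem toMatrix'_prod (f : Frame 𝒮 V) (g : Frame 𝒮 W) (x : B) :
    LinearMap.toMatrix' (
      ({ toFun := fun v => Sum.elim (f.coord x v.1) (g.coord x v.2)
         map_add' := fun v w => by ext (i | i) <;> simp
         map_smul' := fun c v => by ext (i | i) <;> simp } :
          (V x × W x) →ₗ[ℝ] (f.ι ⊕ g.ι → ℝ)) ∘ₗ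
      (f.comb x ∘ₗ LinearMap.funLeft ℝ ℝ Sum.inl).prod
        (g.comb x ∘ₗ LinearMap.funLeft ℝ ℝ Sum.inr)) =
      Matrix.fromBlocks (LinearMap.toMatrix' (f.coord x ∘ₗ f.comb x)) 0 0
        (LinearMap.toMatrix' (g.coord x ∘ₗ g.comb x)) := by
  have h1 : ∀ j : f.ι, (Pi.single (Sum.inl j) 1 : f.ι ⊕ g.ι → ℝ) ∘ Sum.inl = Pi.single j 1 :=
    fun j => by ext i; simp [Pi.single_apply]
  have h2 : ∀ j : f.ι, (Pi.single (Sum.inl j) 1 : f.ι ⊕ g.ι → ℝ) ∘ Sum.inr = 0 :=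
    fun j => by ext i; simp
  have h3 : ∀ j : g.ι, (Pi.single (Sum.inr j) 1 : f.ι ⊕ g.ι → ℝ) ∘ Sum.inl = 0 :=
    fun j => by ext i; simp
  have h4 : ∀ j : g.ι, (Pi.single (Sum.inr j) 1 : f.ι ⊕ g.ι → ℝ) ∘ Sum.inr = Pi.single j 1 :=
    fun j => by ext i; simp [Pi.single_apply]
  ext (i | i) (j | j) <;>
    simp [LinearMap.toMatrix'_apply, LinearMap.funLeft, h1, h2, h3, h4]

/-- The frame of the direct sum of two framed families. -/
def prod (f : Frame 𝒮 V) (g : Frame 𝒮 W) : Frame 𝒮 fun x => V x × W x where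
  ι := f.ι ⊕ g.ι
  comb x := (f.comb x ∘ₗ LinearMap.funLeft ℝ ℝ Sum.inl).prod
    (g.comb x ∘ₗ LinearMap.funLeft ℝ ℝ Sum.inr)
  coord x :=
    { toFun := fun v => Sum.elim (f.coord x v.1) (g.coord x v.2)
      map_add' := fun v w => by ext (i | i) <;> simp
      map_smul' := fun c v => by ext (i | i) <;> simp }
  comb_coord x v := Prod.ext (f.comb_coord x v.1) (g.comb_coord x v.2)
  symm x := by
    rw [toMatrix'_prod, Matrix.fromBlocks_transpose, f.symm, g.symm]
    rfl
  proj_mem := by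
    simp only [toMatrix'_prod]
    exact f.proj_mem.fromBlocks (EntriesMem.const 0) (EntriesMem.const 0) g.proj_mem

/-! ### Block matrices with respect to frames of direct sums -/

section Prod

variable {V' W' : B → Type*} [∀ x, AddCommGroup (V' x)] [∀ x, Module ℝ (V' x)]
  [∀ x, AddCommGroup (W' x)] [∀ x, Module ℝ (W' x)]
  (f : Frame 𝒮 V) (g : Frame 𝒮 W) (f' : Frame 𝒮 V') (g' : Frame 𝒮 W')

theorem prod_comb_inl (x : B) (j : f.ι) :
    (f.prod g).comb x (Pi.single (Sum.inl j) 1) = (f.comb x (Pi.single j 1), 0) := by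
  have h1 : (Pi.single (Sum.inl j) 1 : f.ι ⊕ g.ι → ℝ) ∘ Sum.inl = Pi.single j 1 := by
    ext i; simp [Pi.single_apply]
  have h2 : (Pi.single (Sum.inl j) 1 : f.ι ⊕ g.ι → ℝ) ∘ Sum.inr = 0 := by
    ext i; simp
  change (f.comb x ((Pi.single (Sum.inl j) 1 : f.ι ⊕ g.ι → ℝ) ∘ Sum.inl),
    g.comb x ((Pi.single (Sum.inl j) 1 : f.ι ⊕ g.ι → ℝ) ∘ Sum.inr)) = _
  rw [h1, h2, map_zero]

theorem prod_comb_inr (x : B) (j : g.ι) :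
    (f.prod g).comb x (Pi.single (Sum.inr j) 1) = (0, g.comb x (Pi.single j 1)) := by
  have h1 : (Pi.single (Sum.inr j) 1 : f.ι ⊕ g.ι → ℝ) ∘ Sum.inr = Pi.single j 1 := by
    ext i; simp [Pi.single_apply]
  have h2 : (Pi.single (Sum.inr j) 1 : f.ι ⊕ g.ι → ℝ) ∘ Sum.inl = 0 := by
    ext i; simp
  change (f.comb x ((Pi.single (Sum.inr j) 1 : f.ι ⊕ g.ι → ℝ) ∘ Sum.inl),
    g.comb x ((Pi.single (Sum.inr j) 1 : f.ι ⊕ g.ι → ℝ) ∘ Sum.inr)) = _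
  rw [h1, h2, map_zero]

theorem mat_prod (T : ∀ x, V x × W x →ₗ[ℝ] V' x × W' x) (x : B) :
    (f.prod g).mat (f'.prod g') T x = Matrix.fromBlocks
      (f.mat f' (fun y => LinearMap.fst ℝ _ _ ∘ₗ T y ∘ₗ LinearMap.inl ℝ _ _) x)
      (g.mat f' (fun y => LinearMap.fst ℝ _ _ ∘ₗ T y ∘ₗ LinearMap.inr ℝ _ _) x)
      (f.mat g' (fun y => LinearMap.snd ℝ _ _ ∘ₗ T y ∘ₗ LinearMap.inl ℝ _ _) x)
      (g.mat g' (fun y => LinearMap.snd ℝ _ _ ∘ₗ T y ∘ₗ LinearMap.inr ℝ _ _) x) := by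
  ext (i | i) (j | j)
  · refine (mat_apply ..).trans ?_
    rw [prod_comb_inl, Matrix.fromBlocks_apply₁₁, mat_apply]
    rfl
  · refine (mat_apply ..).trans ?_
    rw [prod_comb_inr, Matrix.fromBlocks_apply₁₂, mat_apply]
    rfl
  · refine (mat_apply ..).trans ?_
    rw [prod_comb_inl, Matrix.fromBlocks_apply₂₁, mat_apply]
    rfl
  · refine (mat_apply ..).trans ?_
    rw [prod_comb_inr, Matrix.fromBlocks_apply₂₂, mat_apply]
    rfl

end Prod

/-- The contraction `V ← W` of an exact complex `U → V → W` of framed families. -/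
def homotopy (f : Frame 𝒮 U) (g : Frame 𝒮 V) (h : Frame 𝒮 W) (d₀ : ∀ x, U x →ₗ[ℝ] V x)
    (d₁ : ∀ x, V x →ₗ[ℝ] W x) (x : B) : W x →ₗ[ℝ] V x :=
  g.comb x ∘ₗ Matrix.toLin' ((laplacian (f.mat g d₀ x) (g.mat h d₁ x) (g.proj x))⁻¹ *
    (g.mat h d₁ x)ᵀ) ∘ₗ h.coord x

theorem laplacian_det_ne_zero (f : Frame 𝒮 U) (g : Frame 𝒮 V) (h : Frame 𝒮 W)
    {d₀ : ∀ x, U x →ₗ[ℝ] V x} {d₁ : ∀ x, V x →ₗ[ℝ] W x}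
    (hex : ∀ x v, d₁ x v = 0 → ∃ u, d₀ x u = v) (x : B) :
    (laplacian (f.mat g d₀ x) (g.mat h d₁ x) (g.proj x)).det ≠ 0 := by
  refine Matrix.laplacian_det_ne_zero (g.symm x) (g.proj_mul_proj x) fun v hv hd => ?_
  have hv' : g.coord x (g.comb x v) = v := by
    rw [← mat_id, mat_mulVec] at hv
    exact hv
  rw [mat_mulVec] at hd
  obtain ⟨u, hu⟩ := hex x (g.comb x v) (by rw [← h.comb_coord x (d₁ x _), hd, map_zero])
  exact ⟨f.coord x u, by rw [mat_mulVec, f.comb_coord, hu, hv']⟩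

/-- The two outer projections come from passing through `coord ∘ comb` at both ends; they have
entries in `𝒮` as well. -/
theorem mat_homotopy (f : Frame 𝒮 U) (g : Frame 𝒮 V) (h : Frame 𝒮 W) (d₀ : ∀ x, U x →ₗ[ℝ] V x)
    (d₁ : ∀ x, V x →ₗ[ℝ] W x) (x : B) : h.mat g (f.homotopy g h d₀ d₁) x =
      g.proj x * ((laplacian (f.mat g d₀ x) (g.mat h d₁ x) (g.proj x))⁻¹ *
        (g.mat h d₁ x)ᵀ) * h.proj x := by
  rw [mat, homotopy, proj, proj, ← LinearMap.toMatrix'_toLin' (_⁻¹ * _),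
    ← LinearMap.toMatrix'_comp, ← LinearMap.toMatrix'_comp]
  simp only [LinearMap.toMatrix'_toLin']
  rfl

theorem homotopy_mem (f : Frame 𝒮 U) (g : Frame 𝒮 V) (h : Frame 𝒮 W)
    {d₀ : ∀ x, U x →ₗ[ℝ] V x} {d₁ : ∀ x, V x →ₗ[ℝ] W x}
    (hinv : ∀ r ∈ 𝒮, (∀ x, r x ≠ 0) → (fun x => (r x)⁻¹) ∈ 𝒮)
    (hd₀ : EntriesMem 𝒮 (f.mat g d₀)) (hd₁ : EntriesMem 𝒮 (g.mat h d₁))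
    (hex : ∀ x v, d₁ x v = 0 → ∃ u, d₀ x u = v) :
    EntriesMem 𝒮 (h.mat g (f.homotopy g h d₀ d₁)) := by
  have hL : EntriesMem 𝒮 fun x => laplacian (f.mat g d₀ x) (g.mat h d₁ x) (g.proj x) :=
    ((hd₀.mul hd₀.transpose).add (hd₁.transpose.mul hd₁)).add
      ((EntriesMem.const 1).sub g.proj_mem)
  have := (g.proj_mem.mul ((hL.inv (hinv _ hL.det (f.laplacian_det_ne_zero g h hex))).mul
    hd₁.transpose)).mul h.proj_mem
  intro i j
  simpa only [mat_homotopy] using! this i j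

/-- The matrix identity gives the projection onto the frame of `W`, which becomes the identity once
`comb` and `coord` are applied on the outside. -/
theorem homotopy_spec (f : Frame 𝒮 U) (g : Frame 𝒮 V) (h : Frame 𝒮 W) (k : Frame 𝒮 Q)
    {d₀ : ∀ x, U x →ₗ[ℝ] V x} {d₁ : ∀ x, V x →ₗ[ℝ] W x} {d₂ : ∀ x, W x →ₗ[ℝ] Q x}
    (h₁ : ∀ x v, d₁ x (d₀ x v) = 0) (h₂ : ∀ x v, d₂ x (d₁ x v) = 0)
    (hex₀ : ∀ x v, d₁ x v = 0 → ∃ u, d₀ x u = v) (hex₁ : ∀ x v, d₂ x v = 0 → ∃ u, d₁ x u = v)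
    (x : B) (w : W x) :
    d₁ x (f.homotopy g h d₀ d₁ x w) + g.homotopy h k d₁ d₂ x (d₂ x w) = w := by
  have key := laplacian_contraction (d₀ := f.mat g d₀ x) (d₁ := g.mat h d₁ x)
    (d₂ := h.mat k d₂ x) (P := g.proj x) (Q := h.proj x)
    (by rw [mat_mul]; simp [mat, show d₁ x ∘ₗ d₀ x = 0 from
          LinearMap.ext (h₁ x)])
    (by rw [mat_mul]; simp [mat, show d₂ x ∘ₗ d₁ x = 0 from
          LinearMap.ext (h₂ x)])
    (mat_mul_proj ..) (proj_mul_mat ..) (mat_mul_proj ..) (proj_mul_proj ..) (h.symm x)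
    (f.laplacian_det_ne_zero g h hex₀ x) (g.laplacian_det_ne_zero h k hex₁ x)
  have key2 := congrArg (fun A => h.comb x (A *ᵥ h.coord x w)) key
  have hw : h.comb x (h.proj x *ᵥ h.coord x w) = w := by
    rw [← mat_id, mat_mulVec, h.comb_coord, h.comb_coord, LinearMap.id_apply]
  simp only [add_mulVec, ← mulVec_mulVec, map_add, mat_mulVec, h.comb_coord, hw] at key2
  simpa [homotopy, ← mulVec_mulVec] using key2

end Frame

end

noncomputable section

/-! ### Pseudo-inverses of finite families of sections -/

section PseudoInverse

open Matrix Module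

variable {M : Type*} [TopologicalSpace M]
  {F : Type*} [NormedAddCommGroup F] [NormedSpace ℝ F] [FiniteDimensional ℝ F]
  {V : M → Type*} [∀ x, AddCommGroup (V x)] [∀ x, Module ℝ (V x)] [∀ x, TopologicalSpace (V x)]
  [TopologicalSpace (TotalSpace F V)] [FiberBundle F V] [VectorBundle ℝ F V]
  {n : ℕ} (e : Fin n → ∀ x, V x)

/-- The matrix of the vectors `e j y` in the trivialization at `x₀`. -/
def sectionMatrix (x₀ y : M) : Matrix (Fin (finrank ℝ F)) (Fin n) ℝ :=
  Matrix.of fun i j => (finBasis ℝ F).equivFun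
    ((trivializationAt F V x₀).linearMapAt ℝ y (e j y)) i

/-- The pseudo-inverse of `c ↦ ∑ c j • e j y`, computed in the trivialization at `x₀`. -/
def localCoord (x₀ y : M) : V y →ₗ[ℝ] Fin n → ℝ :=
  Matrix.toLin' ((sectionMatrix (F := F) e x₀ y)ᵀ *
      (sectionMatrix (F := F) e x₀ y * (sectionMatrix (F := F) e x₀ y)ᵀ)⁻¹) ∘ₗ
    (finBasis ℝ F).equivFun.toLinearMap ∘ₗ (trivializationAt F V x₀).linearMapAt ℝ y

variable {e}

theorem sectionMatrix_mulVec (x₀ y : M) (c : Fin n → ℝ) :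
    sectionMatrix (F := F) e x₀ y *ᵥ c = (finBasis ℝ F).equivFun
      ((trivializationAt F V x₀).linearMapAt ℝ y
        (Fintype.linearCombination ℝ (fun j => e j y) c)) := by
  ext i
  simp [sectionMatrix, Matrix.mulVec, dotProduct, Fintype.linearCombination_apply, mul_comm]

/-- A null vector of `S Sᵀ` satisfies `Sᵀv = 0`; read in the trivialization, `v` is a functional
killing all the `e j y`, so it is zero by spanning. -/
theorem sectionMatrix_gram_det_ne_zero {x₀ y : M} (hy : y ∈ (trivializationAt F V x₀).baseSet)
    (he : ∀ μ : V y →ₗ[ℝ] ℝ, (∀ i, μ (e i y) = 0) → μ = 0) :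
    (sectionMatrix (F := F) e x₀ y * (sectionMatrix (F := F) e x₀ y)ᵀ).det ≠ 0 := by
  intro hdet
  obtain ⟨v, hv0, hv⟩ := exists_mulVec_eq_zero_iff.2 hdet
  have h1 : (sectionMatrix (F := F) e x₀ y)ᵀ *ᵥ v = 0 := by
    refine dotProduct_self_eq_zero.1 ?_
    rw [dotProduct_mulVec, vecMul_transpose, mulVec_mulVec, hv, zero_dotProduct]
  let ν : F →ₗ[ℝ] ℝ := ∑ i, v i • (finBasis ℝ F).coord i
  have h2 := he (ν ∘ₗ (trivializationAt F V x₀).linearMapAt ℝ y) fun j => by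
    have := congrFun h1 j
    simpa [ν, sectionMatrix, Matrix.mulVec, dotProduct, mul_comm] using this
  refine hv0 (funext fun i => ?_)
  have h3 := LinearMap.congr_fun h2
    ((trivializationAt F V x₀).symmₗ ℝ y (finBasis ℝ F i))
  rw [LinearMap.comp_apply, (trivializationAt F V x₀).linearMapAt_symmₗ hy] at h3
  simpa [ν, Finsupp.single_apply] using h3

theorem comb_localCoord {x₀ y : M} (hy : y ∈ (trivializationAt F V x₀).baseSet)
    (he : ∀ μ : V y →ₗ[ℝ] ℝ, (∀ i, μ (e i y) = 0) → μ = 0) (v : V y) :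
    Fintype.linearCombination ℝ (fun j => e j y) (localCoord (F := F) e x₀ y v) = v := by
  have h := sectionMatrix_mulVec (F := F) (e := e) x₀ y (localCoord (F := F) e x₀ y v)
  have hu := isUnit_iff_ne_zero.2 (sectionMatrix_gram_det_ne_zero (F := F) hy he)
  rw [localCoord, LinearMap.comp_apply, Matrix.toLin'_apply, mulVec_mulVec, ← Matrix.mul_assoc,
    mul_nonsing_inv _ hu, one_mulVec] at h
  have h2 := congrArg ((trivializationAt F V x₀).symmₗ ℝ y) ((finBasis ℝ F).equivFun.injective h)
  rw [(trivializationAt F V x₀).symmₗ_linearMapAt hy,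
    (trivializationAt F V x₀).symmₗ_linearMapAt hy] at h2
  exact h2.symm

/-- The image of `Sᵀ` is orthogonal to the kernel of `S`: the pseudo-inverse picks the coefficients
orthogonal to all relations. -/
theorem dotProduct_localCoord (x₀ : M) {y : M} {c : Fin n → ℝ}
    (hc : Fintype.linearCombination ℝ (fun j => e j y) c = 0) (v : V y) :
    c ⬝ᵥ localCoord (F := F) e x₀ y v = 0 := by
  have h := sectionMatrix_mulVec (F := F) (e := e) x₀ y c
  rw [hc, map_zero, map_zero] at h
  rw [localCoord, LinearMap.comp_apply, Matrix.toLin'_apply, ← mulVec_mulVec, dotProduct_mulVec,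
    vecMul_transpose, h, zero_dotProduct]

/-- The difference of the two coefficient vectors is a relation and is orthogonal to all relations,
hence zero. So the coordinates are intrinsic although they are computed in a trivialization. -/
theorem localCoord_eq {x₀ x₁ y : M} (h₀ : y ∈ (trivializationAt F V x₀).baseSet)
    (h₁ : y ∈ (trivializationAt F V x₁).baseSet)
    (he : ∀ μ : V y →ₗ[ℝ] ℝ, (∀ i, μ (e i y) = 0) → μ = 0) (v : V y) :
    localCoord (F := F) e x₀ y v = localCoord (F := F) e x₁ y v := by
  have h : Fintype.linearCombination ℝ (fun j => e j y)
      (localCoord (F := F) e x₀ y v - localCoord (F := F) e x₁ y v) = 0 := by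
    rw [map_sub, comb_localCoord h₀ he, comb_localCoord h₁ he, sub_self]
  rw [← sub_eq_zero, ← dotProduct_self_eq_zero, dotProduct_sub, dotProduct_localCoord x₀ h,
    dotProduct_localCoord x₁ h, sub_zero]

theorem localCoord_comb_symm (x₀ y : M) :
    (LinearMap.toMatrix' (localCoord (F := F) e x₀ y ∘ₗ
      Fintype.linearCombination ℝ (fun j => e j y)))ᵀ =
    LinearMap.toMatrix' (localCoord (F := F) e x₀ y ∘ₗ
      Fintype.linearCombination ℝ (fun j => e j y)) := by
  have h : localCoord (F := F) e x₀ y ∘ₗ Fintype.linearCombination ℝ (fun j => e j y) =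
      Matrix.toLin' ((sectionMatrix (F := F) e x₀ y)ᵀ *
        (sectionMatrix (F := F) e x₀ y * (sectionMatrix (F := F) e x₀ y)ᵀ)⁻¹ *
          sectionMatrix (F := F) e x₀ y) := by
    refine LinearMap.ext fun c => ?_
    rw [LinearMap.comp_apply, localCoord, LinearMap.comp_apply, LinearMap.comp_apply,
      LinearEquiv.coe_coe, ← sectionMatrix_mulVec, Matrix.toLin'_apply, Matrix.toLin'_apply,
      mulVec_mulVec]
  rw [h, LinearMap.toMatrix'_toLin']
  simp [Matrix.transpose_mul, Matrix.transpose_nonsing_inv, Matrix.mul_assoc]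

end PseudoInverse

section Groupoid

variable {EM : Type*} [NormedAddCommGroup EM] [NormedSpace ℝ EM]
  {M : Type*} [TopologicalSpace M] [ChartedSpace EM M]
  {EG : Type*} [NormedAddCommGroup EG] [NormedSpace ℝ EG]
  {G : Type*} [TopologicalSpace G] [ChartedSpace EG G]
  {𝒢 : LieGroupoid EM M EG G} {E : GradedVectorBundle EM M}

/-! ### Algebras of smooth functions -/

open Classical in
theorem IsSmoothFunction.mul {k : ℕ} {f g : 𝒢.strings k → ℝ} (hf : IsSmoothFunction 𝒢 f)
    (hg : IsSmoothFunction 𝒢 g) : IsSmoothFunction 𝒢 fun p => f p * g p := by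
  refine (hf.smul hg).congr fun p hp => ?_
  simp [hp]

open Classical in
theorem isSmoothFunction_const {k : ℕ} (c : ℝ) :
    IsSmoothFunction 𝒢 (fun _ : 𝒢.strings k => c) := by
  refine (contMDiffOn_const (c := c)).congr fun p hp => ?_
  simp [hp]

open Classical in
theorem IsSmoothFunction.inv {k : ℕ} {f : 𝒢.strings k → ℝ} (hf : IsSmoothFunction 𝒢 f)
    (h0 : ∀ p, f p ≠ 0) : IsSmoothFunction 𝒢 fun p => (f p)⁻¹ := by
  refine (ContMDiffOn.inv₀ hf fun p hp => ?_).congr fun p hp => ?_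
  · simpa [hp] using h0 _
  · simp [hp]

theorem IsSmoothSection.sum {k : ℕ} {l : ℤ} {ι : Type*} (s : Finset ι)
    {η : ι → ∀ p : 𝒢.strings k, E.Fib l p.1.1} (hη : ∀ i ∈ s, IsSmoothSection 𝒢 E (η i)) :
    IsSmoothSection 𝒢 E fun p => ∑ i ∈ s, η i p := by
  classical
  induction s using Finset.induction_on with
  | empty => simpa using isSmoothSection_zero
  | insert a s ha ih =>
    simp only [Finset.sum_insert ha]
    exact (hη a (by simp)).add (ih fun i hi => hη i (by simp [hi]))

namespace LieGroupoid

theorem contMDiff_base (k : ℕ) : ContMDiff (ambient EM EG k) (ambient EM EG 0) ∞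
    (fun p : M × (Fin k → G) => ((p.1, Fin.elim0) : M × (Fin 0 → G))) :=
  fun _ => contMDiffAt_fst.prodMk contMDiffAt_const

theorem eq_objString (p : 𝒢.strings 0) : p = 𝒢.objString p.1.1 :=
  Subtype.ext (Prod.ext rfl (funext fun i => i.elim0))

variable (𝒢) in
/-- The smooth functions on `M`. -/
def smoothBase : Subalgebra ℝ (M → ℝ) where
  carrier := {f | IsSmoothFunction 𝒢 fun p : 𝒢.strings 0 => f p.1.1}
  mul_mem' {f g} hf hg := IsSmoothFunction.mul (f := fun p : 𝒢.strings 0 => f p.1.1)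
    (g := fun p => g p.1.1) hf hg
  add_mem' {f g} hf hg := IsSmoothFunction.add (f := fun p : 𝒢.strings 0 => f p.1.1)
    (g := fun p => g p.1.1) hf hg
  algebraMap_mem' c := isSmoothFunction_const c

theorem mem_smoothBase {f : M → ℝ} :
    f ∈ 𝒢.smoothBase ↔ IsSmoothFunction 𝒢 fun p : 𝒢.strings 0 => f p.1.1 := Iff.rfl

theorem inv_mem_smoothBase {f : M → ℝ} (hf : f ∈ 𝒢.smoothBase) (h0 : ∀ x, f x ≠ 0) :
    (fun x => (f x)⁻¹) ∈ 𝒢.smoothBase :=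
  IsSmoothFunction.inv (mem_smoothBase.1 hf) fun p => h0 p.1.1

end LieGroupoid

theorem IsSmoothFunction.of_base {f : M → ℝ} (hf : f ∈ 𝒢.smoothBase) (k : ℕ) :
    IsSmoothFunction 𝒢 fun p : 𝒢.strings k => f p.1.1 :=
  IsSmoothFunction.comp (LieGroupoid.mem_smoothBase.1 hf) (LieGroupoid.contMDiff_base k).contMDiffOn
    fun {p} _ => (𝒢.objString p.1).2

open Classical in
theorem IsSmoothSection.of_base {l : ℤ} {s : ∀ x, E.Fib l x}
    (hs : IsSmoothSection 𝒢 E fun p : 𝒢.strings 0 => s p.1.1) (k : ℕ) :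
    IsSmoothSection 𝒢 E fun p : 𝒢.strings k => s p.1.1 := by
  unfold IsSmoothSection at hs ⊢
  refine (hs.comp (LieGroupoid.contMDiff_base k).contMDiffOn
    fun p _ => (𝒢.objString p.1).2).congr fun p hp => ?_
  have h1 : ((p.1, Fin.elim0) : M × (Fin 0 → G)) ∈ 𝒢.strings 0 := (𝒢.objString p.1).2
  simp only [Function.comp, dif_pos h1]
  rw [dif_pos hp]

open Classical in
theorem isSmoothSection_of_contMDiff {l : ℤ} {s : ∀ x, E.Fib l x}
    (hs : ContMDiff 𝓘(ℝ, EM) (𝓘(ℝ, EM).prod 𝓘(ℝ, E.Model l)) ∞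
      fun x => TotalSpace.mk' (E.Model l) x (s x)) (k : ℕ) :
    IsSmoothSection 𝒢 E fun p : 𝒢.strings k => s p.1.1 := by
  refine (hs.comp contMDiff_fst).contMDiffOn.congr fun p hp => ?_
  rw [dif_pos hp]
  rfl

variable (𝒢) in
/-- The functions on `M × G ^ k` which are smooth at `p` along `G_k`. -/
def smoothAlong {k : ℕ} (p : M × (Fin k → G)) : Subalgebra ℝ (M × (Fin k → G) → ℝ) where
  carrier := {f | ContMDiffWithinAt (LieGroupoid.ambient EM EG k) 𝓘(ℝ, ℝ) ∞ f (𝒢.strings k) p}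
  mul_mem' hf hg := ContMDiffWithinAt.smul hf hg
  add_mem' hf hg := ContMDiffWithinAt.add hf hg
  algebraMap_mem' _ := contMDiffWithinAt_const

/-! ### Smooth frames -/

variable (𝒢 E) in
/-- A frame of `E^l` consisting of smooth sections whose coordinate functions are smooth. -/
structure SmoothFrame (l : ℤ) extends Frame 𝒢.smoothBase (E.Fib l) where
  comb_smooth : ∀ i, IsSmoothSection 𝒢 E fun p : 𝒢.strings 0 => comb p.1.1 (Pi.single i 1)
  coord_smooth : ∀ {k : ℕ} {η : ∀ p : 𝒢.strings k, E.Fib l p.1.1}, IsSmoothSection 𝒢 E η →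
    ∀ i, IsSmoothFunction 𝒢 fun p => coord p.1.1 (η p) i

open Module in
open Classical in
-- Smoothness is local, and near `p` the trivialization at the moving point may be replaced by the
-- fixed one at `p.1`, where the formula is rational with nonvanishing denominator.
theorem isSmoothFunction_localCoord {n k : ℕ} {l : ℤ}
    {e : Fin n → Cₛ^∞⟮𝓘(ℝ, EM); E.Model l, E.Fib l⟯} (he : SpansOn Set.univ e)
    {η : ∀ p : 𝒢.strings k, E.Fib l p.1.1} (hη : IsSmoothSection 𝒢 E η) (i : Fin n) :
    IsSmoothFunction 𝒢 fun p =>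
      localCoord (F := E.Model l) (fun j x => e j x) p.1.1 p.1.1 (η p) i := by
  rw [isSmoothSection_iff] at hη
  intro p hp
  set t := trivializationAt (E.Model l) (E.Fib l) p.1 with ht
  have hpt : p.1 ∈ t.baseSet := FiberBundle.mem_baseSet_trivializationAt' p.1
  have hnear : ∀ᶠ q in 𝓝[𝒢.strings k] p, q.1 ∈ t.baseSet :=
    continuous_fst.continuousWithinAt (t.open_baseSet.mem_nhds hpt)
  have hcoord : ∀ {m : M × (Fin k → G) → E.Model l}, ContMDiffWithinAt
      (LieGroupoid.ambient EM EG k) 𝓘(ℝ, E.Model l) ∞ m (𝒢.strings k) p → ∀ j,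
      (fun q => (finBasis ℝ (E.Model l)).equivFun (m q) j) ∈ smoothAlong 𝒢 p := by
    intro m hm j
    exact ContDiff.comp_contMDiffWithinAt (g := fun v => (finBasis ℝ (E.Model l)).equivFun v j)
      (LinearMap.toContinuousLinearMap ((finBasis ℝ (E.Model l)).coord j)).contDiff hm
  have hB : EntriesMem (smoothAlong 𝒢 p) fun q =>
      sectionMatrix (F := E.Model l) (fun j x => e j x) p.1 q.1 := by
    intro a j
    have h1 := (Bundle.contMDiffAt_section p.1).1 ((e j).contMDiff p.1)
    have h2 := hcoord (h1.comp p contMDiffAt_fst).contMDiffWithinAt a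
    refine ContMDiffWithinAt.congr_of_eventuallyEq_of_mem h2 ?_ hp
    filter_upwards [hnear] with q hq
    simp only [sectionMatrix, Matrix.of_apply, ← ht, t.coe_linearMapAt_of_mem hq]
    rfl
  have hgram := hB.mul hB.transpose
  have hdet : (fun q => ((sectionMatrix (F := E.Model l) (fun j x => e j x) p.1 q.1 *
      (sectionMatrix (F := E.Model l) (fun j x => e j x) p.1 q.1).transpose).det)⁻¹) ∈
        smoothAlong 𝒢 p :=
    ContMDiffWithinAt.inv₀ hgram.det (sectionMatrix_gram_det_ne_zero hpt (he p.1 trivial))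
  have key := (hB.transpose.mul (hgram.inv hdet)).mulVec (hcoord (hη p hp)) i
  refine ContMDiffWithinAt.congr_of_eventuallyEq_of_mem key ?_ hp
  filter_upwards [hnear, self_mem_nhdsWithin] with q hq hqs
  rw [dif_pos hqs, localCoord_eq (FiberBundle.mem_baseSet_trivializationAt' q.1) hq
    (he q.1 trivial), localCoord]
  simp only [LinearMap.comp_apply, ← ht, t.coe_linearMapAt_of_mem hq, dif_pos hqs]
  rfl

variable (𝒢 E) in
theorem nonempty_smoothFrame [FiniteDimensional ℝ EM] [IsManifold 𝓘(ℝ, EM) ∞ M] [T2Space M]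
    [SigmaCompactSpace M] (l : ℤ) : Nonempty (SmoothFrame 𝒢 E l) := by
  obtain ⟨n, e, he⟩ := exists_spansOn_univ (EM := EM) (F := E.Model l) (V := E.Fib l)
  have hsmooth : ∀ j, IsSmoothSection 𝒢 E fun p : 𝒢.strings 0 => e j p.1.1 := fun j =>
    isSmoothSection_of_contMDiff (e j).contMDiff 0
  have hsingle : ∀ (j : Fin n) (x : M),
      Fintype.linearCombination ℝ (fun j => e j x) (Pi.single j 1) = e j x := fun j x => by
    simp [Fintype.linearCombination_apply_single]
  refine ⟨{
    ι := Fin n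
    comb := fun x => Fintype.linearCombination ℝ fun j => e j x
    coord := fun x => localCoord (F := E.Model l) (fun j x => e j x) x x
    comb_coord := fun x v => comb_localCoord (FiberBundle.mem_baseSet_trivializationAt' x)
      (he x trivial) v
    symm := fun x => localCoord_comb_symm (e := fun j x => e j x) x x
    proj_mem := fun i j => ?_
    comb_smooth := fun j => ?_
    coord_smooth := isSmoothFunction_localCoord he }⟩
  · have := isSmoothFunction_localCoord he (hsmooth j) i
    simp only [LinearMap.toMatrix'_apply]
    rw [LieGroupoid.mem_smoothBase]
    simpa [hsingle] using this
  · simpa only [hsingle] using hsmooth j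

end Groupoid

end

noncomputable section

section Groupoid

variable {EM : Type*} [NormedAddCommGroup EM] [NormedSpace ℝ EM]
  {M : Type*} [TopologicalSpace M] [ChartedSpace EM M]
  {EG : Type*} [NormedAddCommGroup EG] [NormedSpace ℝ EG]
  {G : Type*} [TopologicalSpace G] [ChartedSpace EG G]
  {𝒢 : LieGroupoid EM M EG G} {E F : GradedVectorBundle EM M}

namespace LieGroupoid

/-! ### Bookkeeping in `C(G; E)` -/

variable (𝒢 E) in
/-- The inclusion of `C^k(G; E^l)` in `C(G; E)`. -/
abbrev inc (k : ℕ) (l : ℤ) : 𝒢.Cochains E k l →ₗ[ℝ] 𝒢.TotalCochains E :=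
  DirectSum.lof ℝ (ℕ × ℤ) (fun a : ℕ × ℤ => 𝒢.Cochains E a.1 a.2) (k, l)

theorem inc_apply_of_ne {k : ℕ} {l : ℤ} (ζ : 𝒢.Cochains E k l) {a : ℕ × ℤ} (h : (k, l) ≠ a) :
    𝒢.inc E k l ζ a = 0 :=
  DirectSum.of_eq_of_ne _ _ _ h.symm

/-- Reduces a statement about `T η` to homogeneous elements in the bidegrees where `η` may be
nonzero. -/
theorem map_mem_of_components {N : Type*} [AddCommGroup N] [Module ℝ N]
    (T : 𝒢.TotalCochains E →ₗ[ℝ] N) (S : Submodule ℝ N) {P : ℕ × ℤ → Prop}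
    (hT : ∀ k l, P (k, l) → ∀ ζ : 𝒢.Cochains E k l, T (𝒢.inc E k l ζ) ∈ S)
    {η : 𝒢.TotalCochains E} (hη : ∀ a, ¬ P a → η a = 0) : T η ∈ S := by
  classical
  have h := DirectSum.sum_support_of (β := fun a : ℕ × ℤ => 𝒢.Cochains E a.1 a.2) η
  rw [← h, map_sum]
  refine S.sum_mem fun a ha => hT a.1 a.2 ?_ (η a)
  by_contra hP
  exact (DFinsupp.mem_support_iff.1 ha) (hη a hP)

theorem inc_mem_totalDegree {k : ℕ} {l n : ℤ} (h : (k : ℤ) + l = n) (ζ : 𝒢.Cochains E k l) :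
    𝒢.inc E k l ζ ∈ 𝒢.totalDegree E n := fun a ha =>
  inc_apply_of_ne ζ fun hka => ha (by rw [← hka]; exact h)

/-- The right action of `f` as a linear map. -/
def starHom {m : ℕ} (f : 𝒢.Functions m) : 𝒢.TotalCochains E →ₗ[ℝ] 𝒢.TotalCochains E :=
  DirectSum.toModule ℝ (ℕ × ℤ) (𝒢.TotalCochains E)
    (fun a => (DirectSum.lof ℝ (ℕ × ℤ) (fun b : ℕ × ℤ => 𝒢.Cochains E b.1 b.2)
      (a.1 + m, a.2)).comp (𝒢.starRight E f a.1 a.2))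

theorem starHom_apply {m : ℕ} (f : 𝒢.Functions m) (η : 𝒢.TotalCochains E) :
    starHom f η = 𝒢.star η f := rfl

theorem star_apply_of_lt {m k : ℕ} (h : k < m) (l : ℤ) (f : 𝒢.Functions m)
    (η : 𝒢.TotalCochains E) : 𝒢.star η f (k, l) = 0 := by
  refine map_mem_of_components (P := fun _ => True)
    (DirectSum.component ℝ (ℕ × ℤ) (fun a : ℕ × ℤ => 𝒢.Cochains E a.1 a.2) (k, l) ∘ₗ starHom f) ⊥
    (fun k' l' _ ζ => ?_) fun a ha => absurd trivial ha
  rw [LinearMap.comp_apply, starHom_apply, star_lof]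
  exact inc_apply_of_ne _ fun h' => by
    have := congrArg Prod.fst h'
    simp at this
    omega

theorem star_apply_add {m : ℕ} (k : ℕ) (l : ℤ) (f : 𝒢.Functions m) (η : 𝒢.TotalCochains E) :
    𝒢.star η f (k + m, l) = 𝒢.starRight E f k l (η (k, l)) := by
  rw [← sub_eq_zero]
  refine map_mem_of_components (P := fun _ => True)
    (DirectSum.component ℝ (ℕ × ℤ) (fun a : ℕ × ℤ => 𝒢.Cochains E a.1 a.2) (k + m, l) ∘ₗ
      starHom f - 𝒢.starRight E f k l ∘ₗ
        DirectSum.component ℝ (ℕ × ℤ) (fun a : ℕ × ℤ => 𝒢.Cochains E a.1 a.2) (k, l)) ⊥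
    (fun k' l' _ ζ => ?_) fun a ha => absurd trivial ha
  rw [LinearMap.sub_apply, LinearMap.comp_apply, LinearMap.comp_apply, starHom_apply, star_lof,
    Submodule.mem_bot]
  by_cases h : (k', l') = (k, l)
  · obtain ⟨rfl, rfl⟩ := Prod.mk.inj h
    rw [DirectSum.component.lof_self, DirectSum.component.lof_self, sub_self]
  · have h' : (k' + m, l') ≠ (k + m, l) := fun h'' => h (by simpa using h'')
    have e1 : 𝒢.inc E (k' + m) l' (𝒢.starRight E f k' l' ζ) (k + m, l) = 0 :=
      inc_apply_of_ne _ h'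
    have e2 : 𝒢.inc E k' l' ζ (k, l) = 0 := inc_apply_of_ne _ h
    change 𝒢.inc E (k' + m) l' (𝒢.starRight E f k' l' ζ) (k + m, l) -
      𝒢.starRight E f k l (𝒢.inc E k' l' ζ (k, l)) = 0
    rw [e1, e2, map_zero, sub_zero]

/-- The value at `x` of a section of `E^l`. -/
def eval {l : ℤ} (x : M) : 𝒢.Cochains E 0 l →ₗ[ℝ] E.Fib l x :=
  (LinearMap.proj (𝒢.objString x)).comp (𝒢.Cochains E 0 l).subtype

/-- The value at `x` of the component in `C^0(G; E^l)`. -/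
def objValue (l : ℤ) (x : M) : 𝒢.TotalCochains E →ₗ[ℝ] E.Fib l x :=
  (eval x).comp (DirectSum.component ℝ (ℕ × ℤ) (fun a : ℕ × ℤ => 𝒢.Cochains E a.1 a.2) (0, l))

theorem eq_zero_of_objValue {l : ℤ} {η : 𝒢.TotalCochains E} (h : ∀ x, objValue l x η = 0) :
    η (0, l) = 0 := by
  refine Subtype.ext (funext fun p => ?_)
  rw [eq_objString p]
  exact h p.1.1

variable (𝒢 E) in
/-- The cochains with components in bundle degrees at most `l`. -/
def degreeLE (l : ℤ) : Submodule ℝ (𝒢.TotalCochains E) where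
  carrier := {η | ∀ a : ℕ × ℤ, l < a.2 → η a = 0}
  add_mem' hη hθ a ha := by simp [hη a ha, hθ a ha]
  zero_mem' a _ := rfl
  smul_mem' c η hη a ha := by simp [DirectSum.smul_apply, hη a ha]

theorem degreeLE_mono {l l' : ℤ} (h : l ≤ l') : 𝒢.degreeLE E l ≤ 𝒢.degreeLE E l' :=
  fun _ hη a ha => hη a (h.trans_lt ha)

theorem star_mem_degreeLE {l : ℤ} {m : ℕ} (f : 𝒢.Functions m) {η : 𝒢.TotalCochains E}
    (hη : η ∈ 𝒢.degreeLE E l) : 𝒢.star η f ∈ 𝒢.degreeLE E l := by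
  refine map_mem_of_components (N := 𝒢.TotalCochains E) (P := fun a => a.2 ≤ l) (starHom f) _
    (fun k' l' hl ζ => ?_)
    fun a ha => hη a (not_le.1 ha)
  rw [starHom_apply, star_lof]
  exact fun a ha => inc_apply_of_ne _ fun h => by
    rw [← h] at ha
    exact absurd hl (not_le.2 ha)

/-- Once the `C^0` part vanishes, only `k ≥ 1` remains, and `k + l = n` forces `l ≤ n - 1`. -/
theorem mem_degreeLE_of_totalDegree {n : ℤ} {η : 𝒢.TotalCochains E}
    (hη : η ∈ 𝒢.totalDegree E n) (h0 : η (0, n) = 0) : η ∈ 𝒢.degreeLE E (n - 1) := by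
  rintro ⟨k, l⟩ ha
  by_cases h : (k : ℤ) + l = n
  · simp only at ha
    obtain rfl : k = 0 := by omega
    obtain rfl : l = n := by simpa using h
    exact h0
  · exact hη _ h

/-- The identification of `G_k` with `G_{0 + k}`. -/
def zeroAdd {k : ℕ} (q : 𝒢.strings k) : 𝒢.strings (0 + k) :=
  ⟨(q.1.1, fun i => q.1.2 (Fin.cast (zero_add k) i)), by
    rw [mem_strings_iff]
    exact ⟨fun i hi => 𝒢.tgt_of_val_zero q.2 _ (by simpa using hi),
      fun i j hij => 𝒢.tgt_of_val_succ q.2 _ _ (by simpa using hij)⟩⟩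

theorem zeroAdd_back {k : ℕ} (p : 𝒢.strings (0 + k)) : zeroAdd (𝒢.back 0 p) = p := by
  refine Subtype.ext (Prod.ext rfl (funext fun i => ?_))
  change p.1.2 (Fin.natAdd 0 (Fin.cast (zero_add k) i)) = p.1.2 i
  exact congrArg p.1.2 (Fin.ext (by simp))

end LieGroupoid

/-! ### Generation of `C(G; E)` by the sections of `E` -/

namespace SmoothFrame

open LieGroupoid

variable {l : ℤ} (e : SmoothFrame 𝒢 E l)

/-- The sections of a smooth frame. -/
def frameSection (j : e.ι) : 𝒢.Cochains E 0 l :=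
  ⟨fun p => e.comb p.1.1 (Pi.single j 1), e.comb_smooth j⟩

/-- The coordinates of a cochain in a smooth frame. -/
def coordFun {k : ℕ} (ζ : 𝒢.Cochains E (0 + k) l) (j : e.ι) : 𝒢.Functions k :=
  ⟨fun q => e.coord q.1.1 (ζ.1 (zeroAdd q)) j, by
    refine IsSmoothFunction.comp (φ := fun p : M × (Fin k → G) =>
      ((p.1, fun i => p.2 (Fin.cast (zero_add k) i)) : M × (Fin (0 + k) → G)))
      (e.coord_smooth ζ.2 j) (fun p _ => ?_) fun {p} hp => (zeroAdd ⟨p, hp⟩).2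
    exact contMDiffWithinAt_fst.prodMk
      (contMDiffWithinAt_powModel fun i => (contMDiff_arrow _ _).contMDiffWithinAt)⟩

theorem comb_eq_sum (x : M) (c : e.ι → ℝ) :
    e.comb x c = ∑ j, c j • e.comb x (Pi.single j 1) := by
  conv_lhs => rw [LinearMap.pi_apply_eq_sum_univ (e.comb x) c]
  refine Finset.sum_congr rfl fun j _ => ?_
  congr 2
  ext i
  simp [Pi.single_apply, eq_comm]

/-- Expanding the value of `ζ` in the frame at the target exhibits it as `∑ s_j ⋆ f_j`, with no sign
because the `s_j` lie in `C^0`. Thus a `C(G)`-linear operator is determined by its values on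
sections of `E`. -/
theorem inc_eq_sum {k : ℕ} (ζ : 𝒢.Cochains E (0 + k) l) :
    𝒢.inc E (0 + k) l ζ = ∑ j, 𝒢.star (𝒢.inc E 0 l (e.frameSection j)) (e.coordFun ζ j) := by
  rw [Finset.sum_congr rfl fun j _ => 𝒢.star_lof 0 l (e.frameSection j) (e.coordFun ζ j), ← map_sum]
  congr 1
  refine Subtype.ext (funext fun p => ?_)
  have h : ∀ j, e.coord (𝒢.back 0 p).1.1 (ζ.1 (zeroAdd (𝒢.back 0 p))) j =
      e.coord p.1.1 (ζ.1 p) j := fun j =>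
    congrArg (fun q : 𝒢.strings (0 + k) => e.coord q.1.1 (ζ.1 q) j) (zeroAdd_back p)
  rw [← e.comb_coord p.1.1 (ζ.1 p), comb_eq_sum]
  rw [AddSubmonoidClass.coe_finsetSum, Finset.sum_apply]
  refine Finset.sum_congr rfl fun j _ => ?_
  change _ = ((-1) ^ (0 * k) * e.coord (𝒢.back 0 p).1.1 (ζ.1 (zeroAdd (𝒢.back 0 p))) j) •
    e.comb p.1.1 (Pi.single j 1)
  rw [h, zero_mul, pow_zero, one_mul]

end SmoothFrame

namespace LieGroupoid

/-! ### Operators with a fibrewise leading term -/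

/-- The component in `C^0` of `T (s ⋆ f)` is the one of `(T s) ⋆ f`. -/
def HasLeadingTerm (T : 𝒢.TotalCochains E →ₗ[ℝ] 𝒢.TotalCochains F) : Prop :=
  ∀ (l m : ℤ) (s : 𝒢.Cochains E 0 l) (k : ℕ) (f : 𝒢.Functions k),
    T (𝒢.star (𝒢.inc E 0 l s) f) (0, m) = 𝒢.star (T (𝒢.inc E 0 l s)) f (0, m)

namespace HasLeadingTerm

variable {T : 𝒢.TotalCochains E →ₗ[ℝ] 𝒢.TotalCochains F}

/-- Such a cochain is a sum of `s ⋆ f` with `f` of positive degree, and acting by such an `f` leaves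
nothing in `C^0`. -/
theorem apply_inc_of_pos (hT : HasLeadingTerm T) {k : ℕ} {l : ℤ} (e : SmoothFrame 𝒢 E l)
    (hk : 0 < k) (m : ℤ)
    (ζ : 𝒢.Cochains E k l) : T (𝒢.inc E k l ζ) (0, m) = 0 := by
  obtain ⟨k', rfl⟩ : ∃ k', k = 0 + k' := ⟨k, (zero_add k).symm⟩
  rw [e.inc_eq_sum, map_sum, DirectSum.sum_apply]
  refine Finset.sum_eq_zero fun j _ => ?_
  rw [hT, star_apply_of_lt (by omega)]

/-- Tensoriality: the right side depends on `s` only through its value at `x`. -/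
theorem apply_inc_zero (hT : HasLeadingTerm T) {l : ℤ} (e : SmoothFrame 𝒢 E l) (m : ℤ)
    (s : 𝒢.Cochains E 0 l) (x : M) :
    objValue m x (T (𝒢.inc E 0 l s)) =
      ∑ j, e.coord x (eval x s) j • objValue m x (T (𝒢.inc E 0 l (e.frameSection j))) := by
  have h := e.inc_eq_sum (k := 0) s
  change 𝒢.inc E 0 l s = _ at h
  conv_lhs => rw [h]
  rw [map_sum, map_sum]
  refine Finset.sum_congr rfl fun j _ => ?_
  have h1 := hT l m (e.frameSection j) 0 (e.coordFun (k := 0) s j)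
  have h2 := star_apply_add (m := 0) 0 m (e.coordFun (k := 0) s j)
    (T (𝒢.inc E 0 l (e.frameSection j)))
  change 𝒢.star _ _ (0, m) = _ at h2
  rw [h2] at h1
  refine (congrArg (eval x) h1).trans ?_
  change ((-1 : ℝ) ^ (0 * 0) * e.coord x (s.1 (zeroAdd (𝒢.back 0 (m := 0) (𝒢.objString x)))) j) •
    (T (𝒢.inc E 0 l (e.frameSection j)) (0, m)).1 (𝒢.front 0 (𝒢.objString x)) = _
  rw [zero_mul, pow_zero, one_mul]
  rfl

end HasLeadingTerm

end LieGroupoid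

end Groupoid

end

noncomputable section

section Groupoid

variable {EM : Type*} [NormedAddCommGroup EM] [NormedSpace ℝ EM]
  {M : Type*} [TopologicalSpace M] [ChartedSpace EM M]
  {EG : Type*} [NormedAddCommGroup EG] [NormedSpace ℝ EG]
  {G : Type*} [TopologicalSpace G] [ChartedSpace EG G]
  {𝒢 : LieGroupoid EM M EG G} {E F : GradedVectorBundle EM M}

/-! ### Operators induced by maps of vector bundles -/

variable (𝒢 E F) in
/-- A family of fibre maps whose components `E^l → F^{l + d}` preserve smooth cochains. -/
structure FibreMap (d : ℤ) where
  toFun : ∀ (l m : ℤ) (x : M), E.Fib l x →ₗ[ℝ] F.Fib m x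
  smooth : ∀ {k : ℕ} (l : ℤ) {η : ∀ p : 𝒢.strings k, E.Fib l p.1.1}, IsSmoothSection 𝒢 E η →
    IsSmoothSection 𝒢 F fun p => toFun l (l + d) p.1.1 (η p)

theorem SmoothFrame.isSmoothSection_map {l m : ℤ} (e : SmoothFrame 𝒢 E l) (f : SmoothFrame 𝒢 F m)
    {T : ∀ x, E.Fib l x →ₗ[ℝ] F.Fib m x} (hT : EntriesMem 𝒢.smoothBase (e.mat f.toFrame T))
    {k : ℕ} {η : ∀ p : 𝒢.strings k, E.Fib l p.1.1} (hη : IsSmoothSection 𝒢 E η) :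
    IsSmoothSection 𝒢 F fun p => T p.1.1 (η p) := by
  have h : ∀ p : 𝒢.strings k, T p.1.1 (η p) = ∑ i, (∑ j, e.mat f.toFrame T p.1.1 i j *
      e.coord p.1.1 (η p) j) • f.comb p.1.1 (Pi.single i 1) := by
    intro p
    conv_lhs => rw [← f.comb_coord p.1.1 (T p.1.1 (η p)), f.comb_eq_sum,
      ← e.comb_coord p.1.1 (η p), ← Frame.mat_mulVec]
    rfl
  simp only [h]
  refine IsSmoothSection.sum _ fun i _ => IsSmoothSection.smul ?_
    (IsSmoothSection.of_base (s := fun x => f.comb x (Pi.single i 1)) (f.comb_smooth i) k)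
  exact IsSmoothFunction.sum _ fun j _ => (IsSmoothFunction.of_base (hT i j) k).mul
    (e.coord_smooth hη j)

namespace FibreMap

open LieGroupoid

variable {d : ℤ} (H : FibreMap 𝒢 E F d)

/-- The map `C^k(G; E^l) → C^k(G; F^{l + d})` given by the fibre maps at the target. -/
def onCochains (k : ℕ) (l : ℤ) : 𝒢.Cochains E k l →ₗ[ℝ] 𝒢.Cochains F k (l + d) where
  toFun η := ⟨fun p => H.toFun l (l + d) p.1.1 (η.1 p), H.smooth l η.2⟩
  map_add' η θ := Subtype.ext (funext fun p => map_add (H.toFun l (l + d) p.1.1) (η.1 p) (θ.1 p))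
  map_smul' c η := Subtype.ext (funext fun p => map_smul (H.toFun l (l + d) p.1.1) c (η.1 p))

/-- The operator on `C(G; E)` given by a smooth family of fibre maps. -/
def op : 𝒢.TotalCochains E →ₗ[ℝ] 𝒢.TotalCochains F :=
  DirectSum.toModule ℝ (ℕ × ℤ) (𝒢.TotalCochains F)
    fun a => (𝒢.inc F a.1 (a.2 + d)).comp (H.onCochains a.1 a.2)

theorem op_inc (k : ℕ) (l : ℤ) (ζ : 𝒢.Cochains E k l) :
    H.op (𝒢.inc E k l ζ) = 𝒢.inc F k (l + d) (H.onCochains k l ζ) := by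
  rw [op, DirectSum.toModule_lof]
  rfl

/-- The fibre maps act at the target of the first arrow, while `f` contributes only a scalar. -/
theorem op_star {m : ℕ} (f : 𝒢.Functions m) (η : 𝒢.TotalCochains E) :
    H.op (𝒢.star η f) = 𝒢.star (H.op η) f := by
  have h : H.op ∘ₗ starHom f = starHom f ∘ₗ H.op := by
    refine DirectSum.linearMap_ext _ fun a => LinearMap.ext fun ζ => ?_
    obtain ⟨k, l⟩ := a
    change H.op (𝒢.star (𝒢.inc E k l ζ) f) = 𝒢.star (H.op (𝒢.inc E k l ζ)) f
    rw [star_lof, op_inc, op_inc, star_lof]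
    congr 1
    exact Subtype.ext (funext fun p =>
      map_smul (H.toFun l (l + d) p.1.1) _ (ζ.1 (𝒢.front m p)))
  exact LinearMap.congr_fun h η

/-- The two bundle degrees are kept as separate integers tied by an equation, so no fibre has to be
transported along it. -/
theorem op_apply (k : ℕ) {l m : ℤ} (h : l + d = m) (η : 𝒢.TotalCochains E) (p : 𝒢.strings k) :
    (H.op η (k, m)).1 p = H.toFun l m p.1.1 ((η (k, l)).1 p) := by
  subst h
  have h2 : DirectSum.component ℝ (ℕ × ℤ) (fun a : ℕ × ℤ => 𝒢.Cochains F a.1 a.2) (k, l + d) ∘ₗ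
      H.op = H.onCochains k l ∘ₗ
        DirectSum.component ℝ (ℕ × ℤ) (fun a : ℕ × ℤ => 𝒢.Cochains E a.1 a.2) (k, l) := by
    refine DirectSum.linearMap_ext _ fun a => LinearMap.ext fun ζ => ?_
    obtain ⟨k', l'⟩ := a
    change H.op (𝒢.inc E k' l' ζ) (k, l + d) = H.onCochains k l (𝒢.inc E k' l' ζ (k, l))
    rw [op_inc]
    by_cases hkl : (k', l') = (k, l)
    · obtain ⟨rfl, rfl⟩ := Prod.mk.inj hkl
      rw [DirectSum.lof_apply, DirectSum.lof_apply]
    · rw [inc_apply_of_ne ζ hkl, inc_apply_of_ne _ fun h => hkl (by simpa using h), map_zero]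
  exact congrFun (congrArg Subtype.val (LinearMap.congr_fun h2 η)) p

theorem objValue_op {l m : ℤ} (h : l + d = m) (η : 𝒢.TotalCochains E) (x : M) :
    objValue m x (H.op η) = H.toFun l m x (objValue l x η) :=
  H.op_apply 0 h η (𝒢.objString x)

theorem op_mem_totalDegree {n n' : ℤ} (hn : n + d = n') {η : 𝒢.TotalCochains E}
    (hη : η ∈ 𝒢.totalDegree E n) : H.op η ∈ 𝒢.totalDegree F n' := by
  refine map_mem_of_components (N := 𝒢.TotalCochains F) (P := fun a => (a.1 : ℤ) + a.2 = n) H.op _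
    (fun k l h ζ => ?_) hη
  rw [op_inc]
  exact inc_mem_totalDegree (by simp only at h; omega) _

end FibreMap

/-! ### Leading terms of structure operators and morphisms -/

namespace RepUpToHomotopy

open LieGroupoid

/-- The Leibniz correction `s ⋆ δf` has positive string degree, so it is invisible in `C^0`. -/
theorem hasLeadingTerm_D (E : RepUpToHomotopy 𝒢) : HasLeadingTerm E.D := by
  intro l m s k f
  rw [E.leibniz l _ (inc_mem_totalDegree (by simp) s), DirectSum.add_apply, DirectSum.smul_apply,
    star_apply_of_lt (Nat.succ_pos k), smul_zero, add_zero]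

theorem Hom.hasLeadingTerm {E F : RepUpToHomotopy 𝒢} (Φ : Hom E F) :
    HasLeadingTerm Φ.toLinearMap := by
  intro l m s k f
  rw [Φ.map_star]

end RepUpToHomotopy

/-! ### The leading term and the fibre maps -/

section Fiberwise

variable [FiniteDimensional ℝ EM] [IsManifold 𝓘(ℝ, EM) ∞ M] [T2Space M]

namespace LieGroupoid

namespace HasLeadingTerm

variable {T : 𝒢.TotalCochains E →ₗ[ℝ] 𝒢.TotalCochains F}

/-- By tensoriality the bump-function extension used in `fiberMap` may be replaced by any section
with the same value at `x`. -/
theorem apply_inc_eq_fiberMap (hT : HasLeadingTerm T) {l : ℤ} (e : SmoothFrame 𝒢 E l) (m : ℤ)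
    (s : 𝒢.Cochains E 0 l) (x : M) :
    objValue m x (T (𝒢.inc E 0 l s)) = 𝒢.fiberMap T l m x (eval x s) := by
  have h := hT.apply_inc_zero e m (𝒢.extend E l x (eval x s)) x
  rw [show eval x (𝒢.extend E l x (eval x s)) = eval x s from 𝒢.extend_self E l x _,
    ← hT.apply_inc_zero e] at h
  exact h.symm

/-- Components with `k > 0` do not reach `C^0`, and in total degree `n` the only other component is
the one in `C^0(G; E^n)`. -/
theorem apply_of_totalDegree (hT : HasLeadingTerm T) (e : ∀ l, SmoothFrame 𝒢 E l) {n : ℤ}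
    {η : 𝒢.TotalCochains E} (hη : η ∈ 𝒢.totalDegree E n) (m : ℤ) (x : M) :
    objValue m x (T η) = 𝒢.fiberMap T n m x (objValue n x η) := by
  have h0 : (objValue m x ∘ₗ T) (η - 𝒢.inc E 0 n (η (0, n))) ∈
      (⊥ : Submodule ℝ (F.Fib m x)) := by
    refine map_mem_of_components (P := fun a => 0 < a.1) _ _ (fun k l hk ζ => ?_) ?_
    · refine (congrArg (eval x) (hT.apply_inc_of_pos (e l) hk m ζ)).trans (map_zero _)
    rintro ⟨k, l⟩ hk
    obtain rfl : k = 0 := by simpa using hk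
    rw [DirectSum.sub_apply]
    by_cases hl : n = l
    · subst hl
      rw [DirectSum.lof_apply, sub_self]
    · rw [inc_apply_of_ne _ fun h => hl (by simpa using h), hη _ (by simpa using Ne.symm hl),
        sub_zero]
  rw [Submodule.mem_bot, map_sub, sub_eq_zero] at h0
  exact h0.trans (hT.apply_inc_eq_fiberMap (e n) m _ x)

theorem fiberMap_mem (hT : HasLeadingTerm T) {l m : ℤ} (e : SmoothFrame 𝒢 E l)
    (f : SmoothFrame 𝒢 F m) : EntriesMem 𝒢.smoothBase (e.mat f.toFrame (𝒢.fiberMap T l m)) := by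
  intro i j
  have h := f.coord_smooth (T (𝒢.inc E 0 l (e.frameSection j)) (0, m)).2 i
  rw [mem_smoothBase]
  convert h using 2 with p
  rw [Frame.mat_apply]
  have h2 := hT.apply_inc_eq_fiberMap e m (e.frameSection j) p.1.1
  refine (congrFun (congrArg (f.coord p.1.1) h2.symm) i).trans ?_
  exact congrArg (fun q : 𝒢.strings 0 =>
    f.coord q.1.1 ((T (𝒢.inc E 0 l (e.frameSection j)) (0, m)).1 q) i) (eq_objString p).symm

/-- Leading terms compose. The degree condition on `T` ensures that the `C^0` part of `T s` sits in
bundle degree `m` alone, so no other component feeds `S`. -/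
theorem fiberMap_fiberMap {K : GradedVectorBundle EM M}
    {S : 𝒢.TotalCochains F →ₗ[ℝ] 𝒢.TotalCochains K} (hS : HasLeadingTerm S)
    (e : ∀ l, SmoothFrame 𝒢 F l) {l m : ℤ}
    (hT : ∀ η ∈ 𝒢.totalDegree E l, T η ∈ 𝒢.totalDegree F m) (m' : ℤ) (x : M) (v : E.Fib l x) :
    𝒢.fiberMap S m m' x (𝒢.fiberMap T l m x v) = 𝒢.fiberMap (S ∘ₗ T) l m' x v :=
  (hS.apply_of_totalDegree e (hT _ (inc_mem_totalDegree (by simp) (𝒢.extend E l x v))) m' x).symm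

end HasLeadingTerm

end LieGroupoid

namespace RepUpToHomotopy

open LieGroupoid

theorem differential_differential (E : RepUpToHomotopy 𝒢) (e : ∀ l, SmoothFrame 𝒢 E.bundle l)
    {l m : ℤ} (h : m = l + 1) (m' : ℤ) (x : M) (v : E.bundle.Fib l x) :
    E.differential m m' x (E.differential l m x v) = 0 := by
  have h2 := E.hasLeadingTerm_D.fiberMap_fiberMap (T := E.D) e (l := l) (m := m)
    (h ▸ E.degree_one l) m' x v
  have h3 : E.D ∘ₗ E.D = 0 := LinearMap.ext E.sq_zero
  rw [h3] at h2
  exact h2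

theorem Hom.fiberMap_differential {E F : RepUpToHomotopy 𝒢} (Φ : Hom E F)
    (e : ∀ l, SmoothFrame 𝒢 E.bundle l) (f : ∀ l, SmoothFrame 𝒢 F.bundle l)
    {l m : ℤ} (h : m = l + 1) (m' : ℤ) (x : M) (v : E.bundle.Fib l x) :
    𝒢.fiberMap Φ.toLinearMap m m' x (E.differential l m x v) =
      F.differential l m' x (𝒢.fiberMap Φ.toLinearMap l l x v) := by
  have h1 := Φ.hasLeadingTerm.fiberMap_fiberMap (T := E.D) e (l := l) (m := m)
    (h ▸ E.degree_one l) m' x v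
  have h2 := F.hasLeadingTerm_D.fiberMap_fiberMap (T := Φ.toLinearMap) f (l := l) (m := l)
    (Φ.degree_zero l) m' x v
  have h3 : Φ.toLinearMap ∘ₗ E.D = F.D ∘ₗ Φ.toLinearMap := LinearMap.ext Φ.comm
  rw [h3] at h1
  exact h1.trans h2.symm

end RepUpToHomotopy

end Fiberwise

end Groupoid

end

noncomputable section

section Groupoid

variable {EM : Type*} [NormedAddCommGroup EM] [NormedSpace ℝ EM] [FiniteDimensional ℝ EM]
  {M : Type*} [TopologicalSpace M] [ChartedSpace EM M] [IsManifold 𝓘(ℝ, EM) ∞ M] [T2Space M]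
  {EG : Type*} [NormedAddCommGroup EG] [NormedSpace ℝ EG]
  {G : Type*} [TopologicalSpace G] [ChartedSpace EG G]
  {𝒢 : LieGroupoid EM M EG G}

namespace RepUpToHomotopy

open LieGroupoid

variable {E : RepUpToHomotopy 𝒢} {F : RepUpToHomotopy 𝒢}

namespace Hom

/-! ### The fibrewise mapping cone -/

variable (Φ : Hom E F)

/-- The differential `E^p ⊕ F^q → E^{p'} ⊕ F^{q'}` of the fibrewise mapping cone of `Φ`. -/
def coneD (p q p' q' : ℤ) (x : M) :
    E.bundle.Fib p x × F.bundle.Fib q x →ₗ[ℝ] E.bundle.Fib p' x × F.bundle.Fib q' x :=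
  (-(E.differential p p' x ∘ₗ LinearMap.fst ℝ _ _)).prod
    (𝒢.fiberMap Φ.toLinearMap p q' x ∘ₗ LinearMap.fst ℝ _ _ +
      F.differential q q' x ∘ₗ LinearMap.snd ℝ _ _)

theorem coneD_apply (p q p' q' : ℤ) (x : M) (z : E.bundle.Fib p x × F.bundle.Fib q x) :
    Φ.coneD p q p' q' x z = (-E.differential p p' x z.1,
      𝒢.fiberMap Φ.toLinearMap p q' x z.1 + F.differential q q' x z.2) := rfl

theorem coneD_coneD
    (e : ∀ l, SmoothFrame 𝒢 E.bundle l) (f : ∀ l, SmoothFrame 𝒢 F.bundle l)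
    {p q p' q' : ℤ} (p'' q'' : ℤ) (hp : p = q + 1) (hp' : p' = p + 1) (hq' : q' = q + 1)
    (x : M) (z : E.bundle.Fib p x × F.bundle.Fib q x) :
    Φ.coneD p' q' p'' q'' x (Φ.coneD p q p' q' x z) = 0 := by
  obtain rfl : p = q' := by omega
  rw [coneD_apply, coneD_apply]
  simp only [map_neg, map_add]
  rw [E.differential_differential e hp', F.differential_differential f hq',
    Φ.fiberMap_differential e f hp']
  simp

/-- A cycle `(v, w)` has `∂v = 0` and `Φv = -∂w`. Injectivity in cohomology gives `v = ∂v'`, so `w +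
Φv'` is closed; surjectivity writes it as `Φy + ∂w'` with `y` closed. Then `(-v' + y, w')` is a
primitive. -/
theorem IsQuasiIso.coneD_exact {Φ : Hom E F} (hΦ : Φ.IsQuasiIso)
    (e : ∀ l, SmoothFrame 𝒢 E.bundle l) (f : ∀ l, SmoothFrame 𝒢 F.bundle l)
    {p q p' q' p₀ q₀ : ℤ} (hp : p = q + 1) (hp' : p' = p + 1) (hq' : q' = q + 1)
    (hp₀ : p₀ = p - 1) (hq₀ : q₀ = q - 1) (x : M) (z : E.bundle.Fib p x × F.bundle.Fib q x)
    (hz : Φ.coneD p q p' q' x z = 0) : ∃ y, Φ.coneD p₀ q₀ p q x y = z := by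
  obtain rfl : p₀ = q := by omega
  obtain rfl : q' = p := by omega
  subst hp' hq₀
  obtain ⟨v, w⟩ := z
  rw [coneD_apply, Prod.mk_eq_zero, neg_eq_zero] at hz
  obtain ⟨hv, hw⟩ := hz
  have h1 : v ∈ LinearMap.range (E.differential (q' - 1) q' x) := by
    refine (hΦ x q').1 v hv ?_
    subst hp₀
    exact ⟨-w, by rw [map_neg]; exact (eq_neg_of_add_eq_zero_left hw).symm⟩
  subst hp₀
  obtain ⟨v', rfl⟩ := h1
  have hcl : F.differential (q' - 1) (q' - 1 + 1) x
      (w + 𝒢.fiberMap Φ.toLinearMap (q' - 1) (q' - 1) x v') = 0 := by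
    rw [Φ.fiberMap_differential e f hp] at hw
    rw [← hp, map_add, add_comm]
    exact hw
  obtain ⟨y, hy, w', hw'⟩ := (hΦ x (q' - 1)).2 _ hcl
  refine ⟨(-v' + y, w'), ?_⟩
  rw [coneD_apply]
  rw [← hp] at hy
  refine Prod.ext ?_ ?_
  · simp [hy]
  · simp only [map_add, map_neg]
    rw [hw']
    simp only [fiber]
    abel

/-! ### Smoothness of the cone differential and its contraction -/

variable (e : ∀ l, SmoothFrame 𝒢 E.bundle l) (f : ∀ l, SmoothFrame 𝒢 F.bundle l)

/-- The frame of the fibrewise mapping cone. -/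
abbrev coneFrame (p q : ℤ) :
    Frame 𝒢.smoothBase fun x => E.bundle.Fib p x × F.bundle.Fib q x :=
  (e p).toFrame.prod (f q).toFrame

theorem coneD_mem (p q p' q' : ℤ) : EntriesMem 𝒢.smoothBase
    ((coneFrame e f p q).mat (coneFrame e f p' q') (Φ.coneD p q p' q')) := by
  have h11 : EntriesMem 𝒢.smoothBase ((e p).mat (e p').toFrame
      fun y => LinearMap.fst ℝ _ _ ∘ₗ Φ.coneD p q p' q' y ∘ₗ LinearMap.inl ℝ _ _) := by
    intro i j
    convert 𝒢.smoothBase.neg_mem (E.hasLeadingTerm_D.fiberMap_mem (e p) (e p') i j) using 1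
    ext x
    simp [Frame.mat_apply, coneD_apply, differential]
  have h12 : EntriesMem 𝒢.smoothBase ((f q).mat (e p').toFrame
      fun y => LinearMap.fst ℝ _ _ ∘ₗ Φ.coneD p q p' q' y ∘ₗ LinearMap.inr ℝ _ _) := by
    intro i j
    convert 𝒢.smoothBase.zero_mem using 1
    ext x
    simp [Frame.mat_apply, coneD_apply]
  have h21 : EntriesMem 𝒢.smoothBase ((e p).mat (f q').toFrame
      fun y => LinearMap.snd ℝ _ _ ∘ₗ Φ.coneD p q p' q' y ∘ₗ LinearMap.inl ℝ _ _) := by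
    intro i j
    convert Φ.hasLeadingTerm.fiberMap_mem (e p) (f q') i j using 1
    ext x
    simp [Frame.mat_apply, coneD_apply]
  have h22 : EntriesMem 𝒢.smoothBase ((f q).mat (f q').toFrame
      fun y => LinearMap.snd ℝ _ _ ∘ₗ Φ.coneD p q p' q' y ∘ₗ LinearMap.inr ℝ _ _) := by
    intro i j
    convert F.hasLeadingTerm_D.fiberMap_mem (f q) (f q') i j using 1
    ext x
    simp [Frame.mat_apply, coneD_apply, differential]
  have h := h11.fromBlocks h12 h21 h22
  intro i j
  simpa only [Frame.mat_prod] using! h i j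

/-- The fibrewise contraction `E^p ⊕ F^q → E^{p'} ⊕ F^{q'}` of the mapping cone. -/
def coneH (p q p' q' : ℤ) (x : M) :
    E.bundle.Fib p x × F.bundle.Fib q x →ₗ[ℝ] E.bundle.Fib p' x × F.bundle.Fib q' x :=
  Frame.homotopy (coneFrame e f (p' - 1) (q' - 1)) (coneFrame e f p' q') (coneFrame e f p q)
    (Φ.coneD (p' - 1) (q' - 1) p' q') (Φ.coneD p' q' p q) x

variable {Φ} in
theorem IsQuasiIso.coneH_mem (hΦ : Φ.IsQuasiIso) {p q p' q' : ℤ} (hp : p = q + 1)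
    (hp' : p' = p - 1) (hq' : q' = q - 1) : EntriesMem 𝒢.smoothBase
      ((coneFrame e f p q).mat (coneFrame e f p' q') (Φ.coneH e f p q p' q')) :=
  Frame.homotopy_mem _ _ _ (fun _ hr h0 => inv_mem_smoothBase hr h0)
    (Φ.coneD_mem e f _ _ _ _) (Φ.coneD_mem e f _ _ _ _)
    (hΦ.coneD_exact e f (by omega) (by omega) (by omega) rfl rfl)

variable {Φ} in
theorem IsQuasiIso.coneH_spec (hΦ : Φ.IsQuasiIso) {p q p₀ q₀ p₁ q₁ : ℤ} (hp : p = q + 1)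
    (hp₀ : p₀ = p - 1) (hq₀ : q₀ = q - 1) (hp₁ : p₁ = p + 1) (hq₁ : q₁ = q + 1) (x : M)
    (z : E.bundle.Fib p x × F.bundle.Fib q x) :
    Φ.coneD p₀ q₀ p q x (Φ.coneH e f p q p₀ q₀ x z) +
      Φ.coneH e f p₁ q₁ p q x (Φ.coneD p q p₁ q₁ x z) = z := by
  subst hp₀ hq₀
  exact Frame.homotopy_spec _ _ _ _
    (Φ.coneD_coneD e f _ _ (by omega) (by omega) (by omega))
    (Φ.coneD_coneD e f _ _ (by omega) (by omega) (by omega))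
    (hΦ.coneD_exact e f (by omega) (by omega) (by omega) (by omega) (by omega))
    (hΦ.coneD_exact e f (by omega) (by omega) (by omega) (by omega) (by omega)) x z

end Hom

end RepUpToHomotopy

end Groupoid

end

noncomputable section

/-! ### Contractions up to a nilpotent error -/

/-- Since `D² = 0`, `D` commutes with `DH + HD = 1 - N`, hence with `N` and with the geometric
series, which inverts `1 - N`. -/
theorem contraction_of_isNilpotent {R : Type*} [Ring R] {D H N : R} {n : ℕ}
    (hD : D * D = 0) (hN : D * H + H * D + N = 1) (hn : N ^ n = 0) :
    D * ((∑ i ∈ Finset.range n, N ^ i) * H) + (∑ i ∈ Finset.range n, N ^ i) * H * D = 1 := by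
  rw [← eq_sub_iff_add_eq] at hN
  have hc : Commute D (1 - N) := by
    rw [← hN, commute_iff_eq, mul_add, add_mul, ← mul_assoc, hD, mul_assoc H, hD]
    simp [mul_assoc]
  have hcN : Commute D N := by
    have := (Commute.one_right D).sub_right hc
    rwa [sub_sub_cancel] at this
  have hcs : Commute D (∑ i ∈ Finset.range n, N ^ i) :=
    Commute.sum_right _ _ _ fun i _ => hcN.pow_right i
  rw [← mul_assoc, hcs.eq, mul_assoc, mul_assoc, ← mul_add, hN, geom_sum_mul_neg, hn, sub_zero]

/-! ### Negatives supplied by the real scalar `-1` -/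

section Linear

variable {V : Type*} [AddCommMonoid V] [Module ℝ V]

theorem Module.End.contraction_of_isNilpotent
    {D H N : Module.End ℝ V} {n : ℕ} (hD : D * D = 0) (hN : D * H + H * D + N = 1)
    (hn : N ^ n = 0) :
    D * ((∑ i ∈ Finset.range n, N ^ i) * H) + (∑ i ∈ Finset.range n, N ^ i) * H * D = 1 := by
  let _ : AddCommGroup V := Module.addCommMonoidToAddCommGroup ℝ
  exact _root_.contraction_of_isNilpotent hD hN hn

theorem neg_one_smul_add (v : V) : (-1 : ℝ) • v + v = 0 := by
  nth_rw 2 [← one_smul ℝ v]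
  rw [← add_smul, neg_add_cancel, zero_smul]

variable (V) in
/-- Multiplication by `-1`. -/
def LinearMap.negOne : Module.End ℝ V := (-1 : ℝ) • LinearMap.id

theorem LinearMap.add_one_add_negOne_mul (T : Module.End ℝ V) :
    T + (1 + LinearMap.negOne V * T) = 1 := by
  let _ : AddCommGroup V := Module.addCommMonoidToAddCommGroup ℝ
  refine LinearMap.ext fun v => ?_
  change T v + (v + (-1 : ℝ) • T v) = v
  rw [neg_one_smul]
  abel

end Linear

section Groupoid

variable {EM : Type*} [NormedAddCommGroup EM] [NormedSpace ℝ EM]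
  {M : Type*} [TopologicalSpace M] [ChartedSpace EM M]
  {EG : Type*} [NormedAddCommGroup EG] [NormedSpace ℝ EG]
  {G : Type*} [TopologicalSpace G] [ChartedSpace EG G]
  {𝒢 : LieGroupoid EM M EG G}

namespace RepUpToHomotopy

open LieGroupoid

variable {E : RepUpToHomotopy 𝒢} {F : RepUpToHomotopy 𝒢}

namespace Hom

/-! ### The mapping cone -/

variable (Φ : Hom E F)

/-- The mapping cone of `Φ`, without its grading. -/
abbrev Cone (_ : Hom E F) : Type _ := 𝒢.TotalCochains E.bundle × 𝒢.TotalCochains F.bundle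

/-- The structure operator of the mapping cone. -/
def totalD : Module.End ℝ Φ.Cone :=
  (LinearMap.negOne _ ∘ₗ E.D ∘ₗ
    LinearMap.fst ℝ (𝒢.TotalCochains E.bundle) (𝒢.TotalCochains F.bundle)).prod
    (Φ.toLinearMap ∘ₗ LinearMap.fst ℝ (𝒢.TotalCochains E.bundle) (𝒢.TotalCochains F.bundle) +
      F.D ∘ₗ LinearMap.snd ℝ (𝒢.TotalCochains E.bundle) (𝒢.TotalCochains F.bundle))

theorem totalD_apply (z : Φ.Cone) :
    Φ.totalD z = ((-1 : ℝ) • E.D z.1, Φ.toLinearMap z.1 + F.D z.2) := rfl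

theorem totalD_mul_totalD : Φ.totalD * Φ.totalD = 0 := by
  refine LinearMap.ext fun z => ?_
  rw [Module.End.mul_apply, totalD_apply, totalD_apply]
  refine Prod.ext ?_ ?_
  · simp [E.sq_zero]
  · simp only [map_smul, map_add, F.sq_zero, Φ.comm]
    exact (congrArg _ (add_zero _)).trans (neg_one_smul_add _)

/-- The right action on the mapping cone. -/
def totalStar {m : ℕ} (a : 𝒢.Functions m) : Module.End ℝ Φ.Cone :=
  (starHom a).prodMap (starHom a)

theorem totalStar_apply {m : ℕ} (a : 𝒢.Functions m) (z : Φ.Cone) :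
    Φ.totalStar a z = (𝒢.star z.1 a, 𝒢.star z.2 a) := rfl

/-- The elements of degree `n` of the mapping cone. -/
def coneDegree (n : ℤ) : Submodule ℝ Φ.Cone :=
  (𝒢.totalDegree E.bundle (n + 1)).prod (𝒢.totalDegree F.bundle n)

theorem totalD_mem_coneDegree {n n' : ℤ} (hn : n + 1 = n') {z : Φ.Cone}
    (hz : z ∈ Φ.coneDegree n) : Φ.totalD z ∈ Φ.coneDegree n' := by
  subst hn
  exact ⟨Submodule.smul_mem _ _ (E.degree_one _ _ hz.1),
    Submodule.add_mem _ (Φ.degree_zero _ _ hz.1) (F.degree_one _ _ hz.2)⟩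

/-- The sign on `E` is the one forced by the shift: elements of cone degree `n` have `E`-degree `n +
1`, and `-(-1)^(n+1) = (-1)^n`, so both summands obey the same Leibniz rule. -/
theorem totalD_totalStar {n : ℤ} {z : Φ.Cone} (hz : z ∈ Φ.coneDegree n) {m : ℕ}
    (a : 𝒢.Functions m) : Φ.totalD (Φ.totalStar a z) =
      Φ.totalStar a (Φ.totalD z) + (-1 : ℝ) ^ n • Φ.totalStar (𝒢.δ a) z := by
  have h1 : ∀ (c : ℝ) (η : 𝒢.TotalCochains E.bundle), 𝒢.star (c • η) a = c • 𝒢.star η a :=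
    map_smul (starHom a)
  have h2 : ∀ η θ : 𝒢.TotalCochains F.bundle, 𝒢.star (η + θ) a = 𝒢.star η a + 𝒢.star θ a :=
    map_add (starHom a)
  simp only [totalStar_apply, totalD_apply]
  rw [E.leibniz _ _ hz.1, F.leibniz _ _ hz.2, Φ.map_star, h1, h2,
    zpow_add_one₀ (by norm_num : (-1 : ℝ) ≠ 0)]
  refine Prod.ext ?_ ?_
  · change (-1 : ℝ) • (_ + _) = (-1 : ℝ) • _ + _
    rw [smul_add, smul_smul, mul_comm, _root_.mul_assoc]
    norm_num
  · exact (add_assoc _ _ _).symm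

theorem cone_ext {T S : Module.End ℝ Φ.Cone} (h : ∀ n, ∀ z ∈ Φ.coneDegree n, T z = S z) :
    T = S := by
  refine LinearMap.prod_ext ?_ ?_
  · refine DirectSum.linearMap_ext _ fun a => LinearMap.ext fun ζ => ?_
    exact h (a.1 + a.2 - 1) _ ⟨inc_mem_totalDegree (by ring) ζ, Submodule.zero_mem _⟩
  · refine DirectSum.linearMap_ext _ fun a => LinearMap.ext fun ζ => ?_
    exact h (a.1 + a.2) _ ⟨Submodule.zero_mem _, inc_mem_totalDegree rfl ζ⟩

theorem neg_one_smul_totalCochains (B : GradedVectorBundle EM M) (η : 𝒢.TotalCochains B) :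
    (-1 : ℝ) • η = -η := neg_one_smul ℝ η

/-- The values at `x` of the components in `C^0(G; E^p)` and `C^0(G; F^q)`. -/
def coneValue (p q : ℤ) (x : M) : Φ.Cone →ₗ[ℝ] E.bundle.Fib p x × F.bundle.Fib q x :=
  (objValue p x).prodMap (objValue q x)

theorem coneValue_totalD [FiniteDimensional ℝ EM] [IsManifold 𝓘(ℝ, EM) ∞ M] [T2Space M]
    (e : ∀ l, SmoothFrame 𝒢 E.bundle l) (f : ∀ l, SmoothFrame 𝒢 F.bundle l)
    {p q : ℤ} (hp : p = q + 1) (p' q' : ℤ) (x : M) {z : Φ.Cone}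
    (hz : z ∈ Φ.coneDegree q) :
    Φ.coneValue p' q' x (Φ.totalD z) = Φ.coneD p q p' q' x (Φ.coneValue p q x z) := by
  subst hp
  refine Prod.ext ?_ ?_
  · change objValue p' x ((-1 : ℝ) • E.D z.1) = -E.differential (q + 1) p' x (objValue (q + 1) x z.1)
    rw [map_smul, neg_one_smul, E.hasLeadingTerm_D.apply_of_totalDegree e hz.1]
    rfl
  · change objValue q' x (Φ.toLinearMap z.1 + F.D z.2) =
      𝒢.fiberMap Φ.toLinearMap (q + 1) q' x (objValue (q + 1) x z.1) +
        F.differential q q' x (objValue q x z.2)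
    rw [map_add, F.hasLeadingTerm_D.apply_of_totalDegree f hz.2,
      Φ.hasLeadingTerm.apply_of_totalDegree e hz.1]
    rfl

/-! ### The filtration by bundle degree and nilpotency -/

/-- The elements of the mapping cone with components in bundle degrees at most `l`. -/
def coneLE (l : ℤ) : Submodule ℝ Φ.Cone :=
  (𝒢.degreeLE E.bundle l).prod (𝒢.degreeLE F.bundle (l - 1))

theorem coneLE_mono {l l' : ℤ} (h : l ≤ l') : Φ.coneLE l ≤ Φ.coneLE l' :=
  Submodule.prod_mono (degreeLE_mono h) (degreeLE_mono (by omega))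

theorem mem_coneLE_of_coneDegree {n : ℤ} {z : Φ.Cone} (hz : z ∈ Φ.coneDegree n)
    (h0 : ∀ x, Φ.coneValue (n + 1) n x z = 0) : z ∈ Φ.coneLE n := by
  refine ⟨?_, mem_degreeLE_of_totalDegree hz.2
    (eq_zero_of_objValue fun x => congrArg Prod.snd (h0 x))⟩
  have h := mem_degreeLE_of_totalDegree hz.1
    (eq_zero_of_objValue fun x => congrArg Prod.fst (h0 x))
  rwa [add_sub_cancel_right] at h

theorem totalStar_mem_coneLE {l : ℤ} {m : ℕ} (a : 𝒢.Functions m) {z : Φ.Cone}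
    (hz : z ∈ Φ.coneLE l) : Φ.totalStar a z ∈ Φ.coneLE l :=
  ⟨star_mem_degreeLE a hz.1, star_mem_degreeLE a hz.2⟩

/-- A linear endomorphism of the mapping cone commuting with the action of `C(G)`, which preserves
the degree and has no leading term, lowers the filtration by bundle degrees. -/
theorem map_mem_coneLE
    (e : ∀ l, SmoothFrame 𝒢 E.bundle l) (f : ∀ l, SmoothFrame 𝒢 F.bundle l)
    {N : Module.End ℝ Φ.Cone}
    (hstar : ∀ (m : ℕ) (a : 𝒢.Functions m) (z : Φ.Cone), N (Φ.totalStar a z) =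
      Φ.totalStar a (N z))
    (hdeg : ∀ n, ∀ z ∈ Φ.coneDegree n, N z ∈ Φ.coneDegree n)
    (h0 : ∀ n, ∀ z ∈ Φ.coneDegree n, ∀ x, Φ.coneValue (n + 1) n x (N z) = 0)
    {l : ℤ} {z : Φ.Cone} (hz : z ∈ Φ.coneLE l) : N z ∈ Φ.coneLE (l - 1) := by
  have hgen : ∀ n, ∀ z ∈ Φ.coneDegree n, N z ∈ Φ.coneLE n := fun n z hz =>
    Φ.mem_coneLE_of_coneDegree (hdeg n z hz) (h0 n z hz)
  have h1 : N (z.1, 0) ∈ Φ.coneLE (l - 1) := by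
    refine map_mem_of_components (N := Φ.Cone) (P := fun a => a.2 ≤ l)
      (N ∘ₗ LinearMap.inl ℝ (𝒢.TotalCochains E.bundle) (𝒢.TotalCochains F.bundle)) _
      (fun k l' hl ζ => ?_) fun a ha => hz.1 a (not_le.1 ha)
    obtain ⟨k', rfl⟩ : ∃ k', k = 0 + k' := ⟨k, (zero_add k).symm⟩
    rw [(e l').inc_eq_sum, map_sum]
    refine Submodule.sum_mem _ fun j _ => ?_
    have h2 : (N ∘ₗ LinearMap.inl ℝ (𝒢.TotalCochains E.bundle) (𝒢.TotalCochains F.bundle))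
        (𝒢.star (𝒢.inc E.bundle 0 l' ((e l').frameSection j))
        ((e l').coordFun ζ j)) = Φ.totalStar ((e l').coordFun ζ j)
          (N (𝒢.inc E.bundle 0 l' ((e l').frameSection j), 0)) := by
      rw [← hstar, totalStar_apply, ← starHom_apply _ (0 : 𝒢.TotalCochains F.bundle), map_zero]
      rfl
    rw [h2]
    -- A section of `E^{l'}` has cone degree `l' - 1`, which already accounts for the drop by one;
    -- in the `F` case below the drop is in the index shift of `coneLE`.
    refine Φ.totalStar_mem_coneLE _ (Φ.coneLE_mono (l := l' - 1) (by simp only at hl; omega)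
      (hgen _ _ ⟨inc_mem_totalDegree (by simp) _, Submodule.zero_mem _⟩))
  have h2 : N (0, z.2) ∈ Φ.coneLE (l - 1) := by
    refine map_mem_of_components (N := Φ.Cone) (P := fun a => a.2 ≤ l - 1)
      (N ∘ₗ LinearMap.inr ℝ (𝒢.TotalCochains E.bundle) (𝒢.TotalCochains F.bundle)) _
      (fun k l' hl ζ => ?_) fun a ha => hz.2 a (not_le.1 ha)
    obtain ⟨k', rfl⟩ : ∃ k', k = 0 + k' := ⟨k, (zero_add k).symm⟩
    rw [(f l').inc_eq_sum, map_sum]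
    refine Submodule.sum_mem _ fun j _ => ?_
    have h2 : (N ∘ₗ LinearMap.inr ℝ (𝒢.TotalCochains E.bundle) (𝒢.TotalCochains F.bundle))
        (𝒢.star (𝒢.inc F.bundle 0 l' ((f l').frameSection j))
        ((f l').coordFun ζ j)) = Φ.totalStar ((f l').coordFun ζ j)
          (N (0, 𝒢.inc F.bundle 0 l' ((f l').frameSection j))) := by
      rw [← hstar, totalStar_apply, ← starHom_apply _ (0 : 𝒢.TotalCochains E.bundle), map_zero]
      rfl
    rw [h2]
    exact Φ.totalStar_mem_coneLE _ (Φ.coneLE_mono hl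
      (hgen _ _ ⟨Submodule.zero_mem _, inc_mem_totalDegree (by simp) _⟩))
  have h3 : z = (z.1, 0) + (0, z.2) := by simp
  rw [h3, map_add]
  exact Submodule.add_mem _ h1 h2

theorem exists_degree_bounds (B : GradedVectorBundle EM M) : ∃ a b : ℤ,
    ∀ (η : 𝒢.TotalCochains B) (k : ℕ) (l : ℤ), l < a ∨ b < l → η (k, l) = 0 := by
  obtain ⟨a, b, h⟩ := B.bounded
  refine ⟨a, b, fun η k l hl => Subtype.ext (funext fun p => ?_)⟩
  exact (h l hl p.1.1).elim _ _

/-- Each application of `N` descends one step, and the filtration is everything at the top and zero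
below the lowest bundle degree. -/
theorem exists_pow_eq_zero {N : Module.End ℝ Φ.Cone}
    (hN : ∀ l, ∀ z ∈ Φ.coneLE l, N z ∈ Φ.coneLE (l - 1)) : ∃ n, N ^ n = 0 := by
  obtain ⟨a, b, hE⟩ := exists_degree_bounds (𝒢 := 𝒢) E.bundle
  obtain ⟨a', b', hF⟩ := exists_degree_bounds (𝒢 := 𝒢) F.bundle
  have hpow : ∀ (n : ℕ) (z : Φ.Cone), (N ^ n) z ∈ Φ.coneLE (max b (b' + 1) - n) := by
    intro n z
    induction n with
    | zero =>
      exact ⟨fun c hc => hE _ _ _ (Or.inr (by simp at hc; omega)),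
        fun c hc => hF _ _ _ (Or.inr (by simp at hc; omega))⟩
    | succ n ih =>
      rw [pow_succ', Module.End.mul_apply]
      have := hN _ _ ih
      rwa [sub_sub, ← Nat.cast_succ] at this
  -- The top is `b' + 1` for `F` because `coneLE l` allows `F` only up to `l - 1`. After this many
  -- steps the level is at most `min a a' - 1`.
  refine ⟨(max b (b' + 1) - min a a' + 1).toNat, LinearMap.ext fun z => ?_⟩
  obtain ⟨h1, h2⟩ := hpow (max b (b' + 1) - min a a' + 1).toNat z
  refine Prod.ext (DFinsupp.ext fun c => ?_) (DFinsupp.ext fun c => ?_)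
  · by_cases hc : c.2 < a
    · exact hE _ _ _ (Or.inl hc)
    · exact h1 c (by omega)
  · by_cases hc : c.2 < a'
    · exact hF _ _ _ (Or.inl hc)
    · exact h2 c (by omega)

/-- A morphism with contractible mapping cone is a homotopy equivalence. -/
theorem isHomotopyEquiv_of_contraction {Φ : Hom E F} {K : Module.End ℝ Φ.Cone}
    (hstar : ∀ (m : ℕ) (a : 𝒢.Functions m), Commute K (Φ.totalStar a))
    (hdeg : ∀ n, ∀ z ∈ Φ.coneDegree n, K z ∈ Φ.coneDegree (n - 1))
    (hK : Φ.totalD * K + K * Φ.totalD = 1) : Φ.IsHomotopyEquiv := by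
  have hinl : ∀ n, ∀ η ∈ 𝒢.totalDegree E.bundle n, K (η, 0) ∈ Φ.coneDegree (n - 1 - 1) :=
    fun n η hη => hdeg (n - 1) _ ⟨by rwa [sub_add_cancel], Submodule.zero_mem _⟩
  have hinr : ∀ n, ∀ θ ∈ 𝒢.totalDegree F.bundle n, K (0, θ) ∈ Φ.coneDegree (n - 1) :=
    fun n θ hθ => hdeg n _ ⟨Submodule.zero_mem _, hθ⟩
  have hinl_star : ∀ η (m : ℕ) (a : 𝒢.Functions m),
      K (𝒢.star η a, 0) = Φ.totalStar a (K (η, 0)) := by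
    intro η m a
    rw [← Module.End.mul_apply, ← (hstar m a).eq, Module.End.mul_apply, totalStar_apply]
    exact congrArg (fun θ => K (𝒢.star η a, θ)) (map_zero (starHom a)).symm
  have hinr_star : ∀ θ (m : ℕ) (a : 𝒢.Functions m),
      K (0, 𝒢.star θ a) = Φ.totalStar a (K (0, θ)) := by
    intro θ m a
    rw [← Module.End.mul_apply, ← (hstar m a).eq, Module.End.mul_apply, totalStar_apply]
    exact congrArg (fun η => K (η, 𝒢.star θ a)) (map_zero (starHom a)).symm
  -- The two columns of `DK + KD = 1`. On `(η, 0)` the `E`-part is the first homotopy; on `(0, θ)`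
  -- the `E`-part says that `Ψ` is a chain map and the `F`-part is the second homotopy.
  have hinl_eq : ∀ η, Φ.totalD (K (η, 0)) +
      ((-1 : ℝ) • K (E.D η, 0) + K (0, Φ.toLinearMap η)) = (η, 0) := by
    intro η
    refine Eq.trans ?_ (LinearMap.congr_fun hK (η, 0))
    rw [← map_smul, ← map_add]
    change _ = Φ.totalD (K (η, 0)) + K (Φ.totalD (η, 0))
    congr 2
    refine Prod.ext (add_zero _) ?_
    change (-1 : ℝ) • (0 : 𝒢.TotalCochains F.bundle) + Φ.toLinearMap η =
      Φ.toLinearMap η + F.D 0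
    rw [smul_zero, zero_add, map_zero, add_zero]
  have hinr_eq : ∀ θ, Φ.totalD (K (0, θ)) + K (0, F.D θ) = (0, θ) := by
    intro θ
    refine Eq.trans ?_ (LinearMap.congr_fun hK (0, θ))
    change _ = Φ.totalD (K (0, θ)) + K (Φ.totalD (0, θ))
    congr 2
    rw [totalD_apply, map_zero, smul_zero, map_zero, zero_add]
  let Ψ : Hom F E :=
    { toLinearMap := LinearMap.fst ℝ (𝒢.TotalCochains E.bundle) (𝒢.TotalCochains F.bundle) ∘ₗ K ∘ₗ
        LinearMap.inr ℝ (𝒢.TotalCochains E.bundle) (𝒢.TotalCochains F.bundle)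
      degree_zero := fun n θ hθ => by
        have h := (hinr n θ hθ).1
        rwa [sub_add_cancel] at h
      map_star := fun θ m a => congrArg Prod.fst (hinr_star θ m a)
      comm := fun θ => by
        have h : (-1 : ℝ) • E.D (K (0, θ)).1 + (K (0, F.D θ)).1 = 0 :=
          congrArg Prod.fst (hinr_eq θ)
        change (K (0, F.D θ)).1 = E.D (K (0, θ)).1
        rw [neg_one_smul_totalCochains] at h
        exact neg_add_eq_zero.1 h |>.symm }
  refine ⟨Ψ, ⟨LinearMap.fst ℝ (𝒢.TotalCochains E.bundle) (𝒢.TotalCochains F.bundle) ∘ₗ K ∘ₗ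
      LinearMap.inl ℝ (𝒢.TotalCochains E.bundle) (𝒢.TotalCochains F.bundle),
      fun n η hη => ?_, fun η m a => congrArg Prod.fst (hinl_star η m a), fun η => ?_⟩,
    -- The `F`-part reads `ΦΨ + DK' + K'D = 1` for the component `K'` of `K`, so the homotopy from
    -- `ΦΨ` to the identity is `-K'`.
    ⟨LinearMap.negOne _ ∘ₗ LinearMap.snd ℝ (𝒢.TotalCochains E.bundle) (𝒢.TotalCochains F.bundle) ∘ₗ
      K ∘ₗ LinearMap.inr ℝ (𝒢.TotalCochains E.bundle) (𝒢.TotalCochains F.bundle),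
      fun n θ hθ => Submodule.smul_mem _ _ (hinr n θ hθ).2, fun θ m a => ?_, fun θ => ?_⟩⟩
  · have h := (hinl n η hη).1
    rwa [sub_add_cancel] at h
  · have h : (-1 : ℝ) • E.D (K (η, 0)).1 +
        ((-1 : ℝ) • (K (E.D η, 0)).1 + (K (0, Φ.toLinearMap η)).1) = η :=
      congrArg Prod.fst (hinl_eq η)
    change (K (0, Φ.toLinearMap η)).1 - η = E.D (K (η, 0)).1 + (K (E.D η, 0)).1
    rw [neg_one_smul_totalCochains, neg_one_smul_totalCochains] at h
    refine (congrArg (fun w => (K (0, Φ.toLinearMap η)).1 - w) h.symm).trans ?_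
    abel
  · change (-1 : ℝ) • (K (0, 𝒢.star θ a)).2 = starHom a ((-1 : ℝ) • (K (0, θ)).2)
    rw [map_smul, hinr_star]
    rfl
  · have h : Φ.toLinearMap (K (0, θ)).1 + F.D (K (0, θ)).2 + (K (0, F.D θ)).2 = θ :=
      congrArg Prod.snd (hinr_eq θ)
    change Φ.toLinearMap (K (0, θ)).1 - θ =
      F.D ((-1 : ℝ) • (K (0, θ)).2) + (-1 : ℝ) • (K (0, F.D θ)).2
    rw [map_smul, neg_one_smul_totalCochains, neg_one_smul_totalCochains]
    refine (congrArg (fun w => Φ.toLinearMap (K (0, θ)).1 - w) h.symm).trans ?_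
    abel

end Hom

end RepUpToHomotopy

end Groupoid

end

noncomputable section

section Groupoid

variable {EM : Type*} [NormedAddCommGroup EM] [NormedSpace ℝ EM] [FiniteDimensional ℝ EM]
  {M : Type*} [TopologicalSpace M] [ChartedSpace EM M] [IsManifold 𝓘(ℝ, EM) ∞ M] [T2Space M]
  {EG : Type*} [NormedAddCommGroup EG] [NormedSpace ℝ EG]
  {G : Type*} [TopologicalSpace G] [ChartedSpace EG G]
  {𝒢 : LieGroupoid EM M EG G}

namespace RepUpToHomotopy

open LieGroupoid

variable {E : RepUpToHomotopy 𝒢} {F : RepUpToHomotopy 𝒢}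

namespace Hom

variable {Φ : Hom E F}

namespace IsQuasiIso

/-! ### The operator induced by the fibrewise contraction -/

variable (hΦ : Φ.IsQuasiIso) (e : ∀ l, SmoothFrame 𝒢 E.bundle l)
  (f : ∀ l, SmoothFrame 𝒢 F.bundle l)

/-- The component `E → E` of the fibrewise contraction. -/
def contractionEE : FibreMap 𝒢 E.bundle E.bundle (-1) where
  toFun l m x := LinearMap.fst ℝ _ _ ∘ₗ Φ.coneH e f l (l - 1) m (m - 1) x ∘ₗ LinearMap.inl ℝ _ _
  smooth l _ hη := (e l).isSmoothSection_map (e (l + -1)) (fun i j => by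
    simpa only [Frame.mat_prod] using! hΦ.coneH_mem e f (p := l) (q := l - 1) (p' := l + -1)
      (q' := l + -1 - 1) (by omega) (by omega) (by omega) (Sum.inl i) (Sum.inl j)) hη

/-- The component `F → E` of the fibrewise contraction. -/
def contractionFE : FibreMap 𝒢 F.bundle E.bundle 0 where
  toFun l m x := LinearMap.fst ℝ _ _ ∘ₗ Φ.coneH e f (l + 1) l m (m - 1) x ∘ₗ LinearMap.inr ℝ _ _
  smooth l _ hη := (f l).isSmoothSection_map (e (l + 0)) (fun i j => by
    simpa only [Frame.mat_prod] using! hΦ.coneH_mem e f (p := l + 1) (q := l) (p' := l + 0)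
      (q' := l + 0 - 1) (by omega) (by omega) (by omega) (Sum.inl i) (Sum.inr j)) hη

/-- The component `E → F` of the fibrewise contraction. -/
def contractionEF : FibreMap 𝒢 E.bundle F.bundle (-2) where
  -- In the cone `E^l` sits in degree `l - 1` and `F^m` in degree `m`, so lowering the cone degree
  -- by one means `m = l - 2`.
  toFun l m x := LinearMap.snd ℝ _ _ ∘ₗ Φ.coneH e f l (l - 1) (m + 1) m x ∘ₗ LinearMap.inl ℝ _ _
  smooth l _ hη := (e l).isSmoothSection_map (f (l + -2)) (fun i j => by
    simpa only [Frame.mat_prod] using! hΦ.coneH_mem e f (p := l) (q := l - 1) (p' := l + -2 + 1)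
      (q' := l + -2) (by omega) (by omega) (by omega) (Sum.inr i) (Sum.inl j)) hη

/-- The component `F → F` of the fibrewise contraction. -/
def contractionFF : FibreMap 𝒢 F.bundle F.bundle (-1) where
  toFun l m x := LinearMap.snd ℝ _ _ ∘ₗ Φ.coneH e f (l + 1) l (m + 1) m x ∘ₗ LinearMap.inr ℝ _ _
  smooth l _ hη := (f l).isSmoothSection_map (f (l + -1)) (fun i j => by
    simpa only [Frame.mat_prod] using! hΦ.coneH_mem e f (p := l + 1) (q := l)
      (p' := l + -1 + 1) (q' := l + -1) (by omega) (by omega) (by omega)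
      (Sum.inr i) (Sum.inr j)) hη

/-- The operator on the mapping cone given by the fibrewise contraction. -/
def totalH : Module.End ℝ Φ.Cone :=
  ((hΦ.contractionEE e f).op ∘ₗ
      LinearMap.fst ℝ (𝒢.TotalCochains E.bundle) (𝒢.TotalCochains F.bundle) +
    (hΦ.contractionFE e f).op ∘ₗ
      LinearMap.snd ℝ (𝒢.TotalCochains E.bundle) (𝒢.TotalCochains F.bundle)).prod
  ((hΦ.contractionEF e f).op ∘ₗ
      LinearMap.fst ℝ (𝒢.TotalCochains E.bundle) (𝒢.TotalCochains F.bundle) +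
    (hΦ.contractionFF e f).op ∘ₗ
      LinearMap.snd ℝ (𝒢.TotalCochains E.bundle) (𝒢.TotalCochains F.bundle))

theorem totalH_apply (z : Φ.Cone) : hΦ.totalH e f z =
    ((hΦ.contractionEE e f).op z.1 + (hΦ.contractionFE e f).op z.2,
      (hΦ.contractionEF e f).op z.1 + (hΦ.contractionFF e f).op z.2) := rfl

theorem totalH_mem_coneDegree {n n' : ℤ} (hn : n - 1 = n') {z : Φ.Cone}
    (hz : z ∈ Φ.coneDegree n) : hΦ.totalH e f z ∈ Φ.coneDegree n' :=
  ⟨Submodule.add_mem _ (FibreMap.op_mem_totalDegree _ (by omega) hz.1)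
      (FibreMap.op_mem_totalDegree _ (by omega) hz.2),
    Submodule.add_mem _ (FibreMap.op_mem_totalDegree _ (by omega) hz.1)
      (FibreMap.op_mem_totalDegree _ (by omega) hz.2)⟩

theorem totalH_totalStar {m : ℕ} (a : 𝒢.Functions m) (z : Φ.Cone) :
    hΦ.totalH e f (Φ.totalStar a z) = Φ.totalStar a (hΦ.totalH e f z) := by
  have h1 : ∀ η θ : 𝒢.TotalCochains E.bundle, 𝒢.star (η + θ) a = 𝒢.star η a + 𝒢.star θ a :=
    map_add (starHom a)
  have h2 : ∀ η θ : 𝒢.TotalCochains F.bundle, 𝒢.star (η + θ) a = 𝒢.star η a + 𝒢.star θ a :=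
    map_add (starHom a)
  simp only [totalH_apply, totalStar_apply, FibreMap.op_star, h1, h2]

/-- The leading term of `totalH` is the fibrewise contraction; the work is to match the indices at
which its four blocks were taken. -/
theorem coneValue_totalH {p q p' q' : ℤ} (hp : p = q + 1) (hp' : p' = p - 1) (hq' : q' = q - 1)
    (x : M) (z : Φ.Cone) : Φ.coneValue p' q' x (hΦ.totalH e f z) =
      Φ.coneH e f p q p' q' x (Φ.coneValue p q x z) := by
  have hsplit : Φ.coneValue p q x z = (objValue p x z.1, 0) + (0, objValue q x z.2) :=
    Prod.ext (add_zero _).symm (zero_add _).symm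
  have hq : ∀ q₀ q₀', q₀ = q → q₀' = q' → ∀ v,
      (Φ.coneH e f p q₀ p' q₀' x (v, 0)).1 = (Φ.coneH e f p q p' q' x (v, 0)).1 := by
    rintro _ _ rfl rfl v; rfl
  have hpq : ∀ p₀ q₀', p₀ = p → q₀' = q' → ∀ v,
      (Φ.coneH e f p₀ q p' q₀' x (0, v)).1 = (Φ.coneH e f p q p' q' x (0, v)).1 := by
    rintro _ _ rfl rfl v; rfl
  have hqp : ∀ q₀ p₀', q₀ = q → p₀' = p' → ∀ v,
      (Φ.coneH e f p q₀ p₀' q' x (v, 0)).2 = (Φ.coneH e f p q p' q' x (v, 0)).2 := by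
    rintro _ _ rfl rfl v; rfl
  have hpp : ∀ p₀ p₀', p₀ = p → p₀' = p' → ∀ v,
      (Φ.coneH e f p₀ q p₀' q' x (0, v)).2 = (Φ.coneH e f p q p' q' x (0, v)).2 := by
    rintro _ _ rfl rfl v; rfl
  rw [hsplit, map_add]
  refine Prod.ext ?_ ?_
  · change objValue p' x ((hΦ.contractionEE e f).op z.1 + (hΦ.contractionFE e f).op z.2) = _ + _
    rw [map_add, FibreMap.objValue_op _ (l := p) (by omega),
      FibreMap.objValue_op _ (l := q) (by omega)]
    exact congrArg₂ _ (hq _ _ (by omega) (by omega) _) (hpq _ _ (by omega) (by omega) _)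
  · change objValue q' x ((hΦ.contractionEF e f).op z.1 + (hΦ.contractionFF e f).op z.2) = _ + _
    rw [map_add, FibreMap.objValue_op _ (l := p) (by omega),
      FibreMap.objValue_op _ (l := q) (by omega)]
    exact congrArg₂ _ (hqp _ _ (by omega) (by omega) _) (hpp _ _ (by omega) (by omega) _)

/-! ### The error term and the corrected contraction -/

/-- The failure of `totalH` to be a contraction of the mapping cone. -/
def totalN : Module.End ℝ Φ.Cone :=
  1 + LinearMap.negOne Φ.Cone * (Φ.totalD * hΦ.totalH e f + hΦ.totalH e f * Φ.totalD)

theorem totalN_apply (z : Φ.Cone) : hΦ.totalN e f z =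
    z + (-1 : ℝ) • (Φ.totalD (hΦ.totalH e f z) + hΦ.totalH e f (Φ.totalD z)) := rfl

theorem totalN_mem_coneDegree {n : ℤ} {z : Φ.Cone} (hz : z ∈ Φ.coneDegree n) :
    hΦ.totalN e f z ∈ Φ.coneDegree n :=
  Submodule.add_mem _ hz (Submodule.smul_mem _ _ (Submodule.add_mem _
    (Φ.totalD_mem_coneDegree (by omega) (hΦ.totalH_mem_coneDegree e f rfl hz))
    (hΦ.totalH_mem_coneDegree e f (by omega) (Φ.totalD_mem_coneDegree rfl hz))))

/-- `DH` contributes the Leibniz correction with sign `(-1)^(n-1)` and `HD` with `(-1)^n`, on the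
same element `(Hz) ⋆ δa`; they cancel. -/
theorem commute_totalN_totalStar {m : ℕ} (a : 𝒢.Functions m) :
    Commute (hΦ.totalN e f) (Φ.totalStar a) := by
  refine Φ.cone_ext fun n z hz => ?_
  have h1 := Φ.totalD_totalStar (hΦ.totalH_mem_coneDegree e f rfl hz) a
  have h2 := congrArg (hΦ.totalH e f) (Φ.totalD_totalStar hz a)
  rw [map_add, map_smul, totalH_totalStar, totalH_totalStar] at h2
  have h3 : ∀ w : Φ.Cone, (-1 : ℝ) ^ n • w = (-1 : ℝ) • (-1 : ℝ) ^ (n - 1) • w := by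
    intro w
    rw [smul_smul, ← zpow_one_add₀ (by norm_num : (-1 : ℝ) ≠ 0), add_sub_cancel]
  rw [Module.End.mul_apply, Module.End.mul_apply, totalN_apply, totalN_apply, totalH_totalStar,
    h1, h2, h3, map_add, map_smul, map_add, add_add_add_comm,
    add_comm ((-1 : ℝ) ^ (n - 1) • _), neg_one_smul_add, add_zero]

/-- The leading term of `DH + HD` is `dh + hd`, the identity by fibrewise contraction. -/
theorem coneValue_totalN {n : ℤ} {z : Φ.Cone} (hz : z ∈ Φ.coneDegree n) (x : M) :
    Φ.coneValue (n + 1) n x (hΦ.totalN e f z) = 0 := by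
  rw [totalN_apply, map_add, map_smul, map_add,
    Φ.coneValue_totalD e f (p := n) (by omega) _ _ x (hΦ.totalH_mem_coneDegree e f rfl hz),
    hΦ.coneValue_totalH e f (p := n + 1) (q := n) rfl (by omega) rfl,
    hΦ.coneValue_totalH e f (p := n + 1 + 1) (q := n + 1) rfl (by omega) (by omega),
    Φ.coneValue_totalD e f rfl _ _ x hz,
    hΦ.coneH_spec e f rfl (by omega) rfl rfl rfl]
  exact (add_comm _ _).trans (neg_one_smul_add _)

/-- The mapping cone of a quasi-isomorphism is contractible. -/
theorem exists_contraction (hΦ : Φ.IsQuasiIso) (e : ∀ l, SmoothFrame 𝒢 E.bundle l)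
    (f : ∀ l, SmoothFrame 𝒢 F.bundle l) : ∃ K : Module.End ℝ Φ.Cone,
    (∀ (m : ℕ) (a : 𝒢.Functions m), Commute K (Φ.totalStar a)) ∧
    (∀ n, ∀ z ∈ Φ.coneDegree n, K z ∈ Φ.coneDegree (n - 1)) ∧
    Φ.totalD * K + K * Φ.totalD = 1 := by
  have hstar := fun (m : ℕ) (a : 𝒢.Functions m) => hΦ.commute_totalN_totalStar e f a
  obtain ⟨n, hn⟩ := Φ.exists_pow_eq_zero (N := hΦ.totalN e f) fun l z hz =>
    Φ.map_mem_coneLE e f (fun m a z => LinearMap.congr_fun (hstar m a) z)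
      (fun n z hz => hΦ.totalN_mem_coneDegree e f hz)
      (fun n z hz x => hΦ.coneValue_totalN e f hz x) hz
  -- The geometric series inverts `DH + HD = 1 - N`, and composing with `H` keeps linearity over
  -- `C(G)` and degree `-1`, as `N` has degree zero.
  refine ⟨(∑ i ∈ Finset.range n, hΦ.totalN e f ^ i) * hΦ.totalH e f, fun m a => ?_,
    fun k z hz => ?_, Module.End.contraction_of_isNilpotent Φ.totalD_mul_totalD
      (LinearMap.add_one_add_negOne_mul _) hn⟩
  · exact (Commute.sum_left _ _ _ fun i _ => (hstar m a).pow_left i).mul_left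
      (LinearMap.ext fun z => hΦ.totalH_totalStar e f a z)
  · rw [Module.End.mul_apply, LinearMap.sum_apply]
    refine Submodule.sum_mem _ fun i hi => ?_
    clear hi
    induction i with
    | zero => exact hΦ.totalH_mem_coneDegree e f rfl hz
    | succ i ih =>
      rw [pow_succ', Module.End.mul_apply]
      exact hΦ.totalN_mem_coneDegree e f ih

end IsQuasiIso

end Hom

end RepUpToHomotopy

end Groupoid

end

/-! ### Quasi-isomorphisms are homotopy equivalences -/

theorem mainTheorem8
    {EM : Type*} [NormedAddCommGroup EM] [NormedSpace ℝ EM] [FiniteDimensional ℝ EM]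
    {M : Type*} [TopologicalSpace M] [ChartedSpace EM M] [IsManifold 𝓘(ℝ, EM) ∞ M]
    [T2Space M] [SigmaCompactSpace M]
    {EG : Type*} [NormedAddCommGroup EG] [NormedSpace ℝ EG] [FiniteDimensional ℝ EG]
    {G : Type*} [TopologicalSpace G] [ChartedSpace EG G] [IsManifold 𝓘(ℝ, EG) ∞ G]
    (𝒢 : LieGroupoid EM M EG G) (E F : RepUpToHomotopy 𝒢) (Φ : RepUpToHomotopy.Hom E F)
    (hΦ : Φ.IsQuasiIso) : Φ.IsHomotopyEquiv := by
  obtain ⟨K, hstar, hdeg, hK⟩ := hΦ.exists_contraction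
    (fun l => Classical.choice (nonempty_smoothFrame 𝒢 E.bundle l))
    (fun l => Classical.choice (nonempty_smoothFrame 𝒢 F.bundle l))
  exact RepUpToHomotopy.Hom.isHomotopyEquiv_of_contraction hstar hdeg hK
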